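/- **Setting.** Let $k_1,k_2\ge1$, $D_1,D_2\ge2$ be integers, and for $1\le l_1\le D_1$, $1\le l_2\le D_2$ let $\delta_{l_1},\tilde\delta_{l_2},d_{l_1},\tilde d_{l_2},\Delta_{l_1,l_2}$ be non-negative integers with $\delta_1=\tilde\delta_1=1$, $\delta_{l_1}<\delta_{l_1+1}$, $\tilde\delta_{l_2}<\tilde\delta_{l_2+1}$, $d_{l_1}>(\delta_{l_1}-1)(k_1+1)$, $\tilde d_{l_2}>(\tilde\delta_{l_2}-1)(k_2+1)$ for $1\le l_j\le D_j-1$. Put $d_{l_1,k_1}=d_{l_1}+k_1+1-\delta_{l_1}(k_1+1)$ and $\tilde d_{l_2,k_2}=\tilde d_{l_2}+k_2+1-\tilde\delta_{l_2}(k_2+1)$. Let $Q_1,Q_2,R_0,R_{D_1},R_{D_2},R_{l_1,l_2}\in\mathbb C[X]$ ($1\le l_j\le D_j-1$), put $R_{D_1,D_2}=R_{D_1}R_{D_2}$, and let $P_1(X,\epsilon),P_2(X,\epsilon)$ be polynomials in $X$ whose coefficients are holomorphic in $\epsilon$ on a closed disc $\overline D(0,e_0)$, $e_0>0$. Assume $\deg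 Q_j\ge\deg R_{D_j}$; that $R_{D_1,D_2}$ has degree at least the degrees of $R_{l_1,l_2},R_0,P_1,P_2$; that $Q_j(im)\ne0$ and $R_{D_1,D_2}(im)\neq0$ for all $m\in\mathbb R$; and that $\mu>\max(\deg P_1+1,\deg P_2+1,\deg R_0+1)$. For $j=1,2$ let $r_j,\eta_j>0$ and $d_{Q_j}\in\mathbb R$ be such that $Q_j(im)/R_{D_j}(im)\in\{|z|\ge r_j,\ |\arg z-d_{Q_j}|\le\eta_j\}$ for all $m\in\mathbb R$. Let $\nu_1,\nu_2,C_P>0$. *Domains.* Given $\rho>0$ and open unbounded sectors $S_{d_1},S_{d_2}$ with vertex $0$, put $\Omega_j=\overline D(0,\rho)\cup S_{d_j}$ and $U_j=D(0,\rho)\cup S_{d_j}$. With $(k,\delta,Q,R,r)=(k_1,\delta_{D_1},Q_1,R_{D_1},r_1)$ for $j=1$ and $(k_2,\tilde\delta_{D_2},Q_2,R_{D_2},r_2)$ for $j=2$, write $P_{m,j}(\tau)=Q(im)k-R(im)k^{\delta}\tau^{(\delta-1)k}$. Call $(\rho,S_{d_1},S_{d_2})$ *admissible* (for $C_P$) if,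 for $j=1,2$, $$|P_{m,j}(\tau)|\ge C_P\, r^{\frac1{(\delta-1)k}}\,|R(im)|\,(1+|\tau|^{k})^{(\delta-1)-\frac1k}\qquad(\tau\in\Omega_j,\ m\in\mathbb R).$$ *Norms.* For $\beta>0$ and $\epsilon\ne0$, $F=F^{\boldsymbol d}_{(\boldsymbol\nu,\beta,\mu,\boldsymbol k,\epsilon)}$ is the space of continuous $h(\tau_1,\tau_2,m)$ on $\Omega_1\times\Omega_2\times\mathbb R$, holomorphic in $(\tau_1,\tau_2)$ on $U_1\times U_2$, with $$\|h\|=\sup (1+|m|)^\mu e^{\beta|m|}\prod_{j=1,2}\frac{1+|\tau_j/\epsilon|^{2k_j}}{|\tau_j/\epsilon|}e^{-\nu_j|\tau_j/\epsilon|^{k_j}}\,|h(\tau_1,\tau_2,m)|<\infty .$$ $\|\cdot\|_{(\nu_j,\beta,\mu,k_j,\epsilon)}$ is the analogous norm for functions of $(\tau_j,m)$, and $\|h\|_{(\beta,\mu)}=\sup_m(1+|m|)^\mu e^{\beta|m|}|h(m)|$ is the norm of the space $E_{(\beta,\mu)}$ of continuous functions $h:\mathbb R\to\mathbb C$ for which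 it is finite. *Data.* On $D(0,\epsilon_0)$ let $C_{n_1,n_2}(\cdot,\epsilon)$ $(n_1,n_2\ge0)$ and $F_{n_1,n_2}(\cdot,\epsilon)$ $(n_1,n_2\ge1)$ belong to $E_{(\beta,\mu)}$, with $(\beta,\mu)$-norms at most $K_0T_0^{-n_1-n_2}$ for some $K_0,T_0>0$. Let $$\varphi_{\boldsymbol k}=\sum_{n_1,n_2\ge1}C_{n_1,n_2}\frac{\tau_1^{n_1}\tau_2^{n_2}}{\Gamma(n_1/k_1)\Gamma(n_2/k_2)},\quad \psi_{\boldsymbol k}=\sum_{n_1,n_2\ge1}F_{n_1,n_2}\frac{\tau_1^{n_1}\tau_2^{n_2}}{\Gamma(n_1/k_1)\Gamma(n_2/k_2)},$$ $$\varphi^1_{\boldsymbol k}=\sum_{n\ge1}C_{n,0}\frac{\tau_1^{n}}{\Gamma(n/k_1)},\qquad \varphi^2_{\boldsymbol k}=\sum_{n\ge1}C_{0,n}\frac{\tau_2^{n}}{\Gamma(n/k_2)}.$$ *Equation.* All integrals $\int_0^{\tau^k}$, $\int_0^s$ are along segments, and roots are the branches with $(\tau^k)^{1/k}=\tau$, so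 $s^{1/k}=t^{1/k}\tau$ and $(\tau^k-s)^{1/k}=(1-t)^{1/k}\tau$ for $s=t\tau^k$. Let $A_{\delta,p}$ be the integers with $T^{\delta(k_1+1)}\partial_T^{\delta}=(T^{k_1+1}\partial_T)^{\delta}+\sum_{1\le p\le\delta-1}A_{\delta,p}T^{k_1(\delta-p)}(T^{k_1+1}\partial_T)^p$, and $\tilde A_{\delta,p}$ the same numbers for $k_2$. Put $$\mathcal A_{D_1}\omega=\sum_{1\le p\le\delta_{D_1}-1}\frac{A_{\delta_{D_1},p}\,\tau_1^{k_1}}{\Gamma(\delta_{D_1}-p)}\int_0^{\tau_1^{k_1}}(\tau_1^{k_1}-s_1)^{\delta_{D_1}-p-1}k_1^{p}s_1^{p}\,\omega(s_1^{1/k_1},\tau_2,m)\frac{ds_1}{s_1}$$ and define $\tilde{\mathcal A}_{D_2}$ in the same way in $\tau_2$, with $k_2,\tilde\delta_{D_2},\tilde A$. Let $f*g(m)=(2\pi)^{-1/2}\int_{\mathbb R}f(m-m_1)g(m_1)\,dm_1$ and $$\mathcal V[G]=\frac{\tau_1^{k_1}\tau_2^{k_2}}{\Gamma(1+\frac1{k_1})\Gamma(1+\frac1{k_2})}\int_0^{\tau_1^{k_1}}\!\!\int_0^{\tau_2^{k_2}}(\tau_1^{k_1}-s_1)^{1/k_1}(\tau_2^{k_2}-s_2)^{1/k_2}\,G(s_1,s_2)\frac{ds_2}{s_2}\frac{ds_1}{s_1}.$$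 With $L_1=Q_1(im)k_1\tau_1^{k_1}-(k_1\tau_1^{k_1})^{\delta_{D_1}}R_{D_1}(im)$ and $L_2=Q_2(im)k_2\tau_2^{k_2}-(k_2\tau_2^{k_2})^{\tilde\delta_{D_2}}R_{D_2}(im)$, the equation for $\omega$ is $$\begin{aligned}L_1L_2\,\omega={}&L_1R_{D_2}(im)\tilde{\mathcal A}_{D_2}\omega+L_2R_{D_1}(im)\mathcal A_{D_1}\omega-R_{D_1}(im)R_{D_2}(im)\mathcal A_{D_1}\tilde{\mathcal A}_{D_2}\omega\\ &+\epsilon^{-2}\,\mathcal V\Big[s_1s_2\int_0^{s_1}\!\!\int_0^{s_2}\frac{\big(P_1(i\cdot,\epsilon)\omega((s_1-x_1)^{1/k_1},(s_2-x_2)^{1/k_2},\cdot)\big)*\big(P_2(i\cdot,\epsilon)\omega(x_1^{1/k_1},x_2^{1/k_2},\cdot)\big)(m)}{(s_1-x_1)x_1(s_2-x_2)x_2}dx_2dx_1\Big]\\ &+\sum_{\substack{1\le l_1\le D_1-1\\1\le l_2\le D_2-1}}R_{l_1,l_2}(im)\,\epsilon^{\Delta_{l_1,l_2}-d_{l_1}-\tilde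 d_{l_2}+\delta_{l_1}+\tilde\delta_{l_2}-2}\frac{\tau_1^{k_1}\tau_2^{k_2}}{\Gamma(d_{l_1,k_1}/k_1)\Gamma(\tilde d_{l_2,k_2}/k_2)}\\ &\quad\times\int_0^{\tau_1^{k_1}}\!\!\int_0^{\tau_2^{k_2}}(\tau_1^{k_1}-s_1)^{\frac{d_{l_1,k_1}}{k_1}-1}(\tau_2^{k_2}-s_2)^{\frac{\tilde d_{l_2,k_2}}{k_2}-1}k_1^{\delta_{l_1}}k_2^{\tilde\delta_{l_2}}s_1^{\delta_{l_1}}s_2^{\tilde\delta_{l_2}}\,\omega(s_1^{1/k_1},s_2^{1/k_2},m)\frac{ds_2}{s_2}\frac{ds_1}{s_1}\\ &+\epsilon^{-2}\,\mathcal V\Big[s_1s_2\int_0^{s_1}\!\!\int_0^{s_2}\frac{\varphi_{\boldsymbol k}((s_1-x_1)^{1/k_1},(s_2-x_2)^{1/k_2},\cdot,\epsilon)*\big(R_0(i\cdot)\omega(x_1^{1/k_1},x_2^{1/k_2},\cdot)\big)(m)}{(s_1-x_1)x_1(s_2-x_2)x_2}dx_2dx_1\Big]\\ &+\epsilon^{-2}\,\mathcal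 V\Big[s_1\int_0^{s_1}\frac{\varphi^1_{\boldsymbol k}((s_1-x_1)^{1/k_1},\cdot,\epsilon)*\big(R_0(i\cdot)\omega(x_1^{1/k_1},s_2^{1/k_2},\cdot)\big)(m)}{(s_1-x_1)x_1}dx_1\Big]\\ &+\epsilon^{-2}\,\mathcal V\Big[s_2\int_0^{s_2}\frac{\varphi^2_{\boldsymbol k}((s_2-x_2)^{1/k_2},\cdot,\epsilon)*\big(R_0(i\cdot)\omega(s_1^{1/k_1},x_2^{1/k_2},\cdot)\big)(m)}{(s_2-x_2)x_2}dx_2\Big]\\ &+\epsilon^{-2}\,\mathcal V\big[C_{0,0}(\cdot,\epsilon)*\big(R_0(i\cdot)\omega(s_1^{1/k_1},s_2^{1/k_2},\cdot)\big)(m)\big]+\epsilon^{-2}\,\mathcal V\big[\psi_{\boldsymbol k}(s_1^{1/k_1},s_2^{1/k_2},m,\epsilon)\big].\end{aligned}\tag{E}$$ **Proposition.** Assume that for all $1\le l_1\le D_1-1$, $1\le l_2\le D_2-1$, $$\delta_{D_1}\ge\delta_{l_1}+\frac2{k_1},\qquad\tilde\delta_{D_2}\ge\tilde\delta_{l_2}+\frac2{k_2},\qquad\Delta_{l_1,l_2}+k_1(1-\delta_{D_1})+k_2(1-\tilde\delta_{D_2})+2\ge0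 .$$ Then for every sufficiently small $\epsilon_0>0$ there are constants $\varpi,\zeta_1,\zeta_2,\zeta_1^1,\zeta_1^2,\zeta_1^0>0$ such that the following holds for every $\beta>0$, every admissible $(\rho,S_{d_1},S_{d_2})$ and all data as above. If $$\|\varphi_{\boldsymbol k}\|_{(\boldsymbol\nu,\beta,\mu,\boldsymbol k,\epsilon)}\le\zeta_1,\ \ \|\psi_{\boldsymbol k}\|_{(\boldsymbol\nu,\beta,\mu,\boldsymbol k,\epsilon)}\le\zeta_2,\ \ \|\varphi^1_{\boldsymbol k}\|_{(\nu_1,\beta,\mu,k_1,\epsilon)}\le\zeta^1_1,\ \ \|\varphi^2_{\boldsymbol k}\|_{(\nu_2,\beta,\mu,k_2,\epsilon)}\le\zeta_1^2,\ \ \|C_{0,0}\|_{(\beta,\mu)}\le\zeta_1^0$$ for all $\epsilon\in D(0,\epsilon_0)\setminus\{0\}$, then for every $\epsilon\in D(0,\epsilon_0)\setminus\{0\}$ equation (E) has exactly one solution $\omega^{\boldsymbol d}_{\boldsymbol k}(\cdot,\epsilon)$ in the closed ball $\{\|\omega\|\le\varpi\}$ of $F^{\boldsymbol d}_{(\boldsymbol\nu,\beta,\mu,\boldsymbol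 k,\epsilon)}$. The smallness threshold for $\epsilon_0$ and the constants depend only on the exponents and polynomials of the problem and on $\mu,\boldsymbol\nu,C_P,r_j,d_{Q_j},\eta_j,e_0$ (the constants also on $\epsilon_0$); in particular they do not depend on $\epsilon$, $\beta$, $\rho$, the sectors $S_{d_j}$ or the data. -/

import Mathlib

open scoped Polynomial ENNReal

noncomputable section

namespace BorelPlane

/-! ### Sectors, domains and function spaces -/

/-- Open unbounded sector with vertex `0`, bisecting direction `d` and half-opening `θ`. -/
def openSector (d θ : ℝ) : Set ℂ :=
  {z | ∃ r φ : ℝ, 0 < r ∧ |φ - d| < θ ∧ z = r * Complex.exp (Complex.I * φ)}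

/-- Closed unbounded sector truncated at the origin:
`|z| ≥ r` and `|arg z - d| ≤ η` for a determination of the argument. -/
def truncSector (r d η : ℝ) : Set ℂ :=
  {z | r ≤ ‖z‖ ∧ ∃ φ : ℝ, |φ - d| ≤ η ∧ z = ‖z‖ * Complex.exp (Complex.I * φ)}

/-- `D(0,ρ) ∪ S_d`. -/
def openDom (ρ d θ : ℝ) : Set ℂ := Metric.ball 0 ρ ∪ openSector d θ

/-- The closed disc of radius `ρ` together with `S_d`. -/
def closedDom (ρ d θ : ℝ) : Set ℂ := Metric.closedBall 0 ρ ∪ openSector d θ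

/-- `(1+|m|)^μ exp(β|m|)`. -/
def weightE (β μ m : ℝ) : ℝ≥0∞ :=
  ENNReal.ofReal ((1 + |m|) ^ μ * Real.exp (β * |m|))

/-- `((1+|τ/ε|^{2k}) / |τ/ε|) exp(-ν|τ/ε|^k)`; it is `∞` at `τ = 0`. -/
def weightF (ν : ℝ) (k : ℕ) (ε τ : ℂ) : ℝ≥0∞ :=
  ENNReal.ofReal (1 + ‖τ / ε‖ ^ (2 * k)) / ENNReal.ofReal ‖τ / ε‖
    * ENNReal.ofReal (Real.exp (-(ν * ‖τ / ε‖ ^ k)))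

/-- The norm of `E_{(β,μ)}`. -/
def normE (β μ : ℝ) (h : ℝ → ℂ) : ℝ≥0∞ := ⨆ m : ℝ, weightE β μ m * ‖h m‖ₑ

/-- Membership in the Banach space `E_{(β,μ)}`. -/
def MemE (β μ : ℝ) (h : ℝ → ℂ) : Prop := Continuous h ∧ normE β μ h < ∞

/-- The norm of `F^{d}_{(ν,β,μ,k,ε)}` in one Borel variable, on the domain `Ω`.
Since `∞ * 0 = 0`, its finiteness forces `h` to vanish at `τ = 0`. -/
def normF₁ (Ω : Set ℂ) (ν β μ : ℝ) (k : ℕ) (ε : ℂ) (h : ℂ → ℝ → ℂ) : ℝ≥0∞ :=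
  ⨆ τ ∈ Ω, ⨆ m : ℝ, weightE β μ m * weightF ν k ε τ * ‖h τ m‖ₑ

/-- The norm of `F^{𝐝}_{(𝛎,β,μ,𝐤,ε)}` in two Borel variables, on the domain `Ω₁ × Ω₂`.
Since `∞ * 0 = 0`, its finiteness forces `h` to vanish when `τ₁ = 0` or `τ₂ = 0`. -/
def normF (Ω₁ Ω₂ : Set ℂ) (ν₁ ν₂ β μ : ℝ) (k₁ k₂ : ℕ) (ε : ℂ) (h : ℂ → ℂ → ℝ → ℂ) : ℝ≥0∞ :=
  ⨆ τ₁ ∈ Ω₁, ⨆ τ₂ ∈ Ω₂, ⨆ m : ℝ,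
    weightE β μ m * (weightF ν₁ k₁ ε τ₁ * weightF ν₂ k₂ ε τ₂) * ‖h τ₁ τ₂ m‖ₑ

/-- Membership in `F^{𝐝}_{(𝛎,β,μ,𝐤,ε)}`, where `U_j = D(0,ρ) ∪ S_{d_j}` and `Ω_j` is the closed
disc together with `S_{d_j}`: continuity on `Ω₁ × Ω₂ × ℝ`, holomorphy in `(τ₁,τ₂)` on `U₁ × U₂`,
finite norm. -/
structure MemF (U₁ U₂ Ω₁ Ω₂ : Set ℂ) (ν₁ ν₂ β μ : ℝ) (k₁ k₂ : ℕ) (ε : ℂ)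
    (h : ℂ → ℂ → ℝ → ℂ) : Prop where
  continuousOn : ContinuousOn (fun p : (ℂ × ℂ) × ℝ => h p.1.1 p.1.2 p.2)
    ((Ω₁ ×ˢ Ω₂) ×ˢ Set.univ)
  holomorphic : ∀ m : ℝ, DifferentiableOn ℂ (fun p : ℂ × ℂ => h p.1 p.2 m) (U₁ ×ˢ U₂)
  norm_lt_top : normF Ω₁ Ω₂ ν₁ ν₂ β μ k₁ k₂ ε h < ∞

/-! ### Borel transforms of the coefficient series -/

/-- `∑_{n₁,n₂ ≥ 1} a_{n₁,n₂} τ₁^{n₁}/Γ(n₁/k₁) τ₂^{n₂}/Γ(n₂/k₂)`. -/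
def borel₂ (k₁ k₂ : ℕ) (a : ℕ → ℕ → ℂ) (τ₁ τ₂ : ℂ) : ℂ :=
  ∑' n : ℕ × ℕ, a (n.1 + 1) (n.2 + 1)
    * (τ₁ ^ (n.1 + 1) / (Real.Gamma (((n.1 + 1 : ℕ) : ℝ) / k₁) : ℂ))
    * (τ₂ ^ (n.2 + 1) / (Real.Gamma (((n.2 + 1 : ℕ) : ℝ) / k₂) : ℂ))

/-- `∑_{n ≥ 1} a_n τ^n/Γ(n/k)`. -/
def borel₁ (k : ℕ) (a : ℕ → ℂ) (τ : ℂ) : ℂ :=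
  ∑' n : ℕ, a (n + 1) * (τ ^ (n + 1) / (Real.Gamma (((n + 1 : ℕ) : ℝ) / k) : ℂ))

/-! ### The coefficients `A_{δ,p}` -/

/-- The integers `A_{δ,p}` of the expansion
`T^{δ(k+1)} ∂^δ = ∑_{p ≤ δ} A_{δ,p} T^{k(δ-p)} (T^{k+1} ∂)^p`, see `irregCoeff_spec`. -/
def irregCoeff (k : ℕ) : ℕ → ℕ → ℤ
  | 0, 0 => 1
  | 0, _ + 1 => 0
  | δ + 1, 0 => -(δ : ℤ) * irregCoeff k δ 0
  | δ + 1, p + 1 => irregCoeff k δ p - ((p + 1) * k + δ) * irregCoeff k δ (p + 1)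

theorem irregCoeff_of_lt (k : ℕ) : ∀ δ p : ℕ, δ < p → irregCoeff k δ p = 0
  | 0, 0, h => absurd h (lt_irrefl _)
  | 0, _ + 1, _ => by simp [irregCoeff]
  | δ + 1, 0, h => absurd h (Nat.not_lt_zero _)
  | δ + 1, p + 1, h => by
      rw [irregCoeff, irregCoeff_of_lt k δ p (by omega), irregCoeff_of_lt k δ (p + 1) (by omega)]
      simp

theorem irregCoeff_self (k : ℕ) : ∀ δ : ℕ, irregCoeff k δ δ = 1
  | 0 => by simp [irregCoeff]
  | δ + 1 => by
      rw [irregCoeff, irregCoeff_self k δ, irregCoeff_of_lt k δ (δ + 1) (by omega)]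
      simp

theorem irregCoeff_zero_right (k : ℕ) : ∀ δ : ℕ, irregCoeff k (δ + 1) 0 = 0
  | 0 => by simp [irregCoeff]
  | δ + 1 => by rw [irregCoeff, irregCoeff_zero_right k δ]; simp

/-- The operator `T^{k+1} ∂_T`. -/
def irregOp (k : ℕ) (g : ℂ[X]) : ℂ[X] := Polynomial.X ^ (k + 1) * Polynomial.derivative g

theorem irregOp_mul (k : ℕ) (g h : ℂ[X]) : irregOp k (g * h) = irregOp k g * h + g * irregOp k h := by
  simp only [irregOp, Polynomial.derivative_mul]
  ring

theorem irregOp_X_pow (k n : ℕ) :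
    irregOp k (Polynomial.X ^ n) = (n : ℂ[X]) * Polynomial.X ^ (n + k) := by
  cases n with
  | zero => simp [irregOp]
  | succ n =>
    simp only [irregOp, Polynomial.derivative_X_pow, Nat.add_sub_cancel, map_natCast]
    ring

theorem irregOp_sum (k : ℕ) (s : Finset ℕ) (u : ℕ → ℂ[X]) :
    irregOp k (∑ p ∈ s, u p) = ∑ p ∈ s, irregOp k (u p) := by
  simp [irregOp, Finset.mul_sum]

/-- The operator identity that determines the `A_{δ,p}`. -/
theorem irregCoeff_spec (k δ : ℕ) (f : ℂ[X]) :
    Polynomial.X ^ (δ * (k + 1)) * Polynomial.derivative^[δ] f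
      = ∑ p ∈ Finset.range (δ + 1),
          (irregCoeff k δ p : ℂ[X]) * Polynomial.X ^ (k * (δ - p)) * (irregOp k)^[p] f := by
  induction δ with
  | zero => simp [irregCoeff]
  | succ δ ih =>
    have h1 : Polynomial.X ^ ((δ + 1) * (k + 1)) * Polynomial.derivative^[δ + 1] f
        = irregOp k (Polynomial.X ^ (δ * (k + 1)) * Polynomial.derivative^[δ] f)
          - ((k + 1) * δ : ℂ[X]) * Polynomial.X ^ k
            * (Polynomial.X ^ (δ * (k + 1)) * Polynomial.derivative^[δ] f) := by
      rw [Function.iterate_succ_apply', irregOp_mul, irregOp_X_pow, irregOp]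
      push_cast
      ring
    have h2 : ∀ p ∈ Finset.range (δ + 1),
        irregOp k ((irregCoeff k δ p : ℂ[X]) * Polynomial.X ^ (k * (δ - p)) * (irregOp k)^[p] f)
          - ((k + 1) * δ : ℂ[X]) * Polynomial.X ^ k
            * ((irregCoeff k δ p : ℂ[X]) * Polynomial.X ^ (k * (δ - p)) * (irregOp k)^[p] f)
        = (irregCoeff k δ p : ℂ[X]) * Polynomial.X ^ (k * (δ - p)) * (irregOp k)^[p + 1] f
          - ((p * k + δ : ℂ[X]) * (irregCoeff k δ p : ℂ[X])) * Polynomial.X ^ (k * (δ + 1 - p))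
            * (irregOp k)^[p] f := by
      intro p hp
      obtain ⟨q, rfl⟩ : ∃ q, δ = p + q := ⟨δ - p, by simp at hp; omega⟩
      rw [Function.iterate_succ_apply', irregOp_mul, irregOp_mul, irregOp_X_pow]
      rw [show p + q + 1 - p = q + 1 by omega, show p + q - p = q by omega,
        show irregOp k (irregCoeff k (p + q) p : ℂ[X]) = 0 by simp [irregOp]]
      push_cast
      ring
    have h4 : ∑ p ∈ Finset.range (δ + 1),
          ((p * k + δ : ℂ[X]) * (irregCoeff k δ p : ℂ[X])) * Polynomial.X ^ (k * (δ + 1 - p))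
            * (irregOp k)^[p] f
        = ∑ p ∈ Finset.range (δ + 1),
          (((p + 1) * k + δ : ℂ[X]) * (irregCoeff k δ (p + 1) : ℂ[X]))
            * Polynomial.X ^ (k * (δ - p)) * (irregOp k)^[p + 1] f
          + ((δ : ℂ[X]) * (irregCoeff k δ 0 : ℂ[X])) * Polynomial.X ^ (k * (δ + 1)) * f := by
      rw [Finset.sum_range_succ' _ δ, Finset.sum_range_succ _ δ,
        irregCoeff_of_lt k δ (δ + 1) (by omega)]
      simp
    rw [h1, ih, irregOp_sum, Finset.mul_sum, ← Finset.sum_sub_distrib, Finset.sum_congr rfl h2,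
      Finset.sum_sub_distrib, Finset.sum_range_succ' _ (δ + 1), h4, ← sub_sub,
      ← Finset.sum_sub_distrib, sub_eq_add_neg]
    congr 1
    · refine Finset.sum_congr rfl fun p _ => ?_
      rw [irregCoeff, Nat.add_sub_add_right]
      push_cast
      ring
    · rw [irregCoeff]
      simp

/-! ### The convolution operators -/

/-- `t^{1/k}` for `0 ≤ t`. -/
def rt (k : ℕ) (t : ℝ) : ℂ := ((t ^ (1 / (k : ℝ)) : ℝ) : ℂ)

/-- `∫_0^{τ^k} (τ^k - s)^{n/k - 1} f(s^{1/k}) ds/s` along the segment `s = t τ^k`, `0 ≤ t ≤ 1`,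
with `s^{1/k} = t^{1/k} τ` and `(τ^k - s)^{n/k-1} = (1-t)^{n/k-1} τ^{n-k}`. -/
def volterra (k n : ℕ) (f : ℂ → ℂ) (τ : ℂ) : ℂ :=
  τ ^ ((n : ℤ) - k) *
    ∫ t in (0 : ℝ)..1, (((1 - t) ^ ((n : ℝ) / k - 1) : ℝ) : ℂ) * f (rt k t * τ) / (t : ℂ)

/-- `∫_0^s h((s-x)^{1/k}, x^{1/k}) dx / ((s-x) x)` for `s = σ^k`, along the segment `x = u s`,
`0 ≤ u ≤ 1`, with `(s-x)^{1/k} = (1-u)^{1/k} σ` and `x^{1/k} = u^{1/k} σ`. -/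
def convol (k : ℕ) (h : ℂ → ℂ → ℂ) (σ : ℂ) : ℂ :=
  (σ ^ k)⁻¹ *
    ∫ u in (0 : ℝ)..1, h (rt k (1 - u) * σ) (rt k u * σ) / (((1 - u) * u : ℝ) : ℂ)

/-- The Borel transform of `∑_{1 ≤ p ≤ δ-1} A_{δ,p} T^{k(δ-p)} (T^{k+1} ∂_T)^p`:
`∑_p A_{δ,p} τ^k/Γ(δ-p) ∫_0^{τ^k} (τ^k-s)^{δ-p-1} k^p s^p f(s^{1/k}) ds/s`. -/
def borelA (k δ : ℕ) (f : ℂ → ℂ) (τ : ℂ) : ℂ :=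
  ∑ p ∈ Finset.Icc 1 (δ - 1),
    (irregCoeff k δ p : ℂ) * τ ^ k / (Real.Gamma (((δ - p : ℕ) : ℝ)) : ℂ)
      * volterra k (k * (δ - p)) (fun σ => (k : ℂ) ^ p * (σ ^ k) ^ p * f σ) τ

/-- `τ₁^{k₁} τ₂^{k₂} / (Γ(n₁/k₁) Γ(n₂/k₂)) ∫_0^{τ₁^{k₁}} ∫_0^{τ₂^{k₂}} (τ₁^{k₁}-s₁)^{n₁/k₁-1}
(τ₂^{k₂}-s₂)^{n₂/k₂-1} g(s₁^{1/k₁}, s₂^{1/k₂}) ds₂/s₂ ds₁/s₁`. -/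
def volterra₂ (k₁ k₂ n₁ n₂ : ℕ) (g : ℂ → ℂ → ℂ) (τ₁ τ₂ : ℂ) : ℂ :=
  τ₁ ^ k₁ * τ₂ ^ k₂ /
      ((Real.Gamma ((n₁ : ℝ) / k₁) : ℂ) * (Real.Gamma ((n₂ : ℝ) / k₂) : ℂ))
    * volterra k₁ n₁ (fun σ₁ => volterra k₂ n₂ (fun σ₂ => g σ₁ σ₂) τ₂) τ₁

/-! ### The problem -/

/-- The parameters of the equation; `δ', d'` are the exponents attached to the second variable,
`RD₁ = R_{D₁,0}`, `RD₂ = R_{0,D₂}`, so that `R_{D₁,D₂} = RD₁ * RD₂`; `P_j ε = P_j(·,ε)`. -/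
structure Params where
  k₁ : ℕ
  k₂ : ℕ
  D₁ : ℕ
  D₂ : ℕ
  δ : ℕ → ℕ
  δ' : ℕ → ℕ
  d : ℕ → ℕ
  d' : ℕ → ℕ
  Δ : ℕ → ℕ → ℕ
  Q₁ : ℂ[X]
  Q₂ : ℂ[X]
  R₀ : ℂ[X]
  RD₁ : ℂ[X]
  RD₂ : ℂ[X]
  R : ℕ → ℕ → ℂ[X]
  P₁ : ℂ → ℂ[X]
  P₂ : ℂ → ℂ[X]

/-- The value `p(im)` of a polynomial on the imaginary axis. -/
def ev (p : ℂ[X]) (m : ℝ) : ℂ := p.eval (Complex.I * m)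

/-- The standing assumptions on the parameters; `e₀` is a radius such that the coefficients of
`P₁, P₂` are holomorphic on the closed disc of radius `e₀`. -/
structure Params.Standing (S : Params) (e₀ μ : ℝ) : Prop where
  k₁_pos : 1 ≤ S.k₁
  k₂_pos : 1 ≤ S.k₂
  two_le_D₁ : 2 ≤ S.D₁
  two_le_D₂ : 2 ≤ S.D₂
  δ_one : S.δ 1 = 1
  δ'_one : S.δ' 1 = 1
  δ_lt : ∀ l ∈ Finset.Icc 1 (S.D₁ - 1), S.δ l < S.δ (l + 1)
  δ'_lt : ∀ l ∈ Finset.Icc 1 (S.D₂ - 1), S.δ' l < S.δ' (l + 1)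
  lt_d : ∀ l ∈ Finset.Icc 1 (S.D₁ - 1), (S.δ l - 1) * (S.k₁ + 1) < S.d l
  lt_d' : ∀ l ∈ Finset.Icc 1 (S.D₂ - 1), (S.δ' l - 1) * (S.k₂ + 1) < S.d' l
  analytic_P₁ : ∀ i, AnalyticOnNhd ℂ (fun ε => (S.P₁ ε).coeff i) (Metric.closedBall 0 e₀)
  analytic_P₂ : ∀ i, AnalyticOnNhd ℂ (fun ε => (S.P₂ ε).coeff i) (Metric.closedBall 0 e₀)
  deg_RD₁ : S.RD₁.natDegree ≤ S.Q₁.natDegree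
  deg_RD₂ : S.RD₂.natDegree ≤ S.Q₂.natDegree
  deg_R : ∀ l₁ ∈ Finset.Icc 1 (S.D₁ - 1), ∀ l₂ ∈ Finset.Icc 1 (S.D₂ - 1),
    (S.R l₁ l₂).natDegree ≤ (S.RD₁ * S.RD₂).natDegree
  deg_R₀ : S.R₀.natDegree ≤ (S.RD₁ * S.RD₂).natDegree
  deg_P₁ : ∀ ε ∈ Metric.closedBall (0 : ℂ) e₀,
    (S.P₁ ε).natDegree ≤ (S.RD₁ * S.RD₂).natDegree
  deg_P₂ : ∀ ε ∈ Metric.closedBall (0 : ℂ) e₀,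
    (S.P₂ ε).natDegree ≤ (S.RD₁ * S.RD₂).natDegree
  Q₁_ne : ∀ m : ℝ, ev S.Q₁ m ≠ 0
  Q₂_ne : ∀ m : ℝ, ev S.Q₂ m ≠ 0
  RD_ne : ∀ m : ℝ, ev (S.RD₁ * S.RD₂) m ≠ 0
  lt_μ_P₁ : ∀ ε ∈ Metric.closedBall (0 : ℂ) e₀, ((S.P₁ ε).natDegree : ℝ) + 1 < μ
  lt_μ_P₂ : ∀ ε ∈ Metric.closedBall (0 : ℂ) e₀, ((S.P₂ ε).natDegree : ℝ) + 1 < μ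
  lt_μ_R₀ : (S.R₀.natDegree : ℝ) + 1 < μ

/-- `P_m(τ) = Q(im) k - R(im) k^δ τ^{(δ-1)k}`. -/
def charPoly (k δ : ℕ) (Q R : ℂ[X]) (m : ℝ) (τ : ℂ) : ℂ :=
  ev Q m * k - ev R m * (k : ℂ) ^ δ * τ ^ ((δ - 1) * k)

/-- `|P_m(τ)| ≥ C_P r^{1/((δ-1)k)} |R(im)| (1+|τ|^k)^{(δ-1)-1/k}` for `τ ∈ Ω`, `m ∈ ℝ`. -/
def CharPolyBound (k δ : ℕ) (Q R : ℂ[X]) (CP r : ℝ) (Ω : Set ℂ) : Prop :=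
  ∀ τ ∈ Ω, ∀ m : ℝ,
    CP * r ^ (1 / (((δ : ℝ) - 1) * k)) * ‖ev R m‖
        * (1 + ‖τ‖ ^ k) ^ (((δ : ℝ) - 1) - 1 / (k : ℝ))
      ≤ ‖charPoly k δ Q R m τ‖

/-- `Q(im) k τ^k - (k τ^k)^δ R(im)`. -/
def symb (k δ : ℕ) (Q R : ℂ[X]) (m : ℝ) (τ : ℂ) : ℂ :=
  ev Q m * k * τ ^ k - (k * τ ^ k) ^ δ * ev R m

/-- `d_{l,k}`, defined by `d_l + k + 1 = δ_l (k+1) + d_{l,k}`. -/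
def dk (k δl dl : ℕ) : ℕ := dl + k + 1 - δl * (k + 1)

/-- `(2π)^{-1/2} ∫_ℝ f(m - m₁) g(m₁) dm₁`. -/
def fconv (f g : ℝ → ℂ) (m : ℝ) : ℂ :=
  (1 / (Real.sqrt (2 * Real.pi) : ℂ)) * ∫ m₁ : ℝ, f (m - m₁) * g m₁

/-- The convolution equation in the Borel plane at the point `(τ₁,τ₂,m)`, for the unknown `ω`,
with data `φ, φ¹, φ², C₀₀, ψ`, at the parameter value `ε`. -/
def BorelEq (S : Params) (ε : ℂ) (φ : ℂ → ℂ → ℝ → ℂ) (φ₁ φ₂ : ℂ → ℝ → ℂ) (C₀₀ : ℝ → ℂ)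
    (ψ ω : ℂ → ℂ → ℝ → ℂ) (τ₁ τ₂ : ℂ) (m : ℝ) : Prop :=
  symb S.k₁ (S.δ S.D₁) S.Q₁ S.RD₁ m τ₁ * symb S.k₂ (S.δ' S.D₂) S.Q₂ S.RD₂ m τ₂ * ω τ₁ τ₂ m =
    symb S.k₁ (S.δ S.D₁) S.Q₁ S.RD₁ m τ₁ * ev S.RD₂ m
        * borelA S.k₂ (S.δ' S.D₂) (fun σ₂ => ω τ₁ σ₂ m) τ₂
    + symb S.k₂ (S.δ' S.D₂) S.Q₂ S.RD₂ m τ₂ * ev S.RD₁ m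
        * borelA S.k₁ (S.δ S.D₁) (fun σ₁ => ω σ₁ τ₂ m) τ₁
    - ev S.RD₁ m * ev S.RD₂ m
        * borelA S.k₁ (S.δ S.D₁)
            (fun σ₁ => borelA S.k₂ (S.δ' S.D₂) (fun σ₂ => ω σ₁ σ₂ m) τ₂) τ₁
    + ε ^ (-2 : ℤ) * volterra₂ S.k₁ S.k₂ (S.k₁ + 1) (S.k₂ + 1)
        (fun σ₁ σ₂ => σ₁ ^ S.k₁ * σ₂ ^ S.k₂ *
          convol S.k₁ (fun a₁ b₁ => convol S.k₂ (fun a₂ b₂ =>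
            fconv (fun m' => ev (S.P₁ ε) m' * ω a₁ a₂ m')
              (fun m' => ev (S.P₂ ε) m' * ω b₁ b₂ m') m) σ₂) σ₁) τ₁ τ₂
    + ∑ l₁ ∈ Finset.Icc 1 (S.D₁ - 1), ∑ l₂ ∈ Finset.Icc 1 (S.D₂ - 1),
        ev (S.R l₁ l₂) m
          * ε ^ ((S.Δ l₁ l₂ : ℤ) - S.d l₁ - S.d' l₂ + S.δ l₁ + S.δ' l₂ - 2)
          * volterra₂ S.k₁ S.k₂ (dk S.k₁ (S.δ l₁) (S.d l₁)) (dk S.k₂ (S.δ' l₂) (S.d' l₂))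
              (fun σ₁ σ₂ => (S.k₁ : ℂ) ^ S.δ l₁ * (S.k₂ : ℂ) ^ S.δ' l₂
                * (σ₁ ^ S.k₁) ^ S.δ l₁ * (σ₂ ^ S.k₂) ^ S.δ' l₂ * ω σ₁ σ₂ m) τ₁ τ₂
    + ε ^ (-2 : ℤ) * volterra₂ S.k₁ S.k₂ (S.k₁ + 1) (S.k₂ + 1)
        (fun σ₁ σ₂ => σ₁ ^ S.k₁ * σ₂ ^ S.k₂ *
          convol S.k₁ (fun a₁ b₁ => convol S.k₂ (fun a₂ b₂ =>
            fconv (φ a₁ a₂) (fun m' => ev S.R₀ m' * ω b₁ b₂ m') m) σ₂) σ₁) τ₁ τ₂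
    + ε ^ (-2 : ℤ) * volterra₂ S.k₁ S.k₂ (S.k₁ + 1) (S.k₂ + 1)
        (fun σ₁ σ₂ => σ₁ ^ S.k₁ *
          convol S.k₁ (fun a₁ b₁ =>
            fconv (φ₁ a₁) (fun m' => ev S.R₀ m' * ω b₁ σ₂ m') m) σ₁) τ₁ τ₂
    + ε ^ (-2 : ℤ) * volterra₂ S.k₁ S.k₂ (S.k₁ + 1) (S.k₂ + 1)
        (fun σ₁ σ₂ => σ₂ ^ S.k₂ *
          convol S.k₂ (fun a₂ b₂ =>
            fconv (φ₂ a₂) (fun m' => ev S.R₀ m' * ω σ₁ b₂ m') m) σ₂) τ₁ τ₂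
    + ε ^ (-2 : ℤ) * volterra₂ S.k₁ S.k₂ (S.k₁ + 1) (S.k₂ + 1)
        (fun σ₁ σ₂ => fconv C₀₀ (fun m' => ev S.R₀ m' * ω σ₁ σ₂ m') m) τ₁ τ₂
    + ε ^ (-2 : ℤ) * volterra₂ S.k₁ S.k₂ (S.k₁ + 1) (S.k₂ + 1)
        (fun σ₁ σ₂ => ψ σ₁ σ₂ m) τ₁ τ₂

/-- `ω` lies in the closed ball of radius `ϖ` of `F^{𝐝}_{(𝛎,β,μ,𝐤,ε)}` and solves the convolution
equation, whose data are the Borel transforms of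
`C₀ = ∑_{n₁,n₂ ≥ 0} C_{n₁,n₂}(m,ε) T₁^{n₁} T₂^{n₂}` and
`F = ∑_{n₁,n₂ ≥ 1} F_{n₁,n₂}(m,ε) T₁^{n₁} T₂^{n₂}`. -/
structure IsSolutionInBall (S : Params) (ν₁ ν₂ β μ ρ d₁ θ₁ d₂ θ₂ ϖ : ℝ)
    (C F : ℕ → ℕ → ℝ → ℂ → ℂ) (ε : ℂ) (ω : ℂ → ℂ → ℝ → ℂ) : Prop where
  mem : MemF (openDom ρ d₁ θ₁) (openDom ρ d₂ θ₂) (closedDom ρ d₁ θ₁) (closedDom ρ d₂ θ₂)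
    ν₁ ν₂ β μ S.k₁ S.k₂ ε ω
  norm_le : normF (closedDom ρ d₁ θ₁) (closedDom ρ d₂ θ₂) ν₁ ν₂ β μ S.k₁ S.k₂ ε ω
    ≤ ENNReal.ofReal ϖ
  eqn : ∀ τ₁ ∈ closedDom ρ d₁ θ₁, ∀ τ₂ ∈ closedDom ρ d₂ θ₂, ∀ m : ℝ,
    BorelEq S ε
      (fun τ₁ τ₂ m => borel₂ S.k₁ S.k₂ (fun n₁ n₂ => C n₁ n₂ m ε) τ₁ τ₂)
      (fun τ₁ m => borel₁ S.k₁ (fun n => C n 0 m ε) τ₁)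
      (fun τ₂ m => borel₁ S.k₂ (fun n => C 0 n m ε) τ₂)
      (fun m => C 0 0 m ε)
      (fun τ₁ τ₂ m => borel₂ S.k₁ S.k₂ (fun n₁ n₂ => F n₁ n₂ m ε) τ₁ τ₂)
      ω τ₁ τ₂ m

end BorelPlane

end

open BorelPlane

/-!
The equation is solved by a Picard iteration in the weighted space. The symbols `L₁`, `L₂` factor as
`τ_j^{k_j}` times the characteristic polynomial, so dividing the equation by `L₁ L₂` gives a fixed
point equation `ω = L ω + B(ω, ω) + c`, with `L` linear and `B` bilinear. Division loses nothing:
the functions of finite norm vanish at `τ_j = 0`, where the weight is infinite, and the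
characteristic polynomials have no zero on the domains (`Bounds.borelEq_iff`,
`Bounds.symbols_mul_left_cancel`).

The estimates rest on three facts.

* `exists_kernel_bound`: a Volterra operator of order `a` maps the weight `x/(1+x^{2k}) e^{ν x^k}`,
  `x = |τ/ε|`, to at most a constant times
  `(1+x^k)^{-a}` times itself. The gain `(1+x^k)^{-a}` turns powers of `τ` into powers
  of `ε`, and the lower bound `(1+|τ|^k)^{δ-1-1/k}` for the characteristic polynomial absorbs the
  powers of `τ` that remain (`linOp_opK_of_pos`, `linOp_opK_succ`). In each convolution term this
  gives a factor `|ε|` per variable, which compensates `ε^{-2}`; in the terms of lower order, and in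
  those coming from the coefficients `A_{δ,p}`, a positive power of `ε` is left.
* `exists_conv_bound`: the same weight is submultiplicative, up to a constant, for the convolution
  with kernel `dx/((s-x)x)`.
* `exists_Ew_conv`: the weight `(1+|m|)^{-s} e^{-β|m|}` with `s > 1` is submultiplicative, up to a
  constant which does not depend on `β`, for the convolution in `m`. It is used with `s = μ - N`, `N`
  being a common bound for the degrees of `P₁`, `P₂`, `R₀`: multiplication by these polynomials loses
  `N` powers of `1 + |m|`, and the division by `R_{D₁} R_{D₂}` recovers them.

Hence `L` is small if `ε` and the data are small, `B` is bounded, and `c` is small with `ψ`: the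
map sends a small ball to itself and halves distances there (`mem_quadratic`,
`contraction_quadratic`). All constants are collected in the structure `Bounds`, which involves neither
`ε`, `β`, the domains nor the data; this is the uniformity claimed. Holomorphy and continuity of the
operators are the theorems on integrals and series depending on a parameter (`Reg.integral`,
`Reg.tsum`); the domains are star-shaped with respect to `0`, so the segments of integration stay in
them.
-/

noncomputable section

namespace BorelPlane

open MeasureTheory Filter Topology Set

/-! ### Holomorphy of parametric integrals -/

theorem aestronglyMeasurable_fderiv {X : Type*} [MeasurableSpace X] {κ : Measure X}
    {F : ℂ × ℂ → X → ℂ} {U : Set (ℂ × ℂ)} (hU : IsOpen U)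
    (hF : ∀ᵐ x ∂κ, DifferentiableOn ℂ (fun z => F z x) U)
    (hm : ∀ z ∈ U, AEStronglyMeasurable (F z) κ) {z : ℂ × ℂ} (hz : z ∈ U) :
    AEStronglyMeasurable (fun x => fderiv ℂ (fun z => F z x) z) κ := by
  have key : ∀ v : ℂ × ℂ, AEStronglyMeasurable (fun x => fderiv ℂ (fun z => F z x) z v) κ := by
    intro v
    have h0 : Tendsto (fun n : ℕ => z + ((n : ℂ))⁻¹ • v) atTop (𝓝 z) := by
      have : Tendsto (fun n : ℕ => ((n : ℂ))⁻¹) atTop (𝓝 0) := tendsto_inv_atTop_nhds_zero_nat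
      simpa using (this.smul_const v).const_add z
    obtain ⟨n₀, hn₀⟩ := eventually_atTop.1 (h0.eventually (hU.mem_nhds hz))
    refine aestronglyMeasurable_of_tendsto_ae atTop
      (f := fun n : ℕ => fun x =>
        ((n + n₀ : ℕ) : ℂ) • (F (z + (((n + n₀ : ℕ) : ℂ))⁻¹ • v) x - F z x)) (fun n => ?_) ?_
    · exact AEStronglyMeasurable.const_smul
        ((hm _ (hn₀ (n + n₀) (by omega))).sub (hm z hz)) ((n + n₀ : ℕ) : ℂ)
    · filter_upwards [hF] with x hx
      have hd := (hx.differentiableAt (hU.mem_nhds hz)).hasFDerivAt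
      refine hd.lim v (c := fun n : ℕ => ((n + n₀ : ℕ) : ℂ)) ?_
      simp only [Complex.norm_natCast]
      exact tendsto_natCast_atTop_atTop.comp (tendsto_add_atTop_nat n₀)
  have h2 : (fun x => fderiv ℂ (fun z => F z x) z) = fun x =>
      (fderiv ℂ (fun z => F z x) z (1, 0)) • ContinuousLinearMap.fst ℂ ℂ ℂ
        + (fderiv ℂ (fun z => F z x) z (0, 1)) • ContinuousLinearMap.snd ℂ ℂ ℂ := by
    funext x
    ext <;> simp
  rw [h2]
  exact ((key _).smul_const _).add ((key _).smul_const _)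

/-- A parametric integral of functions holomorphic on an open set of `ℂ²` is holomorphic as soon as
the integrands are dominated locally uniformly: the Schwarz lemma turns the domination of the
integrands into a domination of their derivatives. -/
theorem differentiableOn_integral {X : Type*} [MeasurableSpace X] {κ : Measure X}
    {F : ℂ × ℂ → X → ℂ} {U : Set (ℂ × ℂ)} (hU : IsOpen U)
    (hF : ∀ᵐ x ∂κ, DifferentiableOn ℂ (fun z => F z x) U)
    (hm : ∀ z ∈ U, AEStronglyMeasurable (F z) κ)
    (hb : ∀ M : ℝ, ∃ bound : X → ℝ, Integrable bound κ ∧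
      ∀ᵐ x ∂κ, ∀ z ∈ U, ‖z‖ ≤ M → ‖F z x‖ ≤ bound x) :
    DifferentiableOn ℂ (fun z => ∫ x, F z x ∂κ) U := by
  intro z₀ hz₀
  obtain ⟨R, hR, hRU⟩ := Metric.isOpen_iff.1 hU z₀ hz₀
  obtain ⟨bound, hbi, hbd⟩ := hb (‖z₀‖ + R)
  have hnorm : ∀ z ∈ Metric.ball z₀ R, ‖z‖ ≤ ‖z₀‖ + R := by
    intro z hz
    have := norm_sub_norm_le z z₀
    rw [mem_ball_iff_norm] at hz
    linarith
  have hsub : ∀ z ∈ Metric.ball z₀ (R / 2), Metric.ball z (R / 2) ⊆ Metric.ball z₀ R := by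
    intro z hz
    refine Metric.ball_subset_ball' ?_
    rw [Metric.mem_ball] at hz
    linarith
  refine (hasFDerivAt_integral_of_dominated_of_fderiv_le (𝕜 := ℂ)
    (F' := fun z x => fderiv ℂ (fun z => F z x) z)
    (s := Metric.ball z₀ (R / 2)) (bound := fun x => 2 * bound x / (R / 2))
    (Metric.ball_mem_nhds _ (by positivity)) ?_ ?_ (aestronglyMeasurable_fderiv hU hF hm hz₀) ?_
    ((hbi.const_mul 2).div_const _) ?_).differentiableAt.differentiableWithinAt
  · filter_upwards [hU.mem_nhds hz₀] with z hz using hm z hz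
  · refine hbi.mono' (hm z₀ hz₀) ?_
    filter_upwards [hbd] with x hx
    exact hx z₀ hz₀ (by linarith)
  · filter_upwards [hF, hbd] with x hx hx' z hz
    have hzU := (hsub z hz).trans hRU
    refine Complex.norm_fderiv_le_div_of_mapsTo_ball (hx.mono hzU) (fun y hy => ?_) (by positivity)
    have h1 := hx' y (hzU hy) (hnorm y (hsub z hz hy))
    have h3 : z ∈ Metric.ball z (R / 2) := Metric.mem_ball_self (by positivity)
    have h2 := hx' z (hzU h3) (hnorm z (hsub z hz h3))
    rw [mem_closedBall_iff_norm]
    exact (norm_sub_le _ _).trans (by linarith)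
  · filter_upwards [hF] with x hx z hz
    exact (hx.differentiableAt (hU.mem_nhds (hRU (hsub z hz
      (Metric.mem_ball_self (by positivity)))))).hasFDerivAt

/-! ### Regular functions on products of star-shaped domains -/

/-- A domain in one Borel variable: an open set `U` and a larger set `Ω`, both star-shaped with
respect to the origin, on which functions are respectively holomorphic and continuous. -/
structure Dom where
  U : Set ℂ
  Ω : Set ℂ
  isOpen : IsOpen U
  sub : U ⊆ Ω
  smul_mem_U : ∀ c ∈ Icc (0 : ℝ) 1, ∀ z ∈ U, (c : ℂ) * z ∈ U
  smul_mem : ∀ c ∈ Icc (0 : ℝ) 1, ∀ z ∈ Ω, (c : ℂ) * z ∈ Ω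

/-- Continuity on `Ω₁ × Ω₂ × ℝ` and holomorphy on `U₁ × U₂`. -/
structure Reg (D₁ D₂ : Dom) (h : ℂ → ℂ → ℝ → ℂ) : Prop where
  cont : ContinuousOn (fun p : (ℂ × ℂ) × ℝ => h p.1.1 p.1.2 p.2) ((D₁.Ω ×ˢ D₂.Ω) ×ˢ univ)
  hol : ∀ m : ℝ, DifferentiableOn ℂ (fun p : ℂ × ℂ => h p.1 p.2 m) (D₁.U ×ˢ D₂.U)

variable {D₁ D₂ : Dom}

theorem Reg.swap {h : ℂ → ℂ → ℝ → ℂ} (hh : Reg D₁ D₂ h) :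
    Reg D₂ D₁ (fun τ₂ τ₁ m => h τ₁ τ₂ m) where
  cont := hh.cont.comp (f := fun p : (ℂ × ℂ) × ℝ => ((p.1.2, p.1.1), p.2))
    (by fun_prop) (fun p hp => ⟨⟨hp.1.2, hp.1.1⟩, trivial⟩)
  hol m := (hh.hol m).comp (f := fun p : ℂ × ℂ => (p.2, p.1)) (by fun_prop)
    (fun p hp => ⟨hp.2, hp.1⟩)

/-- A parametric integral of regular functions is regular, if the integrands are dominated on
bounded sets. Applied to the counting measure this covers series of regular functions. -/
theorem Reg.integral {X : Type*} [MeasurableSpace X] {κ : Measure X} {F : X → ℂ → ℂ → ℝ → ℂ}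
    (hF : ∀ᵐ x ∂κ, Reg D₁ D₂ (F x))
    (hm : ∀ τ₁ ∈ D₁.Ω, ∀ τ₂ ∈ D₂.Ω, ∀ m, AEStronglyMeasurable (fun x => F x τ₁ τ₂ m) κ)
    (hb : ∀ M : ℝ, ∃ bound : X → ℝ, Integrable bound κ ∧ ∀ᵐ x ∂κ,
      ∀ τ₁ ∈ D₁.Ω, ∀ τ₂ ∈ D₂.Ω, ∀ m, ‖τ₁‖ ≤ M → ‖τ₂‖ ≤ M → |m| ≤ M → ‖F x τ₁ τ₂ m‖ ≤ bound x) :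
    Reg D₁ D₂ (fun τ₁ τ₂ m => ∫ x, F x τ₁ τ₂ m ∂κ) where
  cont := by
    rintro ⟨⟨a, b⟩, c⟩ hp
    obtain ⟨bound, hbi, hbd⟩ := hb (‖((a, b), c)‖ + 1)
    have hev : ∀ᶠ q : (ℂ × ℂ) × ℝ in 𝓝[(D₁.Ω ×ˢ D₂.Ω) ×ˢ univ] ((a, b), c),
        ‖q‖ ≤ ‖((a, b), c)‖ + 1 ∧ q ∈ (D₁.Ω ×ˢ D₂.Ω) ×ˢ univ := by
      refine Filter.Eventually.and ?_ self_mem_nhdsWithin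
      refine nhdsWithin_le_nhds ?_
      exact (continuous_norm.tendsto _).eventually (eventually_le_nhds (by linarith))
    refine continuousWithinAt_of_dominated (bound := bound) ?_ ?_ hbi ?_
    · filter_upwards [hev] with q hq using hm _ hq.2.1.1 _ hq.2.1.2 _
    · filter_upwards [hev] with q hq
      filter_upwards [hbd] with x hx
      refine hx _ hq.2.1.1 _ hq.2.1.2 _ ?_ ?_ ?_
      · exact ((norm_fst_le q.1).trans (norm_fst_le q)).trans hq.1
      · exact ((norm_snd_le q.1).trans (norm_fst_le q)).trans hq.1
      · exact (norm_snd_le q).trans hq.1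
    · filter_upwards [hF] with x hx using hx.cont _ hp
  hol m := by
    refine differentiableOn_integral (D₁.isOpen.prod D₂.isOpen) ?_ ?_ ?_
    · filter_upwards [hF] with x hx using hx.hol m
    · exact fun z hz => hm _ (D₁.sub hz.1) _ (D₂.sub hz.2) m
    · intro M
      obtain ⟨bound, hbi, hbd⟩ := hb (max M |m|)
      refine ⟨bound, hbi, ?_⟩
      filter_upwards [hbd] with x hx z hz hzM
      exact hx _ (D₁.sub hz.1) _ (D₂.sub hz.2) m
        ((norm_fst_le z).trans (hzM.trans (le_max_left _ _)))
        ((norm_snd_le z).trans (hzM.trans (le_max_left _ _))) (le_max_right _ _)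

theorem Reg.tsum {ι : Type*} [Countable ι] {F : ι → ℂ → ℂ → ℝ → ℂ} (hF : ∀ i, Reg D₁ D₂ (F i))
    (hb : ∀ M : ℝ, ∃ bound : ι → ℝ, Summable bound ∧ ∀ i, ∀ τ₁ ∈ D₁.Ω, ∀ τ₂ ∈ D₂.Ω, ∀ m,
      ‖τ₁‖ ≤ M → ‖τ₂‖ ≤ M → |m| ≤ M → ‖F i τ₁ τ₂ m‖ ≤ bound i) :
    Reg D₁ D₂ (fun τ₁ τ₂ m => ∑' i, F i τ₁ τ₂ m) := by
  let _ : MeasurableSpace ι := ⊤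
  have hreg : Reg D₁ D₂ (fun τ₁ τ₂ m => ∫ i, F i τ₁ τ₂ m ∂Measure.count) := by
    refine Reg.integral (.of_forall hF) (fun _ _ _ _ _ => by fun_prop) fun M => ?_
    obtain ⟨bound, hs, hbd⟩ := hb M
    exact ⟨bound, integrable_count_iff.2 hs.norm, .of_forall hbd⟩
  have heq : ∀ τ₁ ∈ D₁.Ω, ∀ τ₂ ∈ D₂.Ω, ∀ m,
      ∑' i, F i τ₁ τ₂ m = ∫ i, F i τ₁ τ₂ m ∂Measure.count := by
    intro τ₁ h₁ τ₂ h₂ m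
    obtain ⟨bound, hs, hbd⟩ := hb (max (max ‖τ₁‖ ‖τ₂‖) |m|)
    have hi : Integrable (fun i => F i τ₁ τ₂ m) Measure.count :=
      integrable_count_iff.2 (hs.of_nonneg_of_le (fun _ => norm_nonneg _)
        fun i => hbd i _ h₁ _ h₂ m (by simp) (by simp) (by simp))
    rw [integral_countable hi]
    simp [measureReal_def]
  exact ⟨hreg.cont.congr fun p hp => heq _ hp.1.1 _ hp.1.2 _, fun m =>
    (hreg.hol m).congr fun p hp => heq _ (D₁.sub hp.1) _ (D₂.sub hp.2) _⟩

theorem Reg.comp_smul {h : ℂ → ℂ → ℝ → ℂ} (hh : Reg D₁ D₂ h) {c₁ c₂ : ℝ}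
    (h₁ : c₁ ∈ Icc (0 : ℝ) 1) (h₂ : c₂ ∈ Icc (0 : ℝ) 1) {u : ℝ → ℝ} (hu : Continuous u) :
    Reg D₁ D₂ (fun τ₁ τ₂ m => h (c₁ * τ₁) (c₂ * τ₂) (u m)) where
  cont := hh.cont.comp (f := fun p : (ℂ × ℂ) × ℝ => (((c₁ : ℂ) * p.1.1, (c₂ : ℂ) * p.1.2), u p.2))
    (by fun_prop) (fun p hp => ⟨⟨D₁.smul_mem _ h₁ _ hp.1.1, D₂.smul_mem _ h₂ _ hp.1.2⟩, trivial⟩)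
  hol m := (hh.hol (u m)).comp (f := fun p : ℂ × ℂ => ((c₁ : ℂ) * p.1, (c₂ : ℂ) * p.2))
    (by fun_prop) (fun p hp => ⟨D₁.smul_mem_U _ h₁ _ hp.1, D₂.smul_mem_U _ h₂ _ hp.2⟩)

theorem Reg.mul {h h' : ℂ → ℂ → ℝ → ℂ} (hh : Reg D₁ D₂ h) (hh' : Reg D₁ D₂ h') :
    Reg D₁ D₂ (fun τ₁ τ₂ m => h τ₁ τ₂ m * h' τ₁ τ₂ m) :=
  ⟨hh.cont.mul hh'.cont, fun m => (hh.hol m).mul (hh'.hol m)⟩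

theorem Reg.add {h h' : ℂ → ℂ → ℝ → ℂ} (hh : Reg D₁ D₂ h) (hh' : Reg D₁ D₂ h') :
    Reg D₁ D₂ (h + h') :=
  ⟨hh.cont.add hh'.cont, fun m => (hh.hol m).add (hh'.hol m)⟩

theorem Reg.sub {h h' : ℂ → ℂ → ℝ → ℂ} (hh : Reg D₁ D₂ h) (hh' : Reg D₁ D₂ h') :
    Reg D₁ D₂ (h - h') :=
  ⟨hh.cont.sub hh'.cont, fun m => (hh.hol m).sub (hh'.hol m)⟩

theorem Reg.of_continuous {ρ : ℝ → ℂ} (hρ : Continuous ρ) : Reg D₁ D₂ (fun _ _ m => ρ m) :=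
  ⟨by fun_prop, fun m => by fun_prop⟩

theorem Reg.of_fst {g : ℂ → ℝ → ℂ}
    (hc : ContinuousOn (fun p : ℂ × ℝ => g p.1 p.2) (D₁.Ω ×ˢ univ))
    (hd : ∀ m, DifferentiableOn ℂ (fun τ => g τ m) D₁.U) : Reg D₁ D₂ (fun τ₁ _ m => g τ₁ m) where
  cont := hc.comp (f := fun p : (ℂ × ℂ) × ℝ => (p.1.1, p.2)) (by fun_prop)
    (fun p hp => ⟨hp.1.1, trivial⟩)
  hol m := (hd m).comp (f := fun p : ℂ × ℂ => p.1) (by fun_prop) (fun p hp => hp.1)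

/-! ### Weighted spaces and bounded linear operators between them -/

/-- Regular functions `h` with `|h(τ₁,τ₂,m)| ≤ N b₁(τ₁) b₂(τ₂) E(m)`, that is, of norm at most `N`
in the weighted space with weight `1/(b₁ b₂ E)`. -/
structure Mem (D₁ D₂ : Dom) (b₁ b₂ : ℂ → ℝ) (E : ℝ → ℝ) (N : ℝ) (h : ℂ → ℂ → ℝ → ℂ) : Prop
    extends Reg D₁ D₂ h where
  nonneg : 0 ≤ N
  bd : ∀ τ₁ ∈ D₁.Ω, ∀ τ₂ ∈ D₂.Ω, ∀ m, ‖h τ₁ τ₂ m‖ ≤ N * (b₁ τ₁ * b₂ τ₂ * E m)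

/-- An operator which, on functions regular on the given domains, is linear and bounded with
constant `K` from the weight `b₁ b₂ E` to the weight `b₁ b₂ E'`. It acts on all functions, so
linearity is only required on the domains. -/
structure LinOp (D₁ D₂ : Dom) (b₁ b₂ : ℂ → ℝ) (E E' : ℝ → ℝ) (K : ℝ)
    (A : (ℂ → ℂ → ℝ → ℂ) → ℂ → ℂ → ℝ → ℂ) : Prop where
  nonneg : 0 ≤ K
  mem : ∀ {h N}, Mem D₁ D₂ b₁ b₂ E N h → Mem D₁ D₂ b₁ b₂ E' (K * N) (A h)
  sub : ∀ {h h' N N'}, Mem D₁ D₂ b₁ b₂ E N h → Mem D₁ D₂ b₁ b₂ E N' h' →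
    ∀ τ₁ ∈ D₁.Ω, ∀ τ₂ ∈ D₂.Ω, ∀ m, A (h - h') τ₁ τ₂ m = A h τ₁ τ₂ m - A h' τ₁ τ₂ m

section weighted

variable {b₁ b₂ : ℂ → ℝ} {E E' E'' : ℝ → ℝ} {N N' K K' : ℝ} {h h' : ℂ → ℂ → ℝ → ℂ}

/-- The operator obtained by exchanging the roles of the two Borel variables. -/
def swapOp (A : (ℂ → ℂ → ℝ → ℂ) → ℂ → ℂ → ℝ → ℂ) (h : ℂ → ℂ → ℝ → ℂ) : ℂ → ℂ → ℝ → ℂ :=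
  fun τ₁ τ₂ m => A (fun τ₂ τ₁ m => h τ₁ τ₂ m) τ₂ τ₁ m

theorem Mem.swap (hh : Mem D₁ D₂ b₁ b₂ E N h) : Mem D₂ D₁ b₂ b₁ E N (fun τ₂ τ₁ m => h τ₁ τ₂ m) :=
  ⟨hh.toReg.swap, hh.nonneg, fun τ₂ h₂ τ₁ h₁ m => by
    rw [mul_comm (b₂ τ₂)]; exact hh.bd τ₁ h₁ τ₂ h₂ m⟩

theorem Mem.add (hh : Mem D₁ D₂ b₁ b₂ E N h) (hh' : Mem D₁ D₂ b₁ b₂ E N' h') :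
    Mem D₁ D₂ b₁ b₂ E (N + N') (h + h') :=
  ⟨hh.toReg.add hh'.toReg, add_nonneg hh.nonneg hh'.nonneg, fun τ₁ h₁ τ₂ h₂ m =>
    (norm_add_le _ _).trans (by
      rw [add_mul]
      exact add_le_add (hh.bd _ h₁ _ h₂ _) (hh'.bd _ h₁ _ h₂ _))⟩

theorem Mem.sub (hh : Mem D₁ D₂ b₁ b₂ E N h) (hh' : Mem D₁ D₂ b₁ b₂ E N' h') :
    Mem D₁ D₂ b₁ b₂ E (N + N') (h - h') :=
  ⟨hh.toReg.sub hh'.toReg, add_nonneg hh.nonneg hh'.nonneg, fun τ₁ h₁ τ₂ h₂ m =>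
    (norm_sub_le _ _).trans (by
      rw [add_mul]
      exact add_le_add (hh.bd _ h₁ _ h₂ _) (hh'.bd _ h₁ _ h₂ _))⟩

theorem Mem.mono (hb₁ : ∀ τ, 0 ≤ b₁ τ) (hb₂ : ∀ τ, 0 ≤ b₂ τ) (hE : ∀ m, 0 ≤ E m)
    (hh : Mem D₁ D₂ b₁ b₂ E N h) (hN : N ≤ N') : Mem D₁ D₂ b₁ b₂ E N' h :=
  ⟨hh.toReg, hh.nonneg.trans hN, fun _ h₁ _ h₂ _ => (hh.bd _ h₁ _ h₂ _).trans
    (mul_le_mul_of_nonneg_right hN (mul_nonneg (mul_nonneg (hb₁ _) (hb₂ _)) (hE _)))⟩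

theorem Mem.mono_weight (hb₁ : ∀ τ, 0 ≤ b₁ τ) (hb₂ : ∀ τ, 0 ≤ b₂ τ) (hE : ∀ m, E m ≤ E' m)
    (hh : Mem D₁ D₂ b₁ b₂ E N h) : Mem D₁ D₂ b₁ b₂ E' N h :=
  ⟨hh.toReg, hh.nonneg, fun _ h₁ _ h₂ m => (hh.bd _ h₁ _ h₂ _).trans
    (mul_le_mul_of_nonneg_left (mul_le_mul_of_nonneg_left (hE m)
      (mul_nonneg (hb₁ _) (hb₂ _))) hh.nonneg)⟩

/-- The values of `A h` on the domains depend only on those of `h`. -/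
theorem LinOp.congr {A : (ℂ → ℂ → ℝ → ℂ) → ℂ → ℂ → ℝ → ℂ} (hA : LinOp D₁ D₂ b₁ b₂ E E' K A)
    (hh : Mem D₁ D₂ b₁ b₂ E N h) (hh' : Mem D₁ D₂ b₁ b₂ E N' h')
    (heq : ∀ τ₁ ∈ D₁.Ω, ∀ τ₂ ∈ D₂.Ω, ∀ m, h τ₁ τ₂ m = h' τ₁ τ₂ m) :
    ∀ τ₁ ∈ D₁.Ω, ∀ τ₂ ∈ D₂.Ω, ∀ m, A h τ₁ τ₂ m = A h' τ₁ τ₂ m := by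
  intro τ₁ h₁ τ₂ h₂ m
  have h0 : Mem D₁ D₂ b₁ b₂ E 0 (h - h') :=
    ⟨hh.toReg.sub hh'.toReg, le_rfl, fun τ₁ h₁ τ₂ h₂ m => by
      simp [heq τ₁ h₁ τ₂ h₂ m]⟩
  have h3 := (hA.mem h0).bd τ₁ h₁ τ₂ h₂ m
  rw [mul_zero, zero_mul, norm_le_zero_iff, hA.sub hh hh' _ h₁ _ h₂, sub_eq_zero] at h3
  exact h3

theorem LinOp.comp {A B : (ℂ → ℂ → ℝ → ℂ) → ℂ → ℂ → ℝ → ℂ} (hA : LinOp D₁ D₂ b₁ b₂ E' E'' K A)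
    (hB : LinOp D₁ D₂ b₁ b₂ E E' K' B) :
    LinOp D₁ D₂ b₁ b₂ E E'' (K * K') (fun h => A (B h)) where
  nonneg := mul_nonneg hA.nonneg hB.nonneg
  mem hh := by rw [mul_assoc]; exact hA.mem (hB.mem hh)
  sub := by
    intro h h' N N' hh hh' τ₁ h₁ τ₂ h₂ m
    rw [← hA.sub (hB.mem hh) (hB.mem hh') _ h₁ _ h₂]
    exact hA.congr (hB.mem (hh.sub hh')) ((hB.mem hh).sub (hB.mem hh'))
      (fun τ₁ h₁ τ₂ h₂ m => hB.sub hh hh' _ h₁ _ h₂ _) _ h₁ _ h₂ _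

theorem LinOp.swap {A : (ℂ → ℂ → ℝ → ℂ) → ℂ → ℂ → ℝ → ℂ} (hA : LinOp D₁ D₂ b₁ b₂ E E' K A) :
    LinOp D₂ D₁ b₂ b₁ E E' K (swapOp A) where
  nonneg := hA.nonneg
  mem hh := (hA.mem hh.swap).swap
  sub hh hh' _ h₂ _ h₁ m := hA.sub hh.swap hh'.swap _ h₁ _ h₂ m

theorem LinOp.zero : LinOp D₁ D₂ b₁ b₂ E E' 0 (fun _ => 0) where
  nonneg := le_rfl
  mem _ := ⟨Reg.of_continuous continuous_const, by simp, fun _ _ _ _ _ => by simp⟩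
  sub _ _ _ _ _ _ _ := by simp

theorem LinOp.add {A B : (ℂ → ℂ → ℝ → ℂ) → ℂ → ℂ → ℝ → ℂ} (hA : LinOp D₁ D₂ b₁ b₂ E E' K A)
    (hB : LinOp D₁ D₂ b₁ b₂ E E' K' B) :
    LinOp D₁ D₂ b₁ b₂ E E' (K + K') (fun h => A h + B h) where
  nonneg := add_nonneg hA.nonneg hB.nonneg
  mem hh := by rw [add_mul]; exact (hA.mem hh).add (hB.mem hh)
  sub hh hh' τ₁ h₁ τ₂ h₂ m := by
    simp only [Pi.add_apply, hA.sub hh hh' _ h₁ _ h₂, hB.sub hh hh' _ h₁ _ h₂]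
    ring

theorem LinOp.sum {ι : Type*} (s : Finset ι) {A : ι → (ℂ → ℂ → ℝ → ℂ) → ℂ → ℂ → ℝ → ℂ}
    {K : ι → ℝ} (hA : ∀ i ∈ s, LinOp D₁ D₂ b₁ b₂ E E' (K i) (A i)) :
    LinOp D₁ D₂ b₁ b₂ E E' (∑ i ∈ s, K i) (fun h => ∑ i ∈ s, A i h) := by
  classical
  induction s using Finset.induction_on with
  | empty => simpa using LinOp.zero
  | insert i s hi ih =>
    simp only [Finset.sum_insert hi]
    exact (hA i (by simp)).add (ih fun j hj => hA j (by simp [hj]))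

/-- Multiplication by a continuous function of `m`. -/
theorem LinOp.mulm (hb₁ : ∀ τ, 0 ≤ b₁ τ) (hb₂ : ∀ τ, 0 ≤ b₂ τ) {ρ : ℝ → ℂ} (hρ : Continuous ρ)
    (hK : 0 ≤ K) (hle : ∀ m, ‖ρ m‖ * E m ≤ K * E' m) :
    LinOp D₁ D₂ b₁ b₂ E E' K (fun h τ₁ τ₂ m => ρ m * h τ₁ τ₂ m) where
  nonneg := hK
  mem {h N} hh := by
    refine ⟨(Reg.of_continuous hρ).mul hh.toReg, mul_nonneg hK hh.nonneg, fun τ₁ h₁ τ₂ h₂ m => ?_⟩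
    rw [norm_mul]
    calc ‖ρ m‖ * ‖h τ₁ τ₂ m‖ ≤ ‖ρ m‖ * (N * (b₁ τ₁ * b₂ τ₂ * E m)) := by
          gcongr; exact hh.bd _ h₁ _ h₂ _
      _ = (N * (b₁ τ₁ * b₂ τ₂)) * (‖ρ m‖ * E m) := by ring
      _ ≤ (N * (b₁ τ₁ * b₂ τ₂)) * (K * E' m) :=
          mul_le_mul_of_nonneg_left (hle m) (mul_nonneg hh.nonneg (mul_nonneg (hb₁ _) (hb₂ _)))
      _ = _ := by ring
  sub _ _ _ _ _ _ _ := by simp [mul_sub]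

theorem LinOp.mono (hb₁ : ∀ τ, 0 ≤ b₁ τ) (hb₂ : ∀ τ, 0 ≤ b₂ τ) (hE : ∀ m, 0 ≤ E' m)
    {A : (ℂ → ℂ → ℝ → ℂ) → ℂ → ℂ → ℝ → ℂ} (hA : LinOp D₁ D₂ b₁ b₂ E E' K A) (hK : K ≤ K') :
    LinOp D₁ D₂ b₁ b₂ E E' K' A where
  nonneg := hA.nonneg.trans hK
  mem hh := (hA.mem hh).mono hb₁ hb₂ hE (mul_le_mul_of_nonneg_right hK hh.nonneg)
  sub := hA.sub

end weighted

/-! ### Scalar estimates for the exponential weight -/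

/-- The growth allowed to an element of the weighted space at the distance `x = |τ/ε|`. -/
def wt (ν : ℝ) (k : ℕ) (x : ℝ) : ℝ := x / (1 + x ^ (2 * k)) * Real.exp (ν * x ^ k)

theorem wt_nonneg {ν : ℝ} {k : ℕ} {x : ℝ} (hx : 0 ≤ x) : 0 ≤ wt ν k x := by
  unfold wt; positivity

theorem continuous_wt (ν : ℝ) (k : ℕ) : Continuous (wt ν k) := by
  unfold wt
  refine (continuous_id.div (by fun_prop) fun x => ?_).mul (by fun_prop)
  have : 0 ≤ x ^ (2 * k) := by rw [pow_mul]; positivity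
  positivity

theorem wt_le {ν : ℝ} (hν : 0 < ν) {k : ℕ} {x M : ℝ} (hx : 0 ≤ x) (hM : x ≤ M) :
    wt ν k x ≤ x * Real.exp (ν * M ^ k) := by
  unfold wt
  gcongr
  exact div_le_self hx (by have := pow_nonneg hx (2 * k); linarith)

theorem rpow_inv_pow {k : ℕ} (hk : 1 ≤ k) {t : ℝ} (ht : 0 ≤ t) : (t ^ (1 / (k : ℝ))) ^ k = t := by
  rw [one_div]
  exact Real.rpow_inv_natCast_pow ht (by omega)

theorem wt_scale {ν : ℝ} {k : ℕ} (hk : 1 ≤ k) {t x : ℝ} (ht : 0 ≤ t) :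
    wt ν k (t ^ (1 / (k : ℝ)) * x)
      = t ^ (1 / (k : ℝ)) * x / (1 + (t * x ^ k) ^ 2) * Real.exp (ν * (t * x ^ k)) := by
  unfold wt
  rw [mul_comm 2 k, pow_mul, mul_pow _ _ k, rpow_inv_pow hk ht]

/-- Exponential decay beats every power. -/
theorem exists_exp_le_rpow {ν a : ℝ} (hν : 0 < ν) (ha : 0 < a) :
    ∃ C : ℝ, 0 < C ∧ ∀ X : ℝ, 0 ≤ X →
      (1 + X ^ 2) * Real.exp (-(ν * X / 2)) ≤ C * (1 + X) ^ (-a) := by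
  set n := a + 2 with hn
  have hn0 : 0 < n := by positivity
  set c := max 1 (2 * n / ν) with hc
  have hc1 : 1 ≤ c := le_max_left _ _
  have hc2 : 2 * n / ν ≤ c := le_max_right _ _
  refine ⟨c ^ n, by positivity, fun X hX => ?_⟩
  have h1 : 1 + X ≤ c * Real.exp (ν * X / (2 * n)) := by
    have h2 : X ≤ c * (ν * X / (2 * n)) := by
      calc X = 2 * n / ν * (ν * X / (2 * n)) := by field_simp
        _ ≤ _ := by gcongr
    have h3 := Real.add_one_le_exp (ν * X / (2 * n))
    nlinarith
  have h2 : (1 + X) ^ n ≤ c ^ n * Real.exp (ν * X / 2) := by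
    calc (1 + X) ^ n ≤ (c * Real.exp (ν * X / (2 * n))) ^ n :=
          Real.rpow_le_rpow (by positivity) h1 hn0.le
      _ = _ := by
          rw [Real.mul_rpow (by positivity) (by positivity), ← Real.exp_mul]
          congr 2
          field_simp
  have h3 : (1 + X) ^ n = (1 + X) ^ a * (1 + X) ^ 2 := by
    rw [hn, Real.rpow_add (by positivity), Real.rpow_two]
  rw [Real.exp_neg, Real.rpow_neg (by positivity), ← div_eq_mul_inv, ← div_eq_mul_inv,
    div_le_div_iff₀ (by positivity) (by positivity)]
  calc (1 + X ^ 2) * (1 + X) ^ a ≤ (1 + X) ^ 2 * (1 + X) ^ a := by gcongr; nlinarith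
    _ = (1 + X) ^ n := by rw [h3]; ring
    _ ≤ _ := h2

theorem rpow_le_two {y r : ℝ} (h1 : 1 / 2 ≤ y) (h2 : y ≤ 1) (hr : -1 < r) : y ^ r ≤ 2 := by
  calc y ^ r ≤ y ^ (-1 : ℝ) := Real.rpow_le_rpow_of_exponent_ge (by linarith) h2 hr.le
    _ = 1 / y := by rw [Real.rpow_neg_one, one_div]
    _ ≤ 2 := by rw [div_le_iff₀ (by linarith)]; linarith

theorem integrableOn_rpow_sub_one {b : ℝ} (hb : 0 < b) :
    IntegrableOn (fun t : ℝ => t ^ (b - 1)) (Ioc 0 1) :=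
  (intervalIntegrable_iff_integrableOn_Ioc_of_le zero_le_one).1
    (intervalIntegral.intervalIntegrable_rpow' (by linarith))

theorem integrableOn_comp_one_sub {f : ℝ → ℝ} (hf : IntegrableOn f (Ioc 0 1)) :
    IntegrableOn (fun t => f (1 - t)) (Ioc 0 1) := by
  have := ((intervalIntegrable_iff_integrableOn_Ioc_of_le zero_le_one).2 hf).comp_sub_left 1
  simp only [sub_zero, sub_self] at this
  exact (intervalIntegrable_iff_integrableOn_Ioc_of_le zero_le_one).1 this.symm

theorem setIntegral_comp_one_sub (f : ℝ → ℝ) :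
    ∫ t in Ioc (0 : ℝ) 1, f (1 - t) = ∫ t in Ioc (0 : ℝ) 1, f t := by
  rw [← intervalIntegral.integral_of_le zero_le_one, ← intervalIntegral.integral_of_le zero_le_one]
  simp

/-- The integrand of the Beta integral. -/
theorem integrableOn_beta {a b : ℝ} (ha : 0 < a) (hb : 0 < b) :
    IntegrableOn (fun t : ℝ => (1 - t) ^ (a - 1) * t ^ (b - 1)) (Ioc 0 1) := by
  refine Integrable.mono' ((((integrableOn_comp_one_sub (integrableOn_rpow_sub_one ha))).const_mul
    2).add ((integrableOn_rpow_sub_one hb).const_mul 2)) (by fun_prop) ?_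
  refine (ae_restrict_iff' measurableSet_Ioc).2 (.of_forall fun t ht => ?_)
  have h1 : 0 ≤ (1 - t) ^ (a - 1) := Real.rpow_nonneg (by linarith [ht.2]) _
  have h2 : 0 ≤ t ^ (b - 1) := Real.rpow_nonneg ht.1.le _
  rw [Real.norm_of_nonneg (mul_nonneg h1 h2)]
  simp only [Pi.add_apply]
  rcases le_total t (1 / 2) with h | h
  · have := rpow_le_two (y := 1 - t) (by linarith) (by linarith [ht.1]) (r := a - 1) (by linarith)
    nlinarith
  · have := rpow_le_two h ht.2 (r := b - 1) (by linarith)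
    nlinarith

theorem setIntegral_rpow_mul_exp_le {a r : ℝ} (ha : 0 < a) (hr : 0 < r) :
    IntegrableOn (fun s : ℝ => s ^ (a - 1) * Real.exp (-(r * s))) (Ioc 0 1) ∧
    ∫ s in Ioc (0 : ℝ) 1, s ^ (a - 1) * Real.exp (-(r * s)) ≤ (1 / r) ^ a * Real.Gamma a := by
  have hi : IntegrableOn (fun s : ℝ => s ^ (a - 1) * Real.exp (-(r * s))) (Ioi 0) := by
    have := integrableOn_rpow_mul_exp_neg_mul_rpow (s := a - 1) (p := 1) (b := r)
      (by linarith) zero_lt_one hr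
    simpa [neg_mul] using this
  refine ⟨hi.mono_set Ioc_subset_Ioi_self, ?_⟩
  rw [← Real.integral_rpow_mul_exp_neg_mul_Ioi ha hr]
  refine setIntegral_mono_set hi ?_ Ioc_subset_Ioi_self.eventuallyLE
  refine (ae_restrict_iff' measurableSet_Ioi).2 (.of_forall fun t ht => ?_)
  exact mul_nonneg (Real.rpow_nonneg (le_of_lt ht) _) (Real.exp_pos _).le

/-- The integrand of the Volterra operator with kernel `(1-t)^{a-1} t^{p-1}`, applied to the
weight, is dominated by the integrand of a Beta integral. -/
theorem kernel_wt_le {ν : ℝ} (hν : 0 < ν) {k : ℕ} (a : ℝ) (p : ℕ) {x M t : ℝ}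
    (hx : 0 ≤ x) (hM : x ≤ M) (ht : t ∈ Ioc (0 : ℝ) 1) :
    (1 - t) ^ (a - 1) * t ^ p / t * wt ν k (t ^ (1 / (k : ℝ)) * x)
      ≤ (1 - t) ^ (a - 1) * t ^ (1 / (k : ℝ) - 1) * (M * Real.exp (ν * M ^ k)) := by
  have hb : t ^ (1 / (k : ℝ)) ≤ 1 := Real.rpow_le_one ht.1.le ht.2 (by positivity)
  have hb0 : 0 ≤ t ^ (1 / (k : ℝ)) := Real.rpow_nonneg ht.1.le _
  have h1 : 0 ≤ (1 - t) ^ (a - 1) := Real.rpow_nonneg (by linarith [ht.2]) _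
  have h2 := wt_le hν (k := k) (mul_nonneg hb0 hx)
    ((mul_le_of_le_one_left hx hb).trans hM)
  have h3 : t ^ p ≤ 1 := pow_le_one₀ ht.1.le ht.2
  rw [Real.rpow_sub_one ht.1.ne']
  have ht0 := ht.1
  calc (1 - t) ^ (a - 1) * t ^ p / t * wt ν k (t ^ (1 / (k : ℝ)) * x)
      ≤ (1 - t) ^ (a - 1) * 1 / t * (t ^ (1 / (k : ℝ)) * M * Real.exp (ν * M ^ k)) := by
        have h4 : wt ν k (t ^ (1 / (k : ℝ)) * x)
            ≤ t ^ (1 / (k : ℝ)) * M * Real.exp (ν * M ^ k) := h2.trans (by gcongr)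
        have := wt_nonneg (ν := ν) (k := k) (mul_nonneg hb0 hx)
        gcongr
    _ = _ := by ring

/-- Pointwise form of `exists_kernel_bound`: for `t ≥ 1/2` the weights are comparable up to the
exponential, for `t ≤ 1/2` the exponential is small. -/
theorem kernel_wt_le_add {ν : ℝ} (hν : 0 < ν) {k : ℕ} (hk : 1 ≤ k) {a : ℝ} (ha : 0 < a) {C' : ℝ}
    (hC' : ∀ X : ℝ, 0 ≤ X → (1 + X ^ 2) * Real.exp (-(ν * X / 2)) ≤ C' * (1 + X) ^ (-a))
    (hC'0 : 0 < C') (p : ℕ) {x t X : ℝ} (hx : 0 ≤ x) (hX : X = x ^ k) (ht : t ∈ Ioc (0 : ℝ) 1) :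
    (1 - t) ^ (a - 1) * t ^ p / t * wt ν k (t ^ (1 / (k : ℝ)) * x) ≤
      8 * Real.exp ν * wt ν k x * ((1 - t) ^ (a - 1) * Real.exp (-(ν * (1 + X) * (1 - t))))
      + 2 * C' * (1 + X) ^ (-a) * wt ν k x * t ^ (1 / (k : ℝ) - 1) := by
  have hX0 : 0 ≤ X := by rw [hX]; positivity
  have hk0 : (0 : ℝ) < k := by exact_mod_cast hk
  have hb : 0 < 1 / (k : ℝ) := by positivity
  have hw := wt_nonneg (ν := ν) (k := k) hx
  have ht0 := ht.1
  have hs : 0 ≤ (1 - t) ^ (a - 1) := Real.rpow_nonneg (by linarith [ht.2]) _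
  have hb0 : 0 ≤ t ^ (1 / (k : ℝ) - 1) := Real.rpow_nonneg ht0.le _
  have hp1 : t ^ p ≤ 1 := pow_le_one₀ ht0.le ht.2
  set R := (1 + X ^ 2) / (1 + (t * X) ^ 2) * Real.exp (-(ν * (1 - t) * X)) with hR
  have hR0 : 0 ≤ R := by positivity
  have hw' : wt ν k (t ^ (1 / (k : ℝ)) * x) = wt ν k x * t ^ (1 / (k : ℝ)) * R := by
    rw [wt_scale hk ht0.le, hR, ← hX, wt, mul_comm 2 k, pow_mul, ← hX]
    have : Real.exp (ν * (t * X)) = Real.exp (ν * X) * Real.exp (-(ν * (1 - t) * X)) := by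
      rw [← Real.exp_add]; congr 1; ring
    rw [this]
    field_simp
  have hL : (1 - t) ^ (a - 1) * t ^ p / t * wt ν k (t ^ (1 / (k : ℝ)) * x)
      ≤ (1 - t) ^ (a - 1) * t ^ (1 / (k : ℝ) - 1) * R * wt ν k x := by
    rw [hw', Real.rpow_sub_one ht0.ne']
    calc (1 - t) ^ (a - 1) * t ^ p / t * (wt ν k x * t ^ (1 / (k : ℝ)) * R)
        ≤ (1 - t) ^ (a - 1) * 1 / t * (wt ν k x * t ^ (1 / (k : ℝ)) * R) := by gcongr
      _ = _ := by ring
  refine hL.trans ?_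
  have he0 := Real.exp_pos (-(ν * (1 + X) * (1 - t)))
  have hXa : 0 ≤ (1 + X) ^ (-a) := by positivity
  rcases le_total t (1 / 2) with h | h
  · have h1 := rpow_le_two (y := 1 - t) (by linarith) (by linarith) (r := a - 1) (by linarith)
    have h2 : R ≤ C' * (1 + X) ^ (-a) := by
      refine le_trans ?_ (hC' X hX0)
      rw [hR]
      gcongr
      · exact div_le_self (by positivity) (by nlinarith [sq_nonneg (t * X)])
      · nlinarith [mul_nonneg hν.le hX0]
    calc (1 - t) ^ (a - 1) * t ^ (1 / (k : ℝ) - 1) * R * wt ν k x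
        ≤ 2 * t ^ (1 / (k : ℝ) - 1) * (C' * (1 + X) ^ (-a)) * wt ν k x := by gcongr
      _ ≤ _ := by
        have : 0 ≤ 8 * Real.exp ν * wt ν k x *
          ((1 - t) ^ (a - 1) * Real.exp (-(ν * (1 + X) * (1 - t)))) := by positivity
        nlinarith
  · have h1 := rpow_le_two h ht.2 (r := 1 / (k : ℝ) - 1) (by linarith)
    have h2 : R ≤ 4 * (Real.exp ν * Real.exp (-(ν * (1 + X) * (1 - t)))) := by
      rw [hR, ← Real.exp_add]
      gcongr
      · rw [div_le_iff₀ (by positivity)]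
        nlinarith [mul_nonneg (mul_nonneg (sub_nonneg.2 h) (by linarith : (0:ℝ) ≤ t + 1 / 2))
          (sq_nonneg X)]
      · nlinarith [mul_nonneg hν.le ht0.le]
    calc (1 - t) ^ (a - 1) * t ^ (1 / (k : ℝ) - 1) * R * wt ν k x
        ≤ (1 - t) ^ (a - 1) * 2 * (4 * (Real.exp ν * Real.exp (-(ν * (1 + X) * (1 - t)))))
          * wt ν k x := by gcongr
      _ ≤ _ := by
        have : 0 ≤ 2 * C' * (1 + X) ^ (-a) * wt ν k x * t ^ (1 / (k : ℝ) - 1) := by positivity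
        nlinarith

/-- The Volterra operator with kernel `(1-t)^{a-1} t^{p-1}` maps the weight to itself and gains the
factor `(1 + x^k)^{-a}`: the exponential concentrates the integral near `t = 1`. -/
theorem exists_kernel_bound {ν : ℝ} (hν : 0 < ν) {k : ℕ} (hk : 1 ≤ k) {a : ℝ} (ha : 0 < a) :
    ∃ C : ℝ, 0 < C ∧ ∀ (p : ℕ) (x : ℝ), 0 ≤ x →
      IntegrableOn (fun t => (1 - t) ^ (a - 1) * t ^ p / t * wt ν k (t ^ (1 / (k : ℝ)) * x))
        (Ioc 0 1) ∧
      ∫ t in Ioc (0 : ℝ) 1, (1 - t) ^ (a - 1) * t ^ p / t * wt ν k (t ^ (1 / (k : ℝ)) * x)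
        ≤ C * (1 + x ^ k) ^ (-a) * wt ν k x := by
  obtain ⟨C', hC'0, hC'⟩ := exists_exp_le_rpow hν ha
  have hk0 : (0 : ℝ) < k := by exact_mod_cast hk
  have hb : 0 < 1 / (k : ℝ) := by positivity
  have hG := Real.Gamma_pos_of_pos ha
  refine ⟨8 * Real.exp ν * ((1 / ν) ^ a * Real.Gamma a) + 2 * C' * k, by positivity,
    fun p x hx => ?_⟩
  set X := x ^ k with hX
  have hX0 : 0 ≤ X := by positivity
  have hmeas : Measurable
      (fun t => (1 - t) ^ (a - 1) * t ^ p / t * wt ν k (t ^ (1 / (k : ℝ)) * x)) := by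
    have := (continuous_wt ν k).measurable
    fun_prop
  have hnn : ∀ t ∈ Ioc (0 : ℝ) 1,
      0 ≤ (1 - t) ^ (a - 1) * t ^ p / t * wt ν k (t ^ (1 / (k : ℝ)) * x) := by
    intro t ht
    have h1 : 0 ≤ (1 - t) ^ (a - 1) := Real.rpow_nonneg (by linarith [ht.2]) _
    have h2 := ht.1.le
    have := wt_nonneg (ν := ν) (k := k) (mul_nonneg (Real.rpow_nonneg h2 (1 / (k : ℝ))) hx)
    positivity
  have hint : IntegrableOn
      (fun t => (1 - t) ^ (a - 1) * t ^ p / t * wt ν k (t ^ (1 / (k : ℝ)) * x)) (Ioc 0 1) := by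
    refine Integrable.mono' ((integrableOn_beta ha hb).mul_const (x * Real.exp (ν * x ^ k)))
      hmeas.aestronglyMeasurable ?_
    refine (ae_restrict_iff' measurableSet_Ioc).2 (.of_forall fun t ht => ?_)
    rw [Real.norm_of_nonneg (hnn t ht)]
    exact kernel_wt_le hν a p hx le_rfl ht
  refine ⟨hint, ?_⟩
  have hr : 0 < ν * (1 + X) := by positivity
  obtain ⟨hi1, hle1⟩ := setIntegral_rpow_mul_exp_le ha hr
  have hi2 := integrableOn_comp_one_sub hi1
  have hle2 := setIntegral_comp_one_sub (fun s : ℝ => s ^ (a - 1) * Real.exp (-(ν * (1 + X) * s)))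
  have hi3 := integrableOn_rpow_sub_one hb
  have hle3 : ∫ t in Ioc (0 : ℝ) 1, t ^ (1 / (k : ℝ) - 1) = k := by
    rw [← intervalIntegral.integral_of_le zero_le_one, integral_rpow (.inl (by linarith))]
    simp [Real.zero_rpow (inv_ne_zero hk0.ne')]
  have hw := wt_nonneg (ν := ν) (k := k) hx
  calc ∫ t in Ioc (0 : ℝ) 1, (1 - t) ^ (a - 1) * t ^ p / t * wt ν k (t ^ (1 / (k : ℝ)) * x)
      ≤ ∫ t in Ioc (0 : ℝ) 1,
        (8 * Real.exp ν * wt ν k x * ((1 - t) ^ (a - 1) * Real.exp (-(ν * (1 + X) * (1 - t))))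
        + 2 * C' * (1 + X) ^ (-a) * wt ν k x * t ^ (1 / (k : ℝ) - 1)) :=
        setIntegral_mono_on hint ((hi2.const_mul _).add (hi3.const_mul _)) measurableSet_Ioc
          fun t ht => kernel_wt_le_add hν hk ha hC' hC'0 p hx hX ht
    _ = 8 * Real.exp ν * wt ν k x *
          (∫ s in Ioc (0 : ℝ) 1, s ^ (a - 1) * Real.exp (-(ν * (1 + X) * s)))
        + 2 * C' * (1 + X) ^ (-a) * wt ν k x * k := by
        rw [integral_add (hi2.const_mul _) (hi3.const_mul _), integral_const_mul,
          integral_const_mul, hle2, hle3]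
    _ ≤ 8 * Real.exp ν * wt ν k x * ((1 / (ν * (1 + X))) ^ a * Real.Gamma a)
        + 2 * C' * (1 + X) ^ (-a) * wt ν k x * k := by gcongr
    _ = _ := by
        rw [← one_div_mul_one_div, Real.mul_rpow (by positivity) (by positivity),
          Real.rpow_neg (by positivity), one_div (1 + X), Real.inv_rpow (by positivity)]
        ring

theorem conv_kernel_nonneg {ν : ℝ} {k : ℕ} {x u : ℝ} (hx : 0 ≤ x) (hu : u ∈ Ioc (0 : ℝ) 1) :
    0 ≤ 1 / ((1 - u) * u) * wt ν k ((1 - u) ^ (1 / (k : ℝ)) * x)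
      * wt ν k (u ^ (1 / (k : ℝ)) * x) := by
  have h1 : 0 ≤ 1 - u := by linarith [hu.2]
  have h2 := hu.1.le
  have := wt_nonneg (ν := ν) (k := k) (mul_nonneg (Real.rpow_nonneg h2 (1 / (k : ℝ))) hx)
  have := wt_nonneg (ν := ν) (k := k) (mul_nonneg (Real.rpow_nonneg h1 (1 / (k : ℝ))) hx)
  positivity

theorem conv_kernel_le {ν : ℝ} (hν : 0 < ν) {k : ℕ} {x M u : ℝ}
    (hx : 0 ≤ x) (hM : x ≤ M) (hu : u ∈ Ioc (0 : ℝ) 1) :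
    1 / ((1 - u) * u) * wt ν k ((1 - u) ^ (1 / (k : ℝ)) * x) * wt ν k (u ^ (1 / (k : ℝ)) * x)
      ≤ (1 - u) ^ (1 / (k : ℝ) - 1) * u ^ (1 / (k : ℝ) - 1) * (M * Real.exp (ν * M ^ k)) ^ 2 := by
  rcases hu.2.eq_or_lt with rfl | hu1
  · simp only [sub_self, zero_mul, div_zero]
    have := Real.rpow_nonneg (le_refl (0 : ℝ)) (1 / (k : ℝ) - 1)
    positivity
  have h0 : 0 < 1 - u := by linarith
  have key : ∀ t : ℝ, 0 < t → t ≤ 1 → wt ν k (t ^ (1 / (k : ℝ)) * x) / t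
      ≤ t ^ (1 / (k : ℝ) - 1) * (M * Real.exp (ν * M ^ k)) := by
    intro t ht ht1
    have := kernel_wt_le hν 1 0 (k := k) hx hM (t := t) ⟨ht, ht1⟩
    simp only [sub_self, Real.rpow_zero, pow_zero, one_mul, mul_one] at this
    rwa [div_mul_eq_mul_div, one_mul] at this
  have h1 := key (1 - u) h0 (by linarith [hu.1])
  have h2 := key u hu.1 hu.2
  have h3 : 0 ≤ wt ν k (u ^ (1 / (k : ℝ)) * x) / u := div_nonneg (wt_nonneg (mul_nonneg
    (Real.rpow_nonneg hu.1.le _) hx)) hu.1.le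
  have h4 : 0 ≤ (1 - u) ^ (1 / (k : ℝ) - 1) * (M * Real.exp (ν * M ^ k)) := mul_nonneg
    (Real.rpow_nonneg h0.le _) (mul_nonneg (hx.trans hM) (Real.exp_pos _).le)
  calc _ = (wt ν k ((1 - u) ^ (1 / (k : ℝ)) * x) / (1 - u))
        * (wt ν k (u ^ (1 / (k : ℝ)) * x) / u) := by field_simp
    _ ≤ _ := mul_le_mul h1 h2 h3 h4
    _ = _ := by ring

/-- The exact primitive `u^b (1 + uX)^{-b} / b` of `u^{b-1} (1 + uX)^{-(1+b)}`. -/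
theorem setIntegral_rpow_mul_one_add_rpow {b X : ℝ} (hb : 0 < b) (hX : 0 ≤ X) :
    IntegrableOn (fun u : ℝ => u ^ (b - 1) * (1 + u * X) ^ (-(1 + b))) (Ioc 0 1) ∧
    ∫ u in Ioc (0 : ℝ) 1, u ^ (b - 1) * (1 + u * X) ^ (-(1 + b)) = 1 / b * (1 + X) ^ (-b) := by
  have hi : IntegrableOn (fun u : ℝ => u ^ (b - 1) * (1 + u * X) ^ (-(1 + b))) (Ioc 0 1) := by
    refine Integrable.mono' (integrableOn_rpow_sub_one hb) (by fun_prop) ?_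
    refine (ae_restrict_iff' measurableSet_Ioc).2 (.of_forall fun u hu => ?_)
    have hu0 := hu.1.le
    have h1 : 1 ≤ 1 + u * X := by have := mul_nonneg hu0 hX; linarith
    have h2 : (1 + u * X) ^ (-(1 + b)) ≤ 1 :=
      Real.rpow_le_one_of_one_le_of_nonpos h1 (by linarith)
    have h3 := Real.rpow_nonneg hu0 (b - 1)
    rw [Real.norm_of_nonneg (by positivity)]
    exact mul_le_of_le_one_right h3 h2
  refine ⟨hi, ?_⟩
  rw [← intervalIntegral.integral_of_le zero_le_one]
  have hpos : ∀ u ∈ Icc (0 : ℝ) 1, 0 < 1 + u * X := fun u hu => by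
    have := mul_nonneg hu.1 hX; linarith
  rw [intervalIntegral.integral_eq_sub_of_hasDerivAt_of_le zero_le_one
    (f := fun u : ℝ => 1 / b * (u ^ b * (1 + u * X) ^ (-b)))]
  · simp [Real.zero_rpow hb.ne']
  · refine ContinuousOn.mul continuousOn_const (ContinuousOn.mul ?_ ?_)
    · exact (Real.continuous_rpow_const hb.le).continuousOn
    · exact ContinuousOn.rpow_const (by fun_prop) fun u hu => .inl (hpos u hu).ne'
  · intro u hu
    have hu0 : u ≠ 0 := hu.1.ne'
    have hp := hpos u ⟨hu.1.le, hu.2.le⟩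
    have d1 := Real.hasDerivAt_rpow_const (x := u) (p := b) (.inl hu0)
    have d2 : HasDerivAt (fun u : ℝ => 1 + u * X) X u := by
      simpa using ((hasDerivAt_id u).mul_const X).const_add 1
    have d3 := d2.rpow_const (p := -b) (.inl hp.ne')
    refine ((d1.mul d3).const_mul (1 / b)).congr_deriv ?_
    have e1 : u ^ b = u ^ (b - 1) * u := by rw [Real.rpow_sub_one hu0]; field_simp
    have e2 : (1 + u * X) ^ (-b) = (1 + u * X) ^ (-(1 + b)) * (1 + u * X) := by
      rw [show -(1 + b) = -b - 1 by ring, Real.rpow_sub_one hp.ne']; field_simp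
    rw [e1, show -b - 1 = -(1 + b) by ring, e2]
    field_simp
    ring
  · exact (intervalIntegrable_iff_integrableOn_Ioc_of_le zero_le_one).2 hi

/-- The weight is stable under the convolution of the Borel plane. -/
theorem exists_conv_bound {ν : ℝ} (hν : 0 < ν) {k : ℕ} (hk : 1 ≤ k) :
    ∃ C : ℝ, 0 < C ∧ ∀ x : ℝ, 0 ≤ x →
      IntegrableOn (fun u => 1 / ((1 - u) * u) * wt ν k ((1 - u) ^ (1 / (k : ℝ)) * x)
        * wt ν k (u ^ (1 / (k : ℝ)) * x)) (Ioc 0 1) ∧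
      ∫ u in Ioc (0 : ℝ) 1, 1 / ((1 - u) * u) * wt ν k ((1 - u) ^ (1 / (k : ℝ)) * x)
        * wt ν k (u ^ (1 / (k : ℝ)) * x) ≤ C * wt ν k x := by
  have hk0 : (0 : ℝ) < k := by exact_mod_cast hk
  have hk1 : (1 : ℝ) ≤ k := by exact_mod_cast hk
  refine ⟨32 * k, by positivity, fun x hx => ?_⟩
  set b := 1 / (k : ℝ) with hbdef
  have hb : 0 < b := by positivity
  have hb1 : b ≤ 1 := by rw [hbdef, div_le_one hk0]; exact hk1
  set X := x ^ k with hX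
  have hX0 : 0 ≤ X := by positivity
  have hw := wt_nonneg (ν := ν) (k := k) hx
  have hint : IntegrableOn (fun u => 1 / ((1 - u) * u) * wt ν k ((1 - u) ^ b * x)
        * wt ν k (u ^ b * x)) (Ioc 0 1) := by
    refine Integrable.mono' ((integrableOn_beta hb hb).mul_const ((x * Real.exp (ν * x ^ k)) ^ 2))
      ?_ ?_
    · have := (continuous_wt ν k).measurable
      fun_prop
    refine (ae_restrict_iff' measurableSet_Ioc).2 (.of_forall fun t ht => ?_)
    rw [Real.norm_of_nonneg (conv_kernel_nonneg hx ht)]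
    exact conv_kernel_le hν hx le_rfl ht
  refine ⟨hint, ?_⟩
  set f : ℝ → ℝ := fun u => u ^ (b - 1) * (1 + u * X) ^ (-(1 + b)) with hf
  obtain ⟨hi1, he1⟩ := setIntegral_rpow_mul_one_add_rpow hb hX0
  have hi2 := integrableOn_comp_one_sub hi1
  have he2 := setIntegral_comp_one_sub f
  have hf0 : ∀ u, 0 ≤ u → 0 ≤ f u := fun u hu => by
    have := mul_nonneg hu hX0
    exact mul_nonneg (Real.rpow_nonneg hu _) (by positivity)
  -- the case `u ≤ 1/2`, with `v = 1 - u`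
  have half : ∀ u v : ℝ, 0 < u → u ≤ 1 / 2 → v = 1 - u →
      1 / (v * u) * wt ν k (v ^ b * x) * wt ν k (u ^ b * x) ≤ 16 * x * wt ν k x * f u := by
    intro u v hu hu2 hv
    have hv0 : 1 / 2 ≤ v := by linarith
    have hvp : 0 < v := by linarith
    have e1 : wt ν k (v ^ b * x) * wt ν k (u ^ b * x) / (v * u)
        = wt ν k x * x * (v ^ (b - 1) * u ^ (b - 1)
          * ((1 + X ^ 2) / (1 + (v * X) ^ 2)) * (1 / (1 + (u * X) ^ 2))) := by
      rw [wt_scale hk hvp.le, wt_scale hk hu.le, ← hX, wt, mul_comm 2 k, pow_mul, ← hX,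
        Real.rpow_sub_one hvp.ne', Real.rpow_sub_one hu.ne', ← hbdef]
      have : Real.exp (ν * X) = Real.exp (ν * (v * X)) * Real.exp (ν * (u * X)) := by
        rw [← Real.exp_add, hv]; congr 1; ring
      rw [this]
      field_simp
    have h1 : v ^ (b - 1) ≤ 2 := rpow_le_two hv0 (by linarith) (by linarith)
    have h2 : (1 + X ^ 2) / (1 + (v * X) ^ 2) ≤ 4 := by
      rw [div_le_iff₀ (by positivity)]
      nlinarith [mul_nonneg (mul_nonneg (sub_nonneg.2 hv0) (by linarith : (0:ℝ) ≤ v + 1 / 2))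
            (sq_nonneg X)]
    have hq : 1 ≤ 1 + u * X := by have := mul_nonneg hu.le hX0; linarith
    have h3 : 1 / (1 + (u * X) ^ 2) ≤ 2 * (1 + u * X) ^ (-(1 + b)) := by
      have h4 : (1 + u * X) ^ (-2 : ℝ) ≤ (1 + u * X) ^ (-(1 + b)) :=
        Real.rpow_le_rpow_of_exponent_le hq (by linarith)
      have h5 : (1 + u * X) ^ (-2 : ℝ) = 1 / (1 + u * X) ^ 2 := by
        rw [Real.rpow_neg (by linarith), Real.rpow_two, one_div]
      have h6 : 1 / (1 + (u * X) ^ 2) ≤ 2 * (1 / (1 + u * X) ^ 2) := by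
        rw [mul_one_div, div_le_div_iff₀ (by positivity) (by positivity)]
        nlinarith [sq_nonneg (1 - u * X)]
      linarith
    have hub : 0 ≤ u ^ (b - 1) := Real.rpow_nonneg hu.le _
    have hvb : 0 ≤ v ^ (b - 1) := Real.rpow_nonneg hvp.le _
    calc _ = wt ν k (v ^ b * x) * wt ν k (u ^ b * x) / (v * u) := by ring
      _ = _ := e1
      _ ≤ wt ν k x * x * (2 * u ^ (b - 1) * 4 * (2 * (1 + u * X) ^ (-(1 + b)))) := by gcongr
      _ = _ := by rw [hf]; ring
  have hpt : ∀ u ∈ Ioc (0 : ℝ) 1, 1 / ((1 - u) * u) * wt ν k ((1 - u) ^ b * x)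
        * wt ν k (u ^ b * x) ≤ 16 * x * wt ν k x * (f u + f (1 - u)) := by
    intro u hu
    have hc : 0 ≤ 16 * x * wt ν k x := by positivity
    have g1 := mul_nonneg hc (hf0 u hu.1.le)
    have g2 := mul_nonneg hc (hf0 (1 - u) (by linarith [hu.2]))
    rcases le_total u (1 / 2) with h | h
    · have := half u (1 - u) hu.1 h rfl
      linarith
    · rcases hu.2.eq_or_lt with rfl | hu1
      · simp only [sub_self, zero_mul, div_zero] at g1 g2 ⊢
        linarith
      · have := half (1 - u) u (by linarith) (by linarith) (by ring)
        calc _ = 1 / (u * (1 - u)) * wt ν k (u ^ b * x) * wt ν k ((1 - u) ^ b * x) := by ring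
          _ ≤ _ := by linarith
  have hxX : x * (1 + X) ^ (-b) ≤ 1 := by
    rw [Real.rpow_neg (by positivity), ← div_eq_mul_inv, div_le_one (by positivity)]
    calc x = X ^ b := by
          rw [hX, hbdef, one_div, Real.pow_rpow_inv_natCast hx (by omega)]
      _ ≤ (1 + X) ^ b := Real.rpow_le_rpow hX0 (by linarith) hb.le
  calc _ ≤ ∫ u in Ioc (0 : ℝ) 1, 16 * x * wt ν k x * (f u + f (1 - u)) :=
        setIntegral_mono_on hint ((hi1.add hi2).const_mul _) measurableSet_Ioc hpt
    _ = 16 * x * wt ν k x * (1 / b * (1 + X) ^ (-b) + 1 / b * (1 + X) ^ (-b)) := by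
        rw [integral_const_mul, integral_add hi1 hi2, he2, he1]
    _ = 32 * k * wt ν k x * (x * (1 + X) ^ (-b)) := by rw [hbdef, one_div_one_div]; ring
    _ ≤ 32 * k * wt ν k x * 1 := by gcongr
    _ = _ := by ring

/-! ### Convolution in the Fourier variable and polynomial bounds -/

/-- The decay `(1+|m|)^{-s} exp(-β|m|)`. -/
def Ew (β s m : ℝ) : ℝ := (1 + |m|) ^ (-s) * Real.exp (-(β * |m|))

theorem Ew_pos (β s m : ℝ) : 0 < Ew β s m := by unfold Ew; positivity

theorem Ew_nonneg (β s m : ℝ) : 0 ≤ Ew β s m := (Ew_pos β s m).le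

theorem continuous_Ew (β s : ℝ) : Continuous (Ew β s) := by
  unfold Ew
  refine Continuous.mul (Continuous.rpow_const (by fun_prop) fun m => .inl ?_) (by fun_prop)
  positivity

theorem Ew_anti (β : ℝ) {s s' : ℝ} (h : s ≤ s') (m : ℝ) : Ew β s' m ≤ Ew β s m := by
  unfold Ew
  gcongr
  linarith [abs_nonneg m]

theorem Ew_le_one {β s : ℝ} (hβ : 0 ≤ β) (hs : 0 ≤ s) (m : ℝ) : Ew β s m ≤ 1 := by
  unfold Ew
  refine mul_le_one₀ ?_ (Real.exp_pos _).le ?_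
  · exact Real.rpow_le_one_of_one_le_of_nonpos (by linarith [abs_nonneg m]) (by linarith)
  · rw [Real.exp_le_one_iff]
    have := mul_nonneg hβ (abs_nonneg m)
    linarith

theorem integrable_one_add_abs {s : ℝ} (hs : 1 < s) :
    Integrable (fun m : ℝ => (1 + |m|) ^ (-s)) := by
  have := integrable_one_add_norm (E := ℝ) (μ := volume) (r := s) (by simpa using hs)
  simpa using this

theorem integrable_Ew {β s : ℝ} (hβ : 0 ≤ β) (hs : 1 < s) : Integrable (Ew β s) := by
  refine (integrable_one_add_abs hs).mono' (continuous_Ew β s).aestronglyMeasurable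
    (.of_forall fun m => ?_)
  rw [Real.norm_of_nonneg (Ew_nonneg _ _ _), Ew]
  refine mul_le_of_le_one_right (by positivity) ?_
  rw [Real.exp_le_one_iff]
  have := mul_nonneg hβ (abs_nonneg m)
  linarith

/-- The weight in `m` is stable under convolution, with a constant independent of `β`. -/
theorem exists_Ew_conv {s : ℝ} (hs : 1 < s) : ∃ C : ℝ, 0 < C ∧ ∀ β : ℝ, 0 ≤ β → ∀ m : ℝ,
    ∫ x : ℝ, Ew β s (m - x) * Ew β s x ≤ C * Ew β s m := by
  set I := ∫ x : ℝ, (1 + |x|) ^ (-s) with hI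
  have hI0 : 0 ≤ I := integral_nonneg fun x => by positivity
  have hint := integrable_one_add_abs hs
  refine ⟨2 ^ s * (2 * I) + 1, by positivity, fun β hβ m => ?_⟩
  have hint2 : Integrable (fun x : ℝ => (1 + |m - x|) ^ (-s)) := hint.comp_sub_left m
  have hI2 : ∫ x : ℝ, (1 + |m - x|) ^ (-s) = I :=
    integral_sub_left_eq_self (fun x : ℝ => (1 + |x|) ^ (-s)) volume m
  have hpt : ∀ x : ℝ, Ew β s (m - x) * Ew β s x
      ≤ 2 ^ s * Ew β s m * ((1 + |m - x|) ^ (-s) + (1 + |x|) ^ (-s)) := by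
    intro x
    have htri : |m| ≤ |m - x| + |x| := by
      have := abs_add_le (m - x) x
      simpa using this
    have he : Real.exp (-(β * |m - x|)) * Real.exp (-(β * |x|)) ≤ Real.exp (-(β * |m|)) := by
      rw [← Real.exp_add, Real.exp_le_exp]
      nlinarith
    have key : ∀ p q : ℝ, 0 ≤ p → p ≤ q → |m| ≤ p + q →
        (1 + q) ^ (-s) ≤ 2 ^ s * (1 + |m|) ^ (-s) := by
      intro p q hp hpq hm
      have h1 : (1 + |m|) / 2 ≤ 1 + q := by linarith
      have h2 := Real.rpow_le_rpow_of_nonpos (z := -s) (by positivity) h1 (by linarith)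
      rw [Real.div_rpow (by positivity) (by norm_num), Real.rpow_neg (by norm_num : (0:ℝ) ≤ 2),
        div_inv_eq_mul] at h2
      linarith
    have hA : 0 ≤ (1 + |m - x|) ^ (-s) := by positivity
    have hB : 0 ≤ (1 + |x|) ^ (-s) := by positivity
    have hM : 0 ≤ (2 : ℝ) ^ s * (1 + |m|) ^ (-s) := by positivity
    have hprod : (1 + |m - x|) ^ (-s) * (1 + |x|) ^ (-s)
        ≤ 2 ^ s * (1 + |m|) ^ (-s) * ((1 + |m - x|) ^ (-s) + (1 + |x|) ^ (-s)) := by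
      rcases le_total |m - x| |x| with h | h
      · nlinarith [key _ _ (abs_nonneg _) h htri]
      · nlinarith [key _ _ (abs_nonneg _) h (by linarith)]
    unfold Ew
    calc _ = (1 + |m - x|) ^ (-s) * (1 + |x|) ^ (-s)
          * (Real.exp (-(β * |m - x|)) * Real.exp (-(β * |x|))) := by ring
      _ ≤ 2 ^ s * (1 + |m|) ^ (-s) * ((1 + |m - x|) ^ (-s) + (1 + |x|) ^ (-s))
          * Real.exp (-(β * |m|)) := mul_le_mul hprod he (by positivity) (by positivity)
      _ = _ := by ring
  calc _ ≤ ∫ x : ℝ, 2 ^ s * Ew β s m * ((1 + |m - x|) ^ (-s) + (1 + |x|) ^ (-s)) := by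
        refine integral_mono_of_nonneg (.of_forall fun x => mul_nonneg (Ew_nonneg _ _ _)
          (Ew_nonneg _ _ _)) ((hint2.add hint).const_mul _) (.of_forall hpt)
    _ = 2 ^ s * (2 * I) * Ew β s m := by
        rw [integral_const_mul, integral_add hint2 hint, hI2]
        ring
    _ ≤ _ := by
        have := Ew_pos β s m
        nlinarith

theorem continuous_ev (p : ℂ[X]) : Continuous (ev p) := by
  unfold ev
  exact p.continuous.comp (by fun_prop)

/-- Polynomials whose coefficients are bounded by `B` have a common bound on the imaginary axis. -/
theorem norm_ev_le {p : ℂ[X]} {N : ℕ} {B : ℝ} (hN : p.natDegree ≤ N) (hB : ∀ i, ‖p.coeff i‖ ≤ B)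
    (m : ℝ) : ‖ev p m‖ ≤ (N + 1) * B * (1 + |m|) ^ N := by
  rw [ev, Polynomial.eval_eq_sum_range' (Nat.lt_succ_of_le hN)]
  calc _ ≤ ∑ i ∈ Finset.range (N + 1), ‖p.coeff i * (Complex.I * m) ^ i‖ := norm_sum_le _ _
    _ ≤ ∑ i ∈ Finset.range (N + 1), B * (1 + |m|) ^ N := by
        refine Finset.sum_le_sum fun i hi => ?_
        rw [norm_mul, norm_pow, norm_mul, Complex.norm_I, one_mul, Complex.norm_real,
          Real.norm_eq_abs]
        have h1 : |m| ^ i ≤ (1 + |m|) ^ N := by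
          calc |m| ^ i ≤ (1 + |m|) ^ i := by gcongr; linarith
            _ ≤ _ := pow_le_pow_right₀ (by linarith [abs_nonneg m])
              (by simpa [Nat.lt_succ_iff] using hi)
        exact mul_le_mul (hB i) h1 (by positivity) ((norm_nonneg _).trans (hB i))
    _ = _ := by simp; ring

theorem exists_norm_ev_le (p : ℂ[X]) :
    ∃ B : ℝ, 0 < B ∧ ∀ m, ‖ev p m‖ ≤ B * (1 + |m|) ^ p.natDegree := by
  set B := ∑ i ∈ Finset.range (p.natDegree + 1), ‖p.coeff i‖ with hB
  have hB0 : 0 ≤ B := Finset.sum_nonneg fun _ _ => norm_nonneg _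
  have hle : ∀ i, ‖p.coeff i‖ ≤ B := by
    intro i
    by_cases hi : i < p.natDegree + 1
    · exact Finset.single_le_sum (f := fun i => ‖p.coeff i‖) (fun _ _ => norm_nonneg _)
        (Finset.mem_range.2 hi)
    · rw [Polynomial.coeff_eq_zero_of_natDegree_lt (by omega), norm_zero]
      exact hB0
  refine ⟨(p.natDegree + 1) * (B + 1), by positivity, fun m => (norm_ev_le le_rfl hle m).trans ?_⟩
  gcongr
  linarith

/-- A polynomial without zeros on the imaginary axis has full growth there. -/
theorem exists_le_norm_ev {p : ℂ[X]} (hp : ∀ m, ev p m ≠ 0) :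
    ∃ C : ℝ, 0 < C ∧ ∀ m, (1 + |m|) ^ p.natDegree ≤ C * ‖ev p m‖ := by
  have hp0 : p ≠ 0 := by rintro rfl; exact hp 0 (by simp [ev])
  have lin : ∀ z : ℂ, (∀ m : ℝ, Complex.I * m - z ≠ 0) →
      ∃ C : ℝ, 0 < C ∧ ∀ m : ℝ, 1 + |m| ≤ C * ‖Complex.I * m - z‖ := by
    intro z hz
    have hre : 0 < |z.re| := by
      rw [abs_pos]
      intro h0
      refine hz z.im ?_
      apply Complex.ext <;> simp [h0]
    refine ⟨1 + (1 + |z.im|) / |z.re|, by positivity, fun m => ?_⟩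
    have h1 : |z.re| ≤ ‖Complex.I * m - z‖ := by
      have := Complex.abs_re_le_norm (Complex.I * m - z)
      simpa using this
    have h2 : |m - z.im| ≤ ‖Complex.I * m - z‖ := by
      have := Complex.abs_im_le_norm (Complex.I * m - z)
      simpa using this
    have h3 : |m| ≤ |m - z.im| + |z.im| := by
      have := abs_add_le (m - z.im) z.im
      simpa using this
    have h4 : 1 + |z.im| ≤ (1 + |z.im|) / |z.re| * ‖Complex.I * m - z‖ := by
      rw [div_mul_eq_mul_div, le_div_iff₀ hre]
      gcongr
    rw [add_mul]
    linarith
  have prod : ∀ s : Multiset ℂ, (∀ z ∈ s, ∀ m : ℝ, Complex.I * m - z ≠ 0) →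
      ∃ C : ℝ, 0 < C ∧ ∀ m : ℝ,
        (1 + |m|) ^ s.card ≤ C * ‖(s.map fun z => Complex.I * m - z).prod‖ := by
    intro s
    induction s using Multiset.induction_on with
    | empty => exact fun _ => ⟨1, one_pos, fun m => by simp⟩
    | cons z s ih =>
      intro hs
      obtain ⟨C, hC, h⟩ := ih fun w hw => hs w (by simp [hw])
      obtain ⟨C', hC', h'⟩ := lin z (hs z (by simp))
      refine ⟨C' * C, by positivity, fun m => ?_⟩
      rw [Multiset.card_cons, Multiset.map_cons, Multiset.prod_cons, norm_mul, pow_succ']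
      calc _ ≤ (C' * ‖Complex.I * m - z‖)
            * (C * ‖(s.map fun z => Complex.I * m - z).prod‖) := by
            gcongr
            · exact h' m
            · exact h m
        _ = _ := by ring
  have hsplit := IsAlgClosed.splits p
  have hev : ∀ m : ℝ, ev p m
      = p.leadingCoeff * (p.roots.map fun z => Complex.I * m - z).prod := by
    intro m
    rw [ev]
    conv_lhs => rw [hsplit.eq_prod_roots]
    rw [Polynomial.eval_mul, Polynomial.eval_C, Polynomial.eval_multiset_prod, Multiset.map_map]
    simp
  obtain ⟨C, hC, h⟩ := prod p.roots fun z hz m h0 => hp m (by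
    rw [hev, Multiset.prod_eq_zero (Multiset.mem_map.2 ⟨z, hz, h0⟩), mul_zero])
  have hl : 0 < ‖p.leadingCoeff‖ := by simpa using hp0
  refine ⟨C / ‖p.leadingCoeff‖, by positivity, fun m => ?_⟩
  have := h m
  rw [← hsplit.natDegree_eq_card_roots] at this
  rw [hev, norm_mul]
  calc _ ≤ _ := this
    _ = _ := by field_simp

/-! ### Entire Borel series -/

theorem rpow_mul_exp_le_Gamma {x Y : ℝ} (hx : 0 < x) (hY : 0 < Y) :
    Y ^ x * Real.exp (-Y) / x ≤ Real.Gamma x := by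
  rw [div_le_iff₀ hx, mul_comm (Real.Gamma x), ← Real.Gamma_add_one hx.ne',
    Real.Gamma_eq_integral (by linarith)]
  have hi := Real.GammaIntegral_convergent (s := x + 1) (by linarith)
  calc Y ^ x * Real.exp (-Y) = ∫ t in Ioi Y, Y ^ x * Real.exp (-t) := by
        rw [integral_const_mul, integral_exp_neg_Ioi]
    _ ≤ ∫ t in Ioi Y, Real.exp (-t) * t ^ (x + 1 - 1) := by
        refine setIntegral_mono_on ((integrableOn_exp_neg_Ioi Y).const_mul _)
          (hi.mono_set (Ioi_subset_Ioi hY.le)) measurableSet_Ioi fun t ht => ?_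
        rw [add_sub_cancel_right, mul_comm]
        have : Y ≤ t := le_of_lt ht
        gcongr
    _ ≤ _ := by
        refine setIntegral_mono_set hi ?_ (Ioi_subset_Ioi hY.le).eventuallyLE
        refine (ae_restrict_iff' measurableSet_Ioi).2 (.of_forall fun t ht => ?_)
        exact mul_nonneg (Real.exp_pos _).le (Real.rpow_nonneg (le_of_lt ht) _)

/-- The series `∑ z^n / Γ(n/k)` converges everywhere. -/
theorem summable_pow_div_Gamma {k : ℕ} (hk : 1 ≤ k) {z : ℝ} (hz : 0 ≤ z) :
    Summable (fun n : ℕ => z ^ (n + 1) / Real.Gamma (((n + 1 : ℕ) : ℝ) / k)) := by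
  have hk0 : (0 : ℝ) < k := by exact_mod_cast hk
  set y := 2 * (z + 1) with hy
  have hy0 : 0 < y := by positivity
  have hs : Summable fun n : ℕ => Real.exp (y ^ k) / k * (((n + 1 : ℕ) : ℝ) * (1 / 2) ^ (n + 1)) := by
    refine Summable.mul_left _ ?_
    have := summable_pow_mul_geometric_of_norm_lt_one 1 (r := (1 / 2 : ℝ)) (by norm_num)
    simp only [pow_one] at this
    exact (summable_nat_add_iff 1).2 this
  refine hs.of_nonneg_of_le (fun n => ?_) fun n => ?_
  · have : 0 < (((n + 1 : ℕ) : ℝ) / k) := by positivity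
    have := Real.Gamma_pos_of_pos this
    positivity
  · have hx : 0 < (((n + 1 : ℕ) : ℝ) / k) := by positivity
    have h1 := rpow_mul_exp_le_Gamma hx (Y := y ^ k) (by positivity)
    have h2 : (y ^ k) ^ (((n + 1 : ℕ) : ℝ) / k) = y ^ (n + 1) := by
      rw [← Real.rpow_natCast y k, ← Real.rpow_mul hy0.le, mul_div_cancel₀ _ hk0.ne',
        Real.rpow_natCast]
    rw [h2, Real.exp_neg] at h1
    have h3 : z ^ (n + 1) ≤ y ^ (n + 1) * (1 / 2) ^ (n + 1) := by
      rw [← mul_pow]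
      gcongr
      rw [hy]
      linarith
    have hpos : 0 < y ^ (n + 1) * (Real.exp (y ^ k))⁻¹ / (((n + 1 : ℕ) : ℝ) / k) := by positivity
    calc z ^ (n + 1) / Real.Gamma (((n + 1 : ℕ) : ℝ) / k)
        ≤ (y ^ (n + 1) * (1 / 2) ^ (n + 1))
          / (y ^ (n + 1) * (Real.exp (y ^ k))⁻¹ / (((n + 1 : ℕ) : ℝ) / k)) := by gcongr
      _ = _ := by field_simp

/-! ### Volterra operators as bounded linear operators -/

/-- The weight of the space with norm `‖·‖_{(ν,k,ε)}` in one Borel variable. -/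
def Wt (ν : ℝ) (k : ℕ) (ε τ : ℂ) : ℝ := wt ν k ‖τ / ε‖

theorem Wt_nonneg {ν : ℝ} {k : ℕ} {ε : ℂ} (τ : ℂ) : 0 ≤ Wt ν k ε τ := wt_nonneg (norm_nonneg _)

theorem continuous_Wt (ν : ℝ) (k : ℕ) (ε : ℂ) : Continuous (Wt ν k ε) :=
  (continuous_wt ν k).comp (by fun_prop)

theorem Wt_zero (ν : ℝ) (k : ℕ) (ε : ℂ) : Wt ν k ε 0 = 0 := by simp [Wt, wt]

theorem Wt_rt {ν : ℝ} {k : ℕ} {ε : ℂ} {t : ℝ} (ht : 0 ≤ t) (τ : ℂ) :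
    Wt ν k ε (rt k t * τ) = wt ν k (t ^ (1 / (k : ℝ)) * ‖τ / ε‖) := by
  rw [Wt, rt, mul_div_assoc, norm_mul, Complex.norm_real, Real.norm_of_nonneg (by positivity)]

theorem rpow_inv_mem_Icc (k : ℕ) {t : ℝ} (ht : t ∈ Icc (0 : ℝ) 1) :
    t ^ (1 / (k : ℝ)) ∈ Icc (0 : ℝ) 1 :=
  ⟨Real.rpow_nonneg ht.1 _, Real.rpow_le_one ht.1 ht.2 (by positivity)⟩

theorem continuous_rt (k : ℕ) : Continuous (rt k) :=
  Complex.continuous_ofReal.comp (Real.continuous_rpow_const (by positivity))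

theorem rt_one (k : ℕ) : rt k 1 = 1 := by simp [rt]

theorem exists_bound_of_continuous {b : ℂ → ℝ} (hb : Continuous b) (M : ℝ) :
    ∃ B : ℝ, 0 ≤ B ∧ ∀ τ, ‖τ‖ ≤ M → b τ ≤ B := by
  obtain ⟨B, hB⟩ := (isCompact_closedBall (0 : ℂ) M).exists_bound_of_continuousOn hb.continuousOn
  exact ⟨max B 0, le_max_right _ _, fun τ hτ =>
    ((le_abs_self _).trans (hB τ (by simpa using hτ))).trans (le_max_left _ _)⟩

/-- The operator `h ↦ g(τ₁,m) ∫_0^1 (1-t)^{a-1} t^{p-1} h(t^{1/k} τ₁, τ₂, m) dt`. -/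
def volT (g : ℂ → ℝ → ℂ) (k : ℕ) (a : ℝ) (p : ℕ) (h : ℂ → ℂ → ℝ → ℂ) : ℂ → ℂ → ℝ → ℂ :=
  fun τ₁ τ₂ m => g τ₁ m *
    ∫ t in Ioc (0 : ℝ) 1, (((1 - t) ^ (a - 1) * t ^ p / t : ℝ) : ℂ) * h (rt k t * τ₁) τ₂ m

theorem volT_kernel_nonneg (a : ℝ) (p : ℕ) {t : ℝ} (ht : t ∈ Ioc (0 : ℝ) 1) :
    0 ≤ (1 - t) ^ (a - 1) * t ^ p / t := by
  have h1 : 0 ≤ (1 - t) ^ (a - 1) := Real.rpow_nonneg (by linarith [ht.2]) _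
  have := ht.1.le
  positivity

section volT

variable {ν : ℝ} {k : ℕ} {ε : ℂ} {b₂ : ℂ → ℝ} {E : ℝ → ℝ} {N : ℝ} {h : ℂ → ℂ → ℝ → ℂ}

theorem Mem.volT_integrand_le (hh : Mem D₁ D₂ (Wt ν k ε) b₂ E N h) (a : ℝ) (p : ℕ)
    {τ₁ τ₂ : ℂ} (h₁ : τ₁ ∈ D₁.Ω) (h₂ : τ₂ ∈ D₂.Ω) (m : ℝ) {t : ℝ} (ht : t ∈ Ioc (0 : ℝ) 1) :
    ‖(((1 - t) ^ (a - 1) * t ^ p / t : ℝ) : ℂ) * h (rt k t * τ₁) τ₂ m‖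
      ≤ (1 - t) ^ (a - 1) * t ^ p / t * wt ν k (t ^ (1 / (k : ℝ)) * ‖τ₁ / ε‖)
        * (N * (b₂ τ₂ * E m)) := by
  have h0 := volT_kernel_nonneg a p ht
  rw [norm_mul, Complex.norm_real, Real.norm_of_nonneg h0]
  have := hh.bd (rt k t * τ₁) (D₁.smul_mem _ (rpow_inv_mem_Icc k ⟨ht.1.le, ht.2⟩) _ h₁) τ₂ h₂ m
  rw [Wt_rt ht.1.le] at this
  calc _ ≤ (1 - t) ^ (a - 1) * t ^ p / t
        * (N * (wt ν k (t ^ (1 / (k : ℝ)) * ‖τ₁ / ε‖) * b₂ τ₂ * E m)) := by gcongr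
    _ = _ := by ring

theorem Reg.aestronglyMeasurable_volT (hh : Reg D₁ D₂ h) (a : ℝ) (p : ℕ)
    {τ₁ τ₂ : ℂ} (h₁ : τ₁ ∈ D₁.Ω) (h₂ : τ₂ ∈ D₂.Ω) (m : ℝ) :
    AEStronglyMeasurable
      (fun t : ℝ => (((1 - t) ^ (a - 1) * t ^ p / t : ℝ) : ℂ) * h (rt k t * τ₁) τ₂ m)
      (volume.restrict (Ioc 0 1)) := by
  refine AEStronglyMeasurable.mul
    (Complex.measurable_ofReal.comp (by fun_prop)).aestronglyMeasurable ?_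
  refine ContinuousOn.aestronglyMeasurable ?_ measurableSet_Ioc
  have hc := continuous_rt k
  exact hh.cont.comp (f := fun t : ℝ => ((rt k t * τ₁, τ₂), m)) (by fun_prop)
    (fun t ht => ⟨⟨D₁.smul_mem _ (rpow_inv_mem_Icc k ⟨ht.1.le, ht.2⟩) _ h₁, h₂⟩, trivial⟩)

/-- If `C` is the constant of `exists_kernel_bound`, the operator `volT` is bounded as soon as the
multiplier `g` is compensated by the gain `(1 + |τ/ε|^k)^{-a}`. -/
theorem linOp_volT (hν : 0 < ν) (hk : 1 ≤ k) {a C M : ℝ} (ha : 0 < a) (hC0 : 0 < C)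
    (hC : ∀ (p : ℕ) (x : ℝ), 0 ≤ x →
      IntegrableOn (fun t => (1 - t) ^ (a - 1) * t ^ p / t * wt ν k (t ^ (1 / (k : ℝ)) * x))
        (Ioc 0 1) ∧
      ∫ t in Ioc (0 : ℝ) 1, (1 - t) ^ (a - 1) * t ^ p / t * wt ν k (t ^ (1 / (k : ℝ)) * x)
        ≤ C * (1 + x ^ k) ^ (-a) * wt ν k x)
    (p : ℕ) {g : ℂ → ℝ → ℂ}
    (hgc : ContinuousOn (fun q : ℂ × ℝ => g q.1 q.2) (D₁.Ω ×ˢ univ))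
    (hgd : ∀ m, DifferentiableOn ℂ (fun τ => g τ m) D₁.U) (hM : 0 ≤ M)
    (hg : ∀ τ ∈ D₁.Ω, ∀ m, ‖g τ m‖ * (1 + ‖τ / ε‖ ^ k) ^ (-a) ≤ M)
    (hb₂ : ∀ τ, 0 ≤ b₂ τ) (hb₂c : Continuous b₂) (hE0 : ∀ m, 0 ≤ E m) (hE1 : ∀ m, E m ≤ 1) :
    LinOp D₁ D₂ (Wt ν k ε) b₂ E E (C * M) (volT g k a p) where
  nonneg := by positivity
  mem {h N} hh := by
    have hN := hh.nonneg
    refine ⟨(Reg.of_fst hgc hgd).mul ?_, mul_nonneg (by positivity) hN, fun τ₁ h₁ τ₂ h₂ m => ?_⟩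
    · refine Reg.integral ?_ (fun τ₁ h₁ τ₂ h₂ m => hh.aestronglyMeasurable_volT a p h₁ h₂ m) ?_
      · refine (ae_restrict_iff' measurableSet_Ioc).2 (.of_forall fun t ht => ?_)
        have h1 := hh.toReg.comp_smul (rpow_inv_mem_Icc k ⟨ht.1.le, ht.2⟩)
          (⟨zero_le_one, le_rfl⟩ : (1 : ℝ) ∈ Icc (0 : ℝ) 1) continuous_id
        simp only [Complex.ofReal_one, one_mul] at h1
        exact (Reg.of_continuous continuous_const).mul h1
      · intro R
        obtain ⟨B, hB0, hB⟩ := exists_bound_of_continuous hb₂c R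
        have hk0 : (0 : ℝ) < k := by exact_mod_cast hk
        refine ⟨_, (integrableOn_beta (b := 1 / (k : ℝ)) ha (by positivity)).mul_const
          ((R / ‖ε‖ * Real.exp (ν * (R / ‖ε‖) ^ k)) * (N * B)), ?_⟩
        refine (ae_restrict_iff' measurableSet_Ioc).2 (.of_forall fun t ht τ₁ h₁ τ₂ h₂ m r₁ r₂ _ => ?_)
        refine (hh.volT_integrand_le a p h₁ h₂ m ht).trans ?_
        have hx : ‖τ₁ / ε‖ ≤ R / ‖ε‖ := by rw [norm_div]; gcongr
        have h3 := kernel_wt_le hν a p (k := k) (norm_nonneg (τ₁ / ε)) hx ht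
        have h4 : b₂ τ₂ * E m ≤ B := by
          calc _ ≤ B * 1 := mul_le_mul (hB _ r₂) (hE1 m) (hE0 m) hB0
            _ = B := mul_one _
        have h5 := mul_nonneg (hb₂ τ₂) (hE0 m)
        have h6 := mul_nonneg (volT_kernel_nonneg a p ht) (wt_nonneg (ν := ν) (k := k)
          (mul_nonneg (rpow_inv_mem_Icc k ⟨ht.1.le, ht.2⟩).1 (norm_nonneg (τ₁ / ε))))
        rw [← mul_assoc ((1 - t) ^ (a - 1) * t ^ (1 / (k : ℝ) - 1))]
        exact mul_le_mul h3 (by gcongr) (by positivity) (h6.trans h3)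
    · have hx := norm_nonneg (τ₁ / ε)
      obtain ⟨hi, hle⟩ := hC p _ hx
      have h1 := norm_integral_le_of_norm_le (hi.mul_const (N * (b₂ τ₂ * E m)))
        ((ae_restrict_iff' measurableSet_Ioc).2 (.of_forall fun t ht =>
          hh.volT_integrand_le a p h₁ h₂ m ht))
      rw [integral_mul_const] at h1
      have h5 := mul_nonneg hN (mul_nonneg (hb₂ τ₂) (hE0 m))
      have hw := Wt_nonneg (ν := ν) (k := k) (ε := ε) τ₁
      rw [volT, norm_mul]
      calc _ ≤ ‖g τ₁ m‖ * ((C * (1 + ‖τ₁ / ε‖ ^ k) ^ (-a) * Wt ν k ε τ₁) * (N * (b₂ τ₂ * E m))) := by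
            gcongr
            exact h1.trans (mul_le_mul_of_nonneg_right hle h5)
        _ = (‖g τ₁ m‖ * (1 + ‖τ₁ / ε‖ ^ k) ^ (-a)) * (C * Wt ν k ε τ₁ * (N * (b₂ τ₂ * E m))) := by
            ring
        _ ≤ M * (C * Wt ν k ε τ₁ * (N * (b₂ τ₂ * E m))) := by
            gcongr
            exact hg _ h₁ m
        _ = _ := by ring
  sub {h h' N N'} hh hh' τ₁ h₁ τ₂ h₂ m := by
    have hint : ∀ {h N}, Mem D₁ D₂ (Wt ν k ε) b₂ E N h → IntegrableOn
        (fun t : ℝ => (((1 - t) ^ (a - 1) * t ^ p / t : ℝ) : ℂ) * h (rt k t * τ₁) τ₂ m)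
        (Ioc 0 1) := by
      intro h N hh
      refine Integrable.mono' ((hC p _ (norm_nonneg (τ₁ / ε))).1.mul_const (N * (b₂ τ₂ * E m)))
        (hh.aestronglyMeasurable_volT a p h₁ h₂ m) ?_
      exact (ae_restrict_iff' measurableSet_Ioc).2 (.of_forall fun t ht =>
          hh.volT_integrand_le a p h₁ h₂ m ht)
    simp only [volT]
    rw [← mul_sub, ← integral_sub (hint hh) (hint hh')]
    simp only [Pi.sub_apply, mul_sub]

end volT

/-! ### The bilinear convolution operator -/

/-- A convolution in one Borel variable: a measure `μ` on `[0,1]` and a kernel `κ` such that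
`∫ κ(u) b((1-u)^{1/k} τ) c(u^{1/k} τ) dμ(u) ≤ C c(τ)`. Taking for `μ` the Dirac mass at `1` gives
the multiplication by a function which does not depend on the Borel variable. -/
structure ConvKernel (k : ℕ) (b c : ℂ → ℝ) (μ : Measure ℝ) (κ : ℝ → ℝ) (C : ℝ) : Prop where
  mem : ∀ᵐ u ∂μ, u ∈ Icc (0 : ℝ) 1
  measurable : Measurable κ
  nonneg : ∀ᵐ u ∂μ, 0 ≤ κ u
  const_nonneg : 0 ≤ C
  integrable : ∀ τ, Integrable (fun u => κ u * b (rt k (1 - u) * τ) * c (rt k u * τ)) μ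
  le : ∀ τ, ∫ u, κ u * b (rt k (1 - u) * τ) * c (rt k u * τ) ∂μ ≤ C * c τ
  dom : ∀ M : ℝ, ∃ bound : ℝ → ℝ, Integrable bound μ ∧ ∀ᵐ u ∂μ, ∀ τ, ‖τ‖ ≤ M →
    κ u * b (rt k (1 - u) * τ) * c (rt k u * τ) ≤ bound u

/-- The convolution of the Borel plane, with respect to the weight of the exponential space. -/
theorem convKernel_Wt {ν : ℝ} (hν : 0 < ν) {k : ℕ} (hk : 1 ≤ k) (ε : ℂ) {C : ℝ} (hC0 : 0 < C)
    (hC : ∀ x : ℝ, 0 ≤ x →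
      IntegrableOn (fun u => 1 / ((1 - u) * u) * wt ν k ((1 - u) ^ (1 / (k : ℝ)) * x)
        * wt ν k (u ^ (1 / (k : ℝ)) * x)) (Ioc 0 1) ∧
      ∫ u in Ioc (0 : ℝ) 1, 1 / ((1 - u) * u) * wt ν k ((1 - u) ^ (1 / (k : ℝ)) * x)
        * wt ν k (u ^ (1 / (k : ℝ)) * x) ≤ C * wt ν k x) :
    ConvKernel k (Wt ν k ε) (Wt ν k ε) (volume.restrict (Ioc 0 1))
      (fun u => 1 / ((1 - u) * u)) C := by
  have heq : ∀ τ, ∀ u ∈ Ioc (0 : ℝ) 1,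
      1 / ((1 - u) * u) * wt ν k ((1 - u) ^ (1 / (k : ℝ)) * ‖τ / ε‖)
        * wt ν k (u ^ (1 / (k : ℝ)) * ‖τ / ε‖)
      = 1 / ((1 - u) * u) * Wt ν k ε (rt k (1 - u) * τ) * Wt ν k ε (rt k u * τ) :=
    fun τ u hu => by rw [Wt_rt hu.1.le, Wt_rt (by linarith [hu.2])]
  have hk0 : (0 : ℝ) < k := by exact_mod_cast hk
  constructor
  · exact (ae_restrict_iff' measurableSet_Ioc).2 (.of_forall fun u hu => ⟨hu.1.le, hu.2⟩)
  · fun_prop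
  · refine (ae_restrict_iff' measurableSet_Ioc).2 (.of_forall fun u hu => ?_)
    have h1 := hu.1.le
    have h2 : 0 ≤ 1 - u := by linarith [hu.2]
    positivity
  · exact hC0.le
  · intro τ
    exact (integrableOn_congr_fun (heq τ) measurableSet_Ioc).1 (hC _ (norm_nonneg _)).1
  · intro τ
    rw [← setIntegral_congr_fun measurableSet_Ioc (heq τ)]
    exact (hC _ (norm_nonneg _)).2
  · intro M
    refine ⟨_, (integrableOn_beta (a := 1 / (k : ℝ)) (b := 1 / (k : ℝ)) (by positivity)
      (by positivity)).mul_const ((M / ‖ε‖ * Real.exp (ν * (M / ‖ε‖) ^ k)) ^ 2), ?_⟩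
    refine (ae_restrict_iff' measurableSet_Ioc).2 (.of_forall fun u hu τ hτ => ?_)
    rw [← heq τ u hu]
    exact conv_kernel_le hν (norm_nonneg _) (by rw [norm_div]; gcongr) hu

/-- No convolution in the Borel variable. -/
theorem convKernel_dirac (k : ℕ) {c : ℂ → ℝ} (hc : Continuous c) :
    ConvKernel k (fun _ => 1) c (Measure.dirac 1) (fun _ => 1) 1 := by
  constructor
  · simp [ae_dirac_eq]
  · fun_prop
  · simp
  · simp
  · intro τ
    exact integrable_dirac (by simp)
  · intro τ
    simp [rt_one]
  · intro M
    obtain ⟨B, hB0, hB⟩ := exists_bound_of_continuous hc M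
    refine ⟨fun _ => B, integrable_dirac (by simp), ?_⟩
    simp only [ae_dirac_eq, eventually_pure]
    intro τ hτ
    simpa [rt_one] using hB τ hτ

/-- Convolution in the two Borel variables and in the Fourier variable, as one integral over
`(u₁,u₂,m₁)`. -/
def bil (k₁ k₂ : ℕ) (μ₁ μ₂ : Measure ℝ) (κ₁ κ₂ : ℝ → ℝ) (f g : ℂ → ℂ → ℝ → ℂ) :
    ℂ → ℂ → ℝ → ℂ := fun σ₁ σ₂ m =>
  ∫ x : ℝ × ℝ × ℝ, ((κ₁ x.1 * κ₂ x.2.1 : ℝ) : ℂ)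
    * (f (rt k₁ (1 - x.1) * σ₁) (rt k₂ (1 - x.2.1) * σ₂) (m - x.2.2)
      * g (rt k₁ x.1 * σ₁) (rt k₂ x.2.1 * σ₂) x.2.2) ∂(μ₁.prod (μ₂.prod volume))

theorem ae_prod_mem {k₁ k₂ : ℕ} {b₁ b₂ c₁ c₂ : ℂ → ℝ} {μ₁ μ₂ : Measure ℝ} {κ₁ κ₂ : ℝ → ℝ}
    {C₁ C₂ : ℝ} (H₁ : ConvKernel k₁ b₁ c₁ μ₁ κ₁ C₁)
    (H₂ : ConvKernel k₂ b₂ c₂ μ₂ κ₂ C₂) :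
    ∀ᵐ x : ℝ × ℝ × ℝ ∂(μ₁.prod (μ₂.prod volume)),
      (x.1 ∈ Icc (0 : ℝ) 1 ∧ 0 ≤ κ₁ x.1) ∧ x.2.1 ∈ Icc (0 : ℝ) 1 ∧ 0 ≤ κ₂ x.2.1 := by
  have h1 := Measure.quasiMeasurePreserving_fst (μ := μ₁) (ν := μ₂.prod (volume : Measure ℝ))
  have h2 := (Measure.quasiMeasurePreserving_fst (μ := μ₂) (ν := (volume : Measure ℝ))).comp
    (Measure.quasiMeasurePreserving_snd (μ := μ₁) (ν := μ₂.prod (volume : Measure ℝ)))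
  exact (h1.ae (H₁.mem.and H₁.nonneg)).and (h2.ae (H₂.mem.and H₂.nonneg))

section bil

variable {k₁ k₂ : ℕ} {b₁ b₂ c₁ c₂ : ℂ → ℝ} {μ₁ μ₂ : Measure ℝ}
  {κ₁ κ₂ : ℝ → ℝ} {C₁ C₂ C₃ : ℝ} {E : ℝ → ℝ} {N N' : ℝ} {f g : ℂ → ℂ → ℝ → ℂ}

theorem one_sub_mem_Icc {u : ℝ} (hu : u ∈ Icc (0 : ℝ) 1) : 1 - u ∈ Icc (0 : ℝ) 1 :=
  ⟨by linarith [hu.2], by linarith [hu.1]⟩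

theorem Mem.bil_integrand_le (hf : Mem D₁ D₂ b₁ b₂ E N f) (hg : Mem D₁ D₂ c₁ c₂ E N' g)
    {x : ℝ × ℝ × ℝ} (hx : (x.1 ∈ Icc (0 : ℝ) 1 ∧ 0 ≤ κ₁ x.1) ∧ x.2.1 ∈ Icc (0 : ℝ) 1 ∧ 0 ≤ κ₂ x.2.1)
    {σ₁ σ₂ : ℂ} (h₁ : σ₁ ∈ D₁.Ω) (h₂ : σ₂ ∈ D₂.Ω) (m : ℝ) :
    ‖((κ₁ x.1 * κ₂ x.2.1 : ℝ) : ℂ)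
      * (f (rt k₁ (1 - x.1) * σ₁) (rt k₂ (1 - x.2.1) * σ₂) (m - x.2.2)
        * g (rt k₁ x.1 * σ₁) (rt k₂ x.2.1 * σ₂) x.2.2)‖
    ≤ (κ₁ x.1 * b₁ (rt k₁ (1 - x.1) * σ₁) * c₁ (rt k₁ x.1 * σ₁))
      * ((κ₂ x.2.1 * b₂ (rt k₂ (1 - x.2.1) * σ₂) * c₂ (rt k₂ x.2.1 * σ₂))
        * (E (m - x.2.2) * E x.2.2)) * (N * N') := by
  obtain ⟨⟨hx1, hk1⟩, hx2, hk2⟩ := hx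
  have e1 := hf.bd _ (D₁.smul_mem _ (rpow_inv_mem_Icc k₁ (one_sub_mem_Icc hx1)) _ h₁)
    _ (D₂.smul_mem _ (rpow_inv_mem_Icc k₂ (one_sub_mem_Icc hx2)) _ h₂) (m - x.2.2)
  have e2 := hg.bd _ (D₁.smul_mem _ (rpow_inv_mem_Icc k₁ hx1) _ h₁)
    _ (D₂.smul_mem _ (rpow_inv_mem_Icc k₂ hx2) _ h₂) x.2.2
  rw [norm_mul, norm_mul, Complex.norm_real, Real.norm_of_nonneg (mul_nonneg hk1 hk2)]
  refine (mul_le_mul_of_nonneg_left (mul_le_mul e1 e2 (norm_nonneg _)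
    ((norm_nonneg _).trans e1)) (mul_nonneg hk1 hk2)).trans (le_of_eq ?_)
  simp only [rt]
  ring

theorem Mem.aestronglyMeasurable_bil (H₁ : ConvKernel k₁ b₁ c₁ μ₁ κ₁ C₁)
    (H₂ : ConvKernel k₂ b₂ c₂ μ₂ κ₂ C₂) (hf : Reg D₁ D₂ f) (hg : Reg D₁ D₂ g)
    {σ₁ σ₂ : ℂ} (h₁ : σ₁ ∈ D₁.Ω) (h₂ : σ₂ ∈ D₂.Ω) (m : ℝ) :
    AEStronglyMeasurable (fun x : ℝ × ℝ × ℝ => ((κ₁ x.1 * κ₂ x.2.1 : ℝ) : ℂ)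
      * (f (rt k₁ (1 - x.1) * σ₁) (rt k₂ (1 - x.2.1) * σ₂) (m - x.2.2)
        * g (rt k₁ x.1 * σ₁) (rt k₂ x.2.1 * σ₂) x.2.2)) (μ₁.prod (μ₂.prod volume)) := by
  have hκ₁ := H₁.measurable
  have hκ₂ := H₂.measurable
  refine AEStronglyMeasurable.mul (by fun_prop) ?_
  have hS : ∀ᵐ x : ℝ × ℝ × ℝ ∂(μ₁.prod (μ₂.prod volume)),
      x ∈ Icc (0 : ℝ) 1 ×ˢ Icc (0 : ℝ) 1 ×ˢ (univ : Set ℝ) := by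
    filter_upwards [ae_prod_mem H₁ H₂] with x hx using ⟨hx.1.1, hx.2.1, trivial⟩
  rw [← Measure.restrict_eq_self_of_ae_mem hS]
  refine ContinuousOn.aestronglyMeasurable ?_
    (measurableSet_Icc.prod (measurableSet_Icc.prod MeasurableSet.univ))
  have c1 := continuous_rt k₁
  have c2 := continuous_rt k₂
  refine ContinuousOn.mul ?_ ?_
  · exact hf.cont.comp (f := fun x : ℝ × ℝ × ℝ =>
      ((rt k₁ (1 - x.1) * σ₁, rt k₂ (1 - x.2.1) * σ₂), m - x.2.2)) (by fun_prop)
      (fun x hx => ⟨⟨D₁.smul_mem _ (rpow_inv_mem_Icc k₁ (one_sub_mem_Icc hx.1)) _ h₁,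
        D₂.smul_mem _ (rpow_inv_mem_Icc k₂ (one_sub_mem_Icc hx.2.1)) _ h₂⟩, trivial⟩)
  · exact hg.cont.comp (f := fun x : ℝ × ℝ × ℝ =>
      ((rt k₁ x.1 * σ₁, rt k₂ x.2.1 * σ₂), x.2.2)) (by fun_prop)
      (fun x hx => ⟨⟨D₁.smul_mem _ (rpow_inv_mem_Icc k₁ hx.1) _ h₁,
        D₂.smul_mem _ (rpow_inv_mem_Icc k₂ hx.2.1) _ h₂⟩, trivial⟩)

theorem integrable_E_conv (hE0 : ∀ m, 0 ≤ E m) (hE1 : ∀ m, E m ≤ 1) (hEc : Continuous E)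
    (hEi : Integrable E) (m : ℝ) : Integrable (fun x => E (m - x) * E x) := by
  refine hEi.mono' (by fun_prop) (.of_forall fun x => ?_)
  rw [Real.norm_of_nonneg (mul_nonneg (hE0 _) (hE0 _))]
  exact mul_le_of_le_one_left (hE0 _) (hE1 _)

theorem Mem.integrable_bil (H₁ : ConvKernel k₁ b₁ c₁ μ₁ κ₁ C₁)
    (H₂ : ConvKernel k₂ b₂ c₂ μ₂ κ₂ C₂) (hE0 : ∀ m, 0 ≤ E m) (hE1 : ∀ m, E m ≤ 1)
    (hEc : Continuous E) (hEi : Integrable E)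
    (hf : Mem D₁ D₂ b₁ b₂ E N f) (hg : Mem D₁ D₂ c₁ c₂ E N' g)
    {σ₁ σ₂ : ℂ} (h₁ : σ₁ ∈ D₁.Ω) (h₂ : σ₂ ∈ D₂.Ω) (m : ℝ) :
    Integrable (fun x : ℝ × ℝ × ℝ => ((κ₁ x.1 * κ₂ x.2.1 : ℝ) : ℂ)
      * (f (rt k₁ (1 - x.1) * σ₁) (rt k₂ (1 - x.2.1) * σ₂) (m - x.2.2)
        * g (rt k₁ x.1 * σ₁) (rt k₂ x.2.1 * σ₂) x.2.2)) (μ₁.prod (μ₂.prod volume)) := by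
  refine Integrable.mono' (((H₁.integrable σ₁).mul_prod ((H₂.integrable σ₂).mul_prod
    (integrable_E_conv hE0 hE1 hEc hEi m))).mul_const (N * N'))
    (Mem.aestronglyMeasurable_bil H₁ H₂ hf.toReg hg.toReg h₁ h₂ m) ?_
  filter_upwards [ae_prod_mem H₁ H₂] with x hx using hf.bil_integrand_le hg hx h₁ h₂ m

variable [SFinite μ₁] [SFinite μ₂]

theorem mem_bil (H₁ : ConvKernel k₁ b₁ c₁ μ₁ κ₁ C₁)
    (H₂ : ConvKernel k₂ b₂ c₂ μ₂ κ₂ C₂) (hb₁ : ∀ τ, 0 ≤ b₁ τ) (hb₂ : ∀ τ, 0 ≤ b₂ τ)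
    (hc₁ : ∀ τ, 0 ≤ c₁ τ) (hc₂ : ∀ τ, 0 ≤ c₂ τ) (hE0 : ∀ m, 0 ≤ E m) (hE1 : ∀ m, E m ≤ 1)
    (hEc : Continuous E) (hEi : Integrable E) (hC₃ : 0 ≤ C₃)
    (hE : ∀ m, ∫ x, E (m - x) * E x ≤ C₃ * E m)
    (hf : Mem D₁ D₂ b₁ b₂ E N f) (hg : Mem D₁ D₂ c₁ c₂ E N' g) :
    Mem D₁ D₂ c₁ c₂ E (C₁ * C₂ * C₃ * (N * N')) (bil k₁ k₂ μ₁ μ₂ κ₁ κ₂ f g) where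
  nonneg := mul_nonneg (mul_nonneg (mul_nonneg H₁.const_nonneg H₂.const_nonneg) hC₃)
    (mul_nonneg hf.nonneg hg.nonneg)
  toReg := by
    refine Reg.integral ?_ (fun σ₁ h₁ σ₂ h₂ m =>
      Mem.aestronglyMeasurable_bil H₁ H₂ hf.toReg hg.toReg h₁ h₂ m) ?_
    · filter_upwards [ae_prod_mem H₁ H₂] with x hx
      refine (Reg.of_continuous continuous_const).mul (Reg.mul ?_ ?_)
      · exact hf.toReg.comp_smul (rpow_inv_mem_Icc k₁ (one_sub_mem_Icc hx.1.1))
          (rpow_inv_mem_Icc k₂ (one_sub_mem_Icc hx.2.1)) (u := fun m => m - x.2.2) (by fun_prop)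
      · exact hg.toReg.comp_smul (rpow_inv_mem_Icc k₁ hx.1.1)
          (rpow_inv_mem_Icc k₂ hx.2.1) (u := fun _ => x.2.2) (by fun_prop)
    · intro M
      obtain ⟨B₁, hB₁, hd₁⟩ := H₁.dom M
      obtain ⟨B₂, hB₂, hd₂⟩ := H₂.dom M
      refine ⟨_, (hB₁.mul_prod (hB₂.mul_prod hEi)).mul_const (N * N'), ?_⟩
      have q1 := Measure.quasiMeasurePreserving_fst (μ := μ₁) (ν := μ₂.prod (volume : Measure ℝ))
      have q2 := (Measure.quasiMeasurePreserving_fst (μ := μ₂) (ν := (volume : Measure ℝ))).comp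
        (Measure.quasiMeasurePreserving_snd (μ := μ₁) (ν := μ₂.prod (volume : Measure ℝ)))
      filter_upwards [ae_prod_mem H₁ H₂, q1.ae hd₁, q2.ae hd₂] with x hx e1 e2 σ₁ h₁ σ₂ h₂ m r₁ r₂ _
      refine (hf.bil_integrand_le hg hx h₁ h₂ m).trans ?_
      have f1 := e1 σ₁ r₁
      have f2 := e2 σ₂ r₂
      have f3 : E (m - x.2.2) * E x.2.2 ≤ E x.2.2 := mul_le_of_le_one_left (hE0 _) (hE1 _)
      have n1 := mul_nonneg (mul_nonneg hx.1.2 (hb₁ (rt k₁ (1 - x.1) * σ₁))) (hc₁ (rt k₁ x.1 * σ₁))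
      have n2 := mul_nonneg (mul_nonneg hx.2.2 (hb₂ (rt k₂ (1 - x.2.1) * σ₂)))
        (hc₂ (rt k₂ x.2.1 * σ₂))
      have n3 := mul_nonneg (hE0 (m - x.2.2)) (hE0 x.2.2)
      exact mul_le_mul_of_nonneg_right (mul_le_mul f1 (mul_le_mul f2 f3 n3 (n2.trans f2))
        (mul_nonneg n2 n3) (n1.trans f1)) (mul_nonneg hf.nonneg hg.nonneg)
  bd σ₁ h₁ σ₂ h₂ m := by
    have h3 := norm_integral_le_of_norm_le
      (((H₁.integrable σ₁).mul_prod ((H₂.integrable σ₂).mul_prod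
        (integrable_E_conv hE0 hE1 hEc hEi m))).mul_const (N * N'))
      ((ae_prod_mem H₁ H₂).mono fun x hx => hf.bil_integrand_le hg hx h₁ h₂ m)
    rw [integral_mul_const, integral_prod_mul
      (fun u => κ₁ u * b₁ (rt k₁ (1 - u) * σ₁) * c₁ (rt k₁ u * σ₁))
      (fun y : ℝ × ℝ => (κ₂ y.1 * b₂ (rt k₂ (1 - y.1) * σ₂) * c₂ (rt k₂ y.1 * σ₂))
        * (E (m - y.2) * E y.2)), integral_prod_mul
      (fun u => κ₂ u * b₂ (rt k₂ (1 - u) * σ₂) * c₂ (rt k₂ u * σ₂))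
      (fun x => E (m - x) * E x)] at h3
    refine h3.trans ?_
    have i2 : 0 ≤ ∫ u, κ₂ u * b₂ (rt k₂ (1 - u) * σ₂) * c₂ (rt k₂ u * σ₂) ∂μ₂ :=
      integral_nonneg_of_ae (H₂.nonneg.mono fun u hu =>
        mul_nonneg (mul_nonneg hu (hb₂ _)) (hc₂ _))
    have i3 : 0 ≤ ∫ x, E (m - x) * E x := integral_nonneg fun x => mul_nonneg (hE0 _) (hE0 _)
    calc _ ≤ (C₁ * c₁ σ₁) * ((C₂ * c₂ σ₂) * (C₃ * E m)) * (N * N') :=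
          mul_le_mul_of_nonneg_right (mul_le_mul (H₁.le σ₁) (mul_le_mul (H₂.le σ₂) (hE m) i3
            (mul_nonneg H₂.const_nonneg (hc₂ _))) (mul_nonneg i2 i3)
            (mul_nonneg H₁.const_nonneg (hc₁ _))) (mul_nonneg hf.nonneg hg.nonneg)
      _ = _ := by ring

theorem linOp_bil_right (H₁ : ConvKernel k₁ b₁ c₁ μ₁ κ₁ C₁)
    (H₂ : ConvKernel k₂ b₂ c₂ μ₂ κ₂ C₂) (hb₁ : ∀ τ, 0 ≤ b₁ τ) (hb₂ : ∀ τ, 0 ≤ b₂ τ)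
    (hc₁ : ∀ τ, 0 ≤ c₁ τ) (hc₂ : ∀ τ, 0 ≤ c₂ τ) (hE0 : ∀ m, 0 ≤ E m) (hE1 : ∀ m, E m ≤ 1)
    (hEc : Continuous E) (hEi : Integrable E) (hC₃ : 0 ≤ C₃)
    (hE : ∀ m, ∫ x, E (m - x) * E x ≤ C₃ * E m) (hf : Mem D₁ D₂ b₁ b₂ E N f) :
    LinOp D₁ D₂ c₁ c₂ E E (C₁ * C₂ * C₃ * N) (bil k₁ k₂ μ₁ μ₂ κ₁ κ₂ f) where
  nonneg := mul_nonneg (mul_nonneg (mul_nonneg H₁.const_nonneg H₂.const_nonneg) hC₃) hf.nonneg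
  mem hg := by
    rw [mul_assoc]
    exact mem_bil H₁ H₂ hb₁ hb₂ hc₁ hc₂ hE0 hE1 hEc hEi hC₃ hE hf hg
  sub hg hg' σ₁ h₁ σ₂ h₂ m := by
    simp only [bil]
    rw [← integral_sub (hf.integrable_bil H₁ H₂ hE0 hE1 hEc hEi hg h₁ h₂ m)
      (hf.integrable_bil H₁ H₂ hE0 hE1 hEc hEi hg' h₁ h₂ m)]
    simp only [Pi.sub_apply, mul_sub]

theorem linOp_bil_left (H₁ : ConvKernel k₁ c₁ c₁ μ₁ κ₁ C₁)
    (H₂ : ConvKernel k₂ c₂ c₂ μ₂ κ₂ C₂)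
    (hc₁ : ∀ τ, 0 ≤ c₁ τ) (hc₂ : ∀ τ, 0 ≤ c₂ τ) (hE0 : ∀ m, 0 ≤ E m) (hE1 : ∀ m, E m ≤ 1)
    (hEc : Continuous E) (hEi : Integrable E) (hC₃ : 0 ≤ C₃)
    (hE : ∀ m, ∫ x, E (m - x) * E x ≤ C₃ * E m) (hg : Mem D₁ D₂ c₁ c₂ E N g) :
    LinOp D₁ D₂ c₁ c₂ E E (C₁ * C₂ * C₃ * N) (fun f => bil k₁ k₂ μ₁ μ₂ κ₁ κ₂ f g) where
  nonneg := mul_nonneg (mul_nonneg (mul_nonneg H₁.const_nonneg H₂.const_nonneg) hC₃) hg.nonneg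
  mem {f N'} hf := by
    rw [mul_assoc, mul_comm N]
    exact mem_bil H₁ H₂ hc₁ hc₂ hc₁ hc₂ hE0 hE1 hEc hEi hC₃ hE hf hg
  sub hf hf' σ₁ h₁ σ₂ h₂ m := by
    simp only [bil]
    rw [← integral_sub (hf.integrable_bil H₁ H₂ hE0 hE1 hEc hEi hg h₁ h₂ m)
      (hf'.integrable_bil H₁ H₂ hE0 hE1 hEc hEi hg h₁ h₂ m)]
    simp only [Pi.sub_apply, mul_sub, sub_mul]

/-- Fubini's theorem for `bil`. -/
theorem bil_eq_iterated (H₁ : ConvKernel k₁ b₁ c₁ μ₁ κ₁ C₁)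
    (H₂ : ConvKernel k₂ b₂ c₂ μ₂ κ₂ C₂) (hE0 : ∀ m, 0 ≤ E m) (hE1 : ∀ m, E m ≤ 1)
    (hEc : Continuous E) (hEi : Integrable E)
    (hf : Mem D₁ D₂ b₁ b₂ E N f) (hg : Mem D₁ D₂ c₁ c₂ E N' g)
    {σ₁ σ₂ : ℂ} (h₁ : σ₁ ∈ D₁.Ω) (h₂ : σ₂ ∈ D₂.Ω) (m : ℝ) :
    bil k₁ k₂ μ₁ μ₂ κ₁ κ₂ f g σ₁ σ₂ m
      = ∫ u₁, (κ₁ u₁ : ℂ) * (∫ u₂, (κ₂ u₂ : ℂ) * (∫ m₁,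
          f (rt k₁ (1 - u₁) * σ₁) (rt k₂ (1 - u₂) * σ₂) (m - m₁)
          * g (rt k₁ u₁ * σ₁) (rt k₂ u₂ * σ₂) m₁) ∂μ₂) ∂μ₁ := by
  have hi := hf.integrable_bil H₁ H₂ hE0 hE1 hEc hEi hg h₁ h₂ m
  rw [bil, integral_prod _ hi]
  refine integral_congr_ae ?_
  filter_upwards [hi.prod_right_ae] with u₁ hu₁
  rw [integral_prod _ hu₁, ← integral_const_mul (κ₁ u₁ : ℂ)]
  refine integral_congr_ae (.of_forall fun u₂ => ?_)
  simp only [Complex.ofReal_mul, integral_const_mul, mul_assoc]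

end bil

/-! ### Fixed points -/

section fixedPoint

variable {b₁ b₂ : ℂ → ℝ} {E : ℝ → ℝ} {ϖ : ℝ} {H : (ℂ → ℂ → ℝ → ℂ) → ℂ → ℂ → ℝ → ℂ}

theorem eq_of_forall_norm_le_div_two_pow {z : ℂ} {c : ℝ} (h : ∀ n : ℕ, ‖z‖ ≤ c / 2 ^ n) : z = 0 := by
  have ht : Tendsto (fun n : ℕ => c / 2 ^ n) atTop (𝓝 0) := by
    have := (tendsto_pow_atTop_nhds_zero_of_lt_one (r := (1 / 2 : ℝ)) (by norm_num)
      (by norm_num)).const_mul c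
    simpa [div_eq_mul_inv] using this
  exact norm_le_zero_iff.1 (ge_of_tendsto' ht h)

/-- A map of a ball of the weighted space to itself which halves distances has a fixed point. The
limit of the Picard iteration is the sum of a series of regular functions, hence regular. -/
theorem exists_fixedPoint (hb₁ : Continuous b₁) (hb₂ : Continuous b₂) (hb₁0 : ∀ τ, 0 ≤ b₁ τ)
    (hb₂0 : ∀ τ, 0 ≤ b₂ τ) (hE0 : ∀ m, 0 ≤ E m) (hE1 : ∀ m, E m ≤ 1) (hϖ : 0 ≤ ϖ)
    (hmem : ∀ {h}, Mem D₁ D₂ b₁ b₂ E ϖ h → Mem D₁ D₂ b₁ b₂ E ϖ (H h))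
    (hcon : ∀ {h h' N}, Mem D₁ D₂ b₁ b₂ E ϖ h → Mem D₁ D₂ b₁ b₂ E ϖ h' →
      Mem D₁ D₂ b₁ b₂ E N (h - h') → Mem D₁ D₂ b₁ b₂ E (N / 2) (H h - H h')) :
    ∃ ω, Mem D₁ D₂ b₁ b₂ E ϖ ω ∧
      ∀ τ₁ ∈ D₁.Ω, ∀ τ₂ ∈ D₂.Ω, ∀ m, ω τ₁ τ₂ m = H ω τ₁ τ₂ m := by
  set u : ℕ → ℂ → ℂ → ℝ → ℂ := fun n => H^[n] 0 with hu
  have hsucc : ∀ n, u (n + 1) = H (u n) := fun n => Function.iterate_succ_apply' H n 0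
  have hW : ∀ τ₁ τ₂ m, 0 ≤ b₁ τ₁ * b₂ τ₂ * E m := fun τ₁ τ₂ m =>
    mul_nonneg (mul_nonneg (hb₁0 _) (hb₂0 _)) (hE0 _)
  have hu0 : Mem D₁ D₂ b₁ b₂ E ϖ (u 0) :=
    ⟨Reg.of_continuous continuous_const, hϖ, fun τ₁ _ τ₂ _ m => by
      simpa [hu] using mul_nonneg hϖ (hW τ₁ τ₂ m)⟩
  have hball : ∀ n, Mem D₁ D₂ b₁ b₂ E ϖ (u n) := by
    intro n
    induction n with
    | zero => exact hu0
    | succ n ih => rw [hsucc]; exact hmem ih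
  have hdiff : ∀ n, Mem D₁ D₂ b₁ b₂ E (ϖ / 2 ^ n) (u (n + 1) - u n) := by
    intro n
    induction n with
    | zero =>
      have h0 : u (0 + 1) - u 0 = u 1 := by
        simp [hu]
      rw [h0, pow_zero, div_one]
      exact hball 1
    | succ n ih =>
      have := hcon (hball (n + 1)) (hball n) ih
      rw [← hsucc, ← hsucc, div_div, ← pow_succ] at this
      exact this
  set ω : ℂ → ℂ → ℝ → ℂ := fun τ₁ τ₂ m => ∑' n, (u (n + 1) - u n) τ₁ τ₂ m with hω
  have hsumm2 : ∀ c : ℝ, Summable fun n : ℕ => c / 2 ^ n := fun c => by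
    have := (summable_geometric_of_lt_one (r := (1 / 2 : ℝ)) (by norm_num)
      (by norm_num)).mul_left c
    simpa [div_eq_mul_inv] using this
  have hreg : Reg D₁ D₂ ω := by
    refine Reg.tsum (fun n => (hdiff n).toReg) fun M => ?_
    obtain ⟨B₁, hB₁, hB₁'⟩ := exists_bound_of_continuous hb₁ M
    obtain ⟨B₂, hB₂, hB₂'⟩ := exists_bound_of_continuous hb₂ M
    refine ⟨fun n => ϖ / 2 ^ n * (B₁ * B₂ * 1), (hsumm2 ϖ).mul_right _,
      fun n τ₁ h₁ τ₂ h₂ m r₁ r₂ _ => ((hdiff n).bd _ h₁ _ h₂ m).trans ?_⟩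
    refine mul_le_mul_of_nonneg_left ?_ (by positivity)
    exact mul_le_mul (mul_le_mul (hB₁' _ r₁) (hB₂' _ r₂) (hb₂0 _) hB₁) (hE1 m) (hE0 m)
      (by positivity)
  have hlim : ∀ τ₁ ∈ D₁.Ω, ∀ τ₂ ∈ D₂.Ω, ∀ m,
      Tendsto (fun n => u n τ₁ τ₂ m) atTop (𝓝 (ω τ₁ τ₂ m)) := by
    intro τ₁ h₁ τ₂ h₂ m
    have hs : Summable fun n => (u (n + 1) - u n) τ₁ τ₂ m := by
      refine Summable.of_norm_bounded ((hsumm2 ϖ).mul_right (b₁ τ₁ * b₂ τ₂ * E m)) fun n => ?_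
      exact (hdiff n).bd _ h₁ _ h₂ m
    have := hs.hasSum.tendsto_sum_nat
    have h0 : u 0 τ₁ τ₂ m = 0 := rfl
    simp only [Pi.sub_apply, Finset.sum_range_sub (fun n => u n τ₁ τ₂ m), h0, sub_zero] at this
    exact this
  have hωmem : Mem D₁ D₂ b₁ b₂ E ϖ ω := ⟨hreg, hϖ, fun τ₁ h₁ τ₂ h₂ m =>
    le_of_tendsto' (hlim _ h₁ _ h₂ m).norm fun n => (hball n).bd _ h₁ _ h₂ m⟩
  have herr : ∀ n, Mem D₁ D₂ b₁ b₂ E (2 * ϖ / 2 ^ n) (ω - u n) := by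
    refine fun n => ⟨hreg.sub (hball n).toReg, by positivity, fun τ₁ h₁ τ₂ h₂ m => ?_⟩
    have := dist_le_of_le_geometric_two_of_tendsto (C := 2 * ϖ * (b₁ τ₁ * b₂ τ₂ * E m))
      (f := fun n => u n τ₁ τ₂ m) (fun n => ?_) (hlim _ h₁ _ h₂ m) n
    · rw [dist_comm, dist_eq_norm] at this
      refine this.trans (le_of_eq ?_)
      ring
    · rw [dist_comm, dist_eq_norm]
      refine ((hdiff n).bd _ h₁ _ h₂ m).trans (le_of_eq ?_)
      ring
  refine ⟨ω, hωmem, fun τ₁ h₁ τ₂ h₂ m => ?_⟩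
  rw [← sub_eq_zero]
  refine eq_of_forall_norm_le_div_two_pow (c := 2 * ϖ * (b₁ τ₁ * b₂ τ₂ * E m)) fun n => ?_
  have e1 := (herr (n + 1)).bd _ h₁ _ h₂ m
  have e2 := (hcon hωmem (hball n) (herr n)).bd _ h₁ _ h₂ m
  rw [← hsucc] at e2
  simp only [Pi.sub_apply] at e1 e2
  calc ‖ω τ₁ τ₂ m - H ω τ₁ τ₂ m‖
      = ‖(ω τ₁ τ₂ m - u (n + 1) τ₁ τ₂ m) - (H ω τ₁ τ₂ m - u (n + 1) τ₁ τ₂ m)‖ := by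
        rw [sub_sub_sub_cancel_right]
    _ ≤ _ := norm_sub_le _ _
    _ ≤ _ := add_le_add e1 e2
    _ = _ := by rw [pow_succ]; ring

theorem fixedPoint_unique
    (hcon : ∀ {h h' N}, Mem D₁ D₂ b₁ b₂ E ϖ h → Mem D₁ D₂ b₁ b₂ E ϖ h' →
      Mem D₁ D₂ b₁ b₂ E N (h - h') → Mem D₁ D₂ b₁ b₂ E (N / 2) (H h - H h'))
    {ω ω' : ℂ → ℂ → ℝ → ℂ} (hω : Mem D₁ D₂ b₁ b₂ E ϖ ω) (hω' : Mem D₁ D₂ b₁ b₂ E ϖ ω')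
    (he : ∀ τ₁ ∈ D₁.Ω, ∀ τ₂ ∈ D₂.Ω, ∀ m, ω τ₁ τ₂ m = H ω τ₁ τ₂ m)
    (he' : ∀ τ₁ ∈ D₁.Ω, ∀ τ₂ ∈ D₂.Ω, ∀ m, ω' τ₁ τ₂ m = H ω' τ₁ τ₂ m) :
    ∀ τ₁ ∈ D₁.Ω, ∀ τ₂ ∈ D₂.Ω, ∀ m, ω' τ₁ τ₂ m = ω τ₁ τ₂ m := by
  have key : ∀ n : ℕ, Mem D₁ D₂ b₁ b₂ E ((ϖ + ϖ) / 2 ^ n) (ω' - ω) := by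
    intro n
    induction n with
    | zero => simpa using hω'.sub hω
    | succ n ih =>
      have h1 := hcon hω' hω ih
      rw [div_div, ← pow_succ] at h1
      refine ⟨ih.toReg, h1.nonneg, fun τ₁ h₁ τ₂ h₂ m => ?_⟩
      have := h1.bd _ h₁ _ h₂ m
      simp only [Pi.sub_apply] at this ⊢
      rwa [he _ h₁ _ h₂, he' _ h₁ _ h₂]
  intro τ₁ h₁ τ₂ h₂ m
  rw [← sub_eq_zero]
  refine eq_of_forall_norm_le_div_two_pow (c := (ϖ + ϖ) * (b₁ τ₁ * b₂ τ₂ * E m)) fun n => ?_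
  exact ((key n).bd _ h₁ _ h₂ m).trans (le_of_eq (by ring))

end fixedPoint

/-! ### The weighted norms and the sectorial domains -/

theorem isOpen_openSector (d θ : ℝ) : IsOpen (openSector d θ) := by
  have : openSector d θ = Complex.exp '' {w : ℂ | |w.im - d| < θ} := by
    ext z
    constructor
    · rintro ⟨r, φ, hr, hφ, rfl⟩
      refine ⟨Real.log r + Complex.I * φ, by simpa using hφ, ?_⟩
      rw [Complex.exp_add, ← Complex.ofReal_exp, Real.exp_log hr]
    · rintro ⟨w, hw, rfl⟩
      refine ⟨Real.exp w.re, w.im, Real.exp_pos _, hw, ?_⟩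
      rw [Complex.ofReal_exp, ← Complex.exp_add, mul_comm Complex.I, Complex.re_add_im]
  rw [this]
  exact Complex.isOpenMap_exp _ (isOpen_lt (by fun_prop) continuous_const)

theorem smul_mem_openSector {d θ c : ℝ} (hc : 0 < c) {z : ℂ} (hz : z ∈ openSector d θ) :
    (c : ℂ) * z ∈ openSector d θ := by
  obtain ⟨r, φ, hr, hφ, rfl⟩ := hz
  exact ⟨c * r, φ, mul_pos hc hr, hφ, by push_cast; ring⟩

/-- The disc of radius `ρ` together with a sector. -/
def sectorDom (ρ d θ : ℝ) (hρ : 0 < ρ) : Dom where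
  U := openDom ρ d θ
  Ω := closedDom ρ d θ
  isOpen := Metric.isOpen_ball.union (isOpen_openSector d θ)
  sub := union_subset_union_left _ Metric.ball_subset_closedBall
  smul_mem_U := by
    rintro c ⟨hc0, hc1⟩ z hz
    rcases hc0.eq_or_lt with rfl | hc
    · left; simpa using hρ
    · rcases hz with hz | hz
      · left
        rw [mem_ball_zero_iff] at hz ⊢
        rw [norm_mul, Complex.norm_real, Real.norm_of_nonneg hc0]
        nlinarith [norm_nonneg z]
      · exact .inr (smul_mem_openSector hc hz)
  smul_mem := by
    rintro c ⟨hc0, hc1⟩ z hz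
    rcases hc0.eq_or_lt with rfl | hc
    · left; simpa using hρ.le
    · rcases hz with hz | hz
      · left
        rw [mem_closedBall_zero_iff] at hz ⊢
        rw [norm_mul, Complex.norm_real, Real.norm_of_nonneg hc0]
        nlinarith [norm_nonneg z]
      · exact .inr (smul_mem_openSector hc hz)

theorem weightE_eq (β μ m : ℝ) : weightE β μ m = (ENNReal.ofReal (Ew β μ m))⁻¹ := by
  rw [weightE, ← ENNReal.ofReal_inv_of_pos (Ew_pos _ _ _), Ew, mul_inv,
    Real.rpow_neg (by positivity), inv_inv, Real.exp_neg, inv_inv]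

theorem weightF_eq (ν : ℝ) (k : ℕ) (ε τ : ℂ) :
    weightF ν k ε τ = (ENNReal.ofReal (Wt ν k ε τ))⁻¹ := by
  have hx := norm_nonneg (τ / ε)
  rw [weightF, Wt, wt]
  set x := ‖τ / ε‖
  rcases hx.eq_or_lt with h | h
  · rw [← h]
    simp only [zero_div, zero_mul, ENNReal.ofReal_zero, ENNReal.inv_zero]
    rw [ENNReal.div_zero, ENNReal.top_mul]
    · simp only [ne_eq, ENNReal.ofReal_eq_zero, not_le]
      positivity
    · simp only [ne_eq, ENNReal.ofReal_eq_zero, not_le]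
      positivity
  · rw [← ENNReal.ofReal_div_of_pos h, ← ENNReal.ofReal_mul (by positivity),
      ← ENNReal.ofReal_inv_of_pos (by positivity), mul_inv, inv_div, Real.exp_neg]

/-- The weights of the norms are infinite where the reciprocal weight vanishes, so that they force
functions of finite norm to vanish there. -/
theorem inv_ofReal_mul_enorm_le {c N : ℝ} (hc : 0 ≤ c) (hN : 0 ≤ N) (z : ℂ) :
    (ENNReal.ofReal c)⁻¹ * ‖z‖ₑ ≤ ENNReal.ofReal N ↔ ‖z‖ ≤ N * c := by
  rcases hc.eq_or_lt with rfl | hc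
  · rw [ENNReal.ofReal_zero, ENNReal.inv_zero, mul_zero, norm_le_zero_iff]
    constructor
    · intro h
      by_contra hz
      rw [ENNReal.top_mul (by simpa using hz), top_le_iff] at h
      exact ENNReal.ofReal_ne_top h
    · rintro rfl
      simp
  · rw [← ofReal_norm, ← ENNReal.ofReal_inv_of_pos hc, ← ENNReal.ofReal_mul (by positivity),
      ENNReal.ofReal_le_ofReal_iff hN, inv_mul_le_iff₀ hc, mul_comm c]

theorem normE_le_iff {β μ N : ℝ} (hN : 0 ≤ N) (h : ℝ → ℂ) :
    normE β μ h ≤ ENNReal.ofReal N ↔ ∀ m, ‖h m‖ ≤ N * Ew β μ m := by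
  simp only [normE, iSup_le_iff, weightE_eq, inv_ofReal_mul_enorm_le (Ew_nonneg _ _ _) hN]

theorem normF₁_le_iff {Ω : Set ℂ} {ν β μ N : ℝ} {k : ℕ} {ε : ℂ} (hN : 0 ≤ N)
    (h : ℂ → ℝ → ℂ) : normF₁ Ω ν β μ k ε h ≤ ENNReal.ofReal N ↔
      ∀ τ ∈ Ω, ∀ m, ‖h τ m‖ ≤ N * (Wt ν k ε τ * Ew β μ m) := by
  simp only [normF₁, iSup_le_iff, weightE_eq, weightF_eq]
  refine forall₃_congr fun τ _ m => ?_
  have h1 := Wt_nonneg (ν := ν) (k := k) (ε := ε) τ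
  rw [← inv_ofReal_mul_enorm_le (mul_nonneg h1 (Ew_nonneg _ _ _)) hN,
    ← ENNReal.mul_inv (.inr ENNReal.ofReal_ne_top) (.inl ENNReal.ofReal_ne_top),
    ← ENNReal.ofReal_mul (Ew_nonneg _ _ _), mul_comm (Ew _ _ _)]

theorem normF_le_iff {Ω₁ Ω₂ : Set ℂ} {ν₁ ν₂ β μ N : ℝ} {k₁ k₂ : ℕ} {ε : ℂ} (hN : 0 ≤ N)
    (h : ℂ → ℂ → ℝ → ℂ) : normF Ω₁ Ω₂ ν₁ ν₂ β μ k₁ k₂ ε h ≤ ENNReal.ofReal N ↔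
      ∀ τ₁ ∈ Ω₁, ∀ τ₂ ∈ Ω₂, ∀ m,
        ‖h τ₁ τ₂ m‖ ≤ N * (Wt ν₁ k₁ ε τ₁ * Wt ν₂ k₂ ε τ₂ * Ew β μ m) := by
  simp only [normF, iSup_le_iff, weightE_eq, weightF_eq]
  refine forall₅_congr fun τ₁ _ τ₂ _ m => ?_
  have h1 := Wt_nonneg (ν := ν₁) (k := k₁) (ε := ε) τ₁
  have h2 := Wt_nonneg (ν := ν₂) (k := k₂) (ε := ε) τ₂
  rw [← inv_ofReal_mul_enorm_le (mul_nonneg (mul_nonneg h1 h2) (Ew_nonneg _ _ _)) hN,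
    ← ENNReal.mul_inv (.inr ENNReal.ofReal_ne_top) (.inl ENNReal.ofReal_ne_top),
    ← ENNReal.ofReal_mul h1,
    ← ENNReal.mul_inv (.inr ENNReal.ofReal_ne_top) (.inl ENNReal.ofReal_ne_top),
    ← ENNReal.ofReal_mul (Ew_nonneg _ _ _), mul_comm (Ew _ _ _)]

theorem mem_iff_memF {ρ₁ d₁ θ₁ ρ₂ d₂ θ₂ ν₁ ν₂ β μ N : ℝ} (hρ₁ : 0 < ρ₁) (hρ₂ : 0 < ρ₂)
    {k₁ k₂ : ℕ} {ε : ℂ} (hN : 0 ≤ N) {h : ℂ → ℂ → ℝ → ℂ} :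
    Mem (sectorDom ρ₁ d₁ θ₁ hρ₁) (sectorDom ρ₂ d₂ θ₂ hρ₂) (Wt ν₁ k₁ ε) (Wt ν₂ k₂ ε) (Ew β μ) N h ↔
      MemF (openDom ρ₁ d₁ θ₁) (openDom ρ₂ d₂ θ₂) (closedDom ρ₁ d₁ θ₁) (closedDom ρ₂ d₂ θ₂)
        ν₁ ν₂ β μ k₁ k₂ ε h ∧
      normF (closedDom ρ₁ d₁ θ₁) (closedDom ρ₂ d₂ θ₂) ν₁ ν₂ β μ k₁ k₂ ε h ≤ ENNReal.ofReal N := by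
  rw [normF_le_iff hN]
  constructor
  · intro hh
    exact ⟨⟨hh.cont, hh.hol, ((normF_le_iff hN h).2 hh.bd).trans_lt ENNReal.ofReal_lt_top⟩, hh.bd⟩
  · rintro ⟨h1, h2⟩
    exact ⟨⟨h1.continuousOn, h1.holomorphic⟩, hN, h2⟩

/-! ### Regularity of the Borel series -/

theorem reg_borel₂ {k₁ k₂ : ℕ} (hk₁ : 1 ≤ k₁) (hk₂ : 1 ≤ k₂) {a : ℕ → ℕ → ℝ → ℂ} {K T : ℝ}
    (hK : 0 ≤ K) (hT : 0 ≤ T) (hc : ∀ n₁ n₂, 1 ≤ n₁ → 1 ≤ n₂ → Continuous (a n₁ n₂))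
    (ha : ∀ n₁ n₂, 1 ≤ n₁ → 1 ≤ n₂ → ∀ m, ‖a n₁ n₂ m‖ ≤ K * T ^ (n₁ + n₂)) :
    Reg D₁ D₂ (fun τ₁ τ₂ m => borel₂ k₁ k₂ (fun n₁ n₂ => a n₁ n₂ m) τ₁ τ₂) := by
  unfold borel₂
  refine Reg.tsum (fun n => ⟨?_, fun m => by fun_prop⟩) fun M => ?_
  · have := hc (n.1 + 1) (n.2 + 1) (by omega) (by omega)
    fun_prop
  · have hTM : 0 ≤ T * |M| := by positivity
    have hG : ∀ {k : ℕ}, 1 ≤ k → ∀ n : ℕ, 0 < Real.Gamma (((n + 1 : ℕ) : ℝ) / k) := by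
      intro k hk n
      have : (0 : ℝ) < k := by exact_mod_cast hk
      exact Real.Gamma_pos_of_pos (by positivity)
    refine ⟨_, (((summable_pow_div_Gamma hk₁ hTM).mul_of_nonneg (summable_pow_div_Gamma hk₂ hTM)
      (fun n => ?_) (fun n => ?_)).mul_left K), fun n τ₁ _ τ₂ _ m r₁ r₂ _ => ?_⟩
    · have := hG hk₁ n
      simp only [Pi.zero_apply]
      positivity
    · have := hG hk₂ n
      simp only [Pi.zero_apply]
      positivity
    · have g1 := hG hk₁ n.1
      have g2 := hG hk₂ n.2
      have e := ha (n.1 + 1) (n.2 + 1) (by omega) (by omega) m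
      rw [norm_mul, norm_mul, norm_div, norm_div, norm_pow, norm_pow, Complex.norm_real,
        Complex.norm_real, Real.norm_of_nonneg g1.le, Real.norm_of_nonneg g2.le]
      calc _ ≤ K * T ^ (n.1 + 1 + (n.2 + 1))
            * (|M| ^ (n.1 + 1) / Real.Gamma (((n.1 + 1 : ℕ) : ℝ) / k₁))
            * (|M| ^ (n.2 + 1) / Real.Gamma (((n.2 + 1 : ℕ) : ℝ) / k₂)) := by
            gcongr
            · exact r₁.trans (le_abs_self M)
            · exact r₂.trans (le_abs_self M)
        _ = _ := by
            rw [mul_pow, mul_pow, pow_add]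
            ring

theorem reg_borel₁ {k : ℕ} (hk : 1 ≤ k) {a : ℕ → ℝ → ℂ} {K T : ℝ}
    (hK : 0 ≤ K) (hT : 0 ≤ T) (hc : ∀ n, Continuous (a n))
    (ha : ∀ n m, ‖a n m‖ ≤ K * T ^ n) :
    Reg D₁ D₂ (fun τ₁ _ m => borel₁ k (fun n => a n m) τ₁) := by
  unfold borel₁
  refine Reg.tsum (fun n => ⟨?_, fun m => by fun_prop⟩) fun M => ?_
  · have := hc (n + 1)
    fun_prop
  · have hTM : 0 ≤ T * |M| := by positivity
    refine ⟨_, (summable_pow_div_Gamma hk hTM).mul_left K, fun n τ₁ _ τ₂ _ m r₁ _ _ => ?_⟩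
    have : (0 : ℝ) < k := by exact_mod_cast hk
    have g1 : 0 < Real.Gamma (((n + 1 : ℕ) : ℝ) / k) := Real.Gamma_pos_of_pos (by positivity)
    have e := ha (n + 1) m
    rw [norm_mul, norm_div, norm_pow, Complex.norm_real, Real.norm_of_nonneg g1.le]
    calc _ ≤ K * T ^ (n + 1) * (|M| ^ (n + 1) / Real.Gamma (((n + 1 : ℕ) : ℝ) / k)) := by
          gcongr
          exact r₁.trans (le_abs_self M)
      _ = _ := by
          rw [mul_pow]
          ring

/-! ### The equation as a fixed point problem -/

theorem symb_eq (k : ℕ) {δ : ℕ} (hδ : 1 ≤ δ) (Q R : ℂ[X]) (m : ℝ) (τ : ℂ) :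
    symb k δ Q R m τ = τ ^ k * charPoly k δ Q R m τ := by
  obtain ⟨j, rfl⟩ : ∃ j, δ = j + 1 := ⟨δ - 1, by omega⟩
  rw [symb, charPoly, Nat.add_sub_cancel]
  ring

theorem volterra_const_mul (k n : ℕ) (c : ℂ) (f : ℂ → ℂ) (τ : ℂ) :
    volterra k n (fun σ => c * f σ) τ = c * volterra k n f τ := by
  rw [volterra, volterra, mul_left_comm c, ← intervalIntegral.integral_const_mul c]
  congr 1
  refine intervalIntegral.integral_congr fun t _ => ?_
  ring

theorem borelA_const_mul (k δ : ℕ) (c : ℂ) (f : ℂ → ℂ) (τ : ℂ) :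
    borelA k δ (fun σ => c * f σ) τ = c * borelA k δ f τ := by
  rw [borelA, borelA, Finset.mul_sum]
  refine Finset.sum_congr rfl fun p _ => ?_
  rw [show (fun σ : ℂ => (k : ℂ) ^ p * (σ ^ k) ^ p * (c * f σ))
      = fun σ => c * ((k : ℂ) ^ p * (σ ^ k) ^ p * f σ) by funext σ; ring, volterra_const_mul]
  ring

theorem volterra_congr {D : Dom} {k n : ℕ} {f f' : ℂ → ℂ} {τ : ℂ} (hτ : τ ∈ D.Ω)
    (h : ∀ σ ∈ D.Ω, f σ = f' σ) : volterra k n f τ = volterra k n f' τ := by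
  rw [volterra, volterra]
  congr 1
  refine intervalIntegral.integral_congr fun t ht => ?_
  rw [uIcc_of_le zero_le_one] at ht
  rw [h (rt k t * τ) (D.smul_mem _ (rpow_inv_mem_Icc k ht) _ hτ)]

theorem volterra₂_congr {k₁ k₂ n₁ n₂ : ℕ} {g g' : ℂ → ℂ → ℂ} {τ₁ τ₂ : ℂ}
    (h₁ : τ₁ ∈ D₁.Ω) (h₂ : τ₂ ∈ D₂.Ω) (h : ∀ σ₁ ∈ D₁.Ω, ∀ σ₂ ∈ D₂.Ω, g σ₁ σ₂ = g' σ₁ σ₂) :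
    volterra₂ k₁ k₂ n₁ n₂ g τ₁ τ₂ = volterra₂ k₁ k₂ n₁ n₂ g' τ₁ τ₂ := by
  rw [volterra₂, volterra₂]
  congr 1
  exact volterra_congr h₁ fun σ₁ hσ₁ => volterra_congr h₂ fun σ₂ hσ₂ => h _ hσ₁ _ hσ₂

theorem rt_pow {k : ℕ} (hk : 1 ≤ k) {t : ℝ} (ht : 0 ≤ t) : rt k t ^ k = t := by
  rw [rt, ← Complex.ofReal_pow, rpow_inv_pow hk ht]

theorem volterra_eq {k : ℕ} (hk : 1 ≤ k) (n q : ℕ) (f : ℂ → ℂ) (τ : ℂ) :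
    volterra k n (fun σ => (σ ^ k) ^ q * f σ) τ = τ ^ ((n : ℤ) - k) * (τ ^ k) ^ q *
      ∫ t in Ioc (0 : ℝ) 1, (((1 - t) ^ ((n : ℝ) / k - 1) * t ^ q / t : ℝ) : ℂ) * f (rt k t * τ) := by
  rw [volterra, mul_assoc, intervalIntegral.integral_of_le zero_le_one,
    ← integral_const_mul ((τ ^ k) ^ q)]
  congr 1
  refine setIntegral_congr_fun measurableSet_Ioc fun t ht => ?_
  rw [mul_pow, rt_pow hk ht.1.le, mul_pow]
  push_cast
  ring

/-- The normalized Volterra operator: `R(im) τ^k / symb` times the Volterra operator with kernel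
`(τ^k - s)^{n/k-1} s^q`. -/
def opK (k δ : ℕ) (Q R : ℂ[X]) (n q : ℕ) : (ℂ → ℂ → ℝ → ℂ) → ℂ → ℂ → ℝ → ℂ :=
  volT (fun τ m => ev R m * τ ^ (n + k * q - k) / charPoly k δ Q R m τ) k ((n : ℝ) / k) q

theorem volterra_eq_opK {k δ : ℕ} (hk : 1 ≤ k) (hδ : 1 ≤ δ) {Q R : ℂ[X]} {n q : ℕ}
    (hn : k ≤ n + k * q) (h : ℂ → ℂ → ℝ → ℂ) {τ₁ : ℂ} (τ₂ : ℂ) {m : ℝ}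
    (hP : charPoly k δ Q R m τ₁ ≠ 0) :
    ev R m * (τ₁ ^ k * volterra k n (fun σ => (σ ^ k) ^ q * h σ τ₂ m) τ₁)
      = symb k δ Q R m τ₁ * opK k δ Q R n q h τ₁ τ₂ m := by
  rw [symb_eq k hδ]
  rcases eq_or_ne τ₁ 0 with rfl | hτ
  · rw [zero_pow (by omega)]
    ring
  rw [volterra_eq hk, opK, volT]
  have e : τ₁ ^ ((n : ℤ) - k) * (τ₁ ^ k) ^ q = τ₁ ^ (n + k * q - k) := by
    rw [← pow_mul, ← zpow_natCast, ← zpow_natCast, ← zpow_add₀ hτ]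
    congr 1
    push_cast [hn]
    ring
  rw [e]
  have key : ∀ I : ℂ, ev R m * (τ₁ ^ k * (τ₁ ^ (n + k * q - k) * I)) =
      τ₁ ^ k * charPoly k δ Q R m τ₁
        * (ev R m * τ₁ ^ (n + k * q - k) / charPoly k δ Q R m τ₁ * I) := by
    intro I
    field_simp
  exact key _

/-- Division of `R(im) · borelA` by the symbol. -/
def opA (k δ : ℕ) (Q R : ℂ[X]) (h : ℂ → ℂ → ℝ → ℂ) : ℂ → ℂ → ℝ → ℂ :=
  ∑ p ∈ Finset.Icc 1 (δ - 1), fun τ₁ τ₂ m =>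
    ((irregCoeff k δ p : ℂ) * (k : ℂ) ^ p / (Real.Gamma ((δ - p : ℕ) : ℝ) : ℂ))
      * opK k δ Q R (k * (δ - p)) p h τ₁ τ₂ m

theorem borelA_eq_opA {k δ : ℕ} (hk : 1 ≤ k) (hδ : 1 ≤ δ) {Q R : ℂ[X]}
    (h : ℂ → ℂ → ℝ → ℂ) {τ₁ : ℂ} (τ₂ : ℂ) {m : ℝ} (hP : charPoly k δ Q R m τ₁ ≠ 0) :
    ev R m * borelA k δ (fun σ => h σ τ₂ m) τ₁
      = symb k δ Q R m τ₁ * opA k δ Q R h τ₁ τ₂ m := by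
  rw [borelA, opA]
  simp only [Finset.sum_apply, Finset.mul_sum]
  refine Finset.sum_congr rfl fun p hp => ?_
  have hp' : 1 ≤ δ - p := by
    have := Finset.mem_Icc.1 hp
    omega
  have hn : k ≤ k * (δ - p) + k * p := (Nat.le_mul_of_pos_right k hp').trans (Nat.le_add_right _ _)
  have := volterra_eq_opK hk hδ hn h τ₂ hP
  rw [show (fun σ : ℂ => (k : ℂ) ^ p * (σ ^ k) ^ p * h σ τ₂ m)
      = fun σ => (k : ℂ) ^ p * ((σ ^ k) ^ p * h σ τ₂ m) by funext σ; ring, volterra_const_mul,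
    mul_left_comm (symb k δ Q R m τ₁), ← this]
  ring

theorem borelA_borelA_eq {k₁ δ₁ k₂ δ₂ : ℕ} (hk₁ : 1 ≤ k₁) (hδ₁ : 1 ≤ δ₁) (hk₂ : 1 ≤ k₂)
    (hδ₂ : 1 ≤ δ₂) {Q₁ R₁ Q₂ R₂ : ℂ[X]} (h : ℂ → ℂ → ℝ → ℂ) {τ₁ τ₂ : ℂ} {m : ℝ}
    (hP₁ : charPoly k₁ δ₁ Q₁ R₁ m τ₁ ≠ 0) (hP₂ : charPoly k₂ δ₂ Q₂ R₂ m τ₂ ≠ 0) :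
    ev R₁ m * ev R₂ m
        * borelA k₁ δ₁ (fun σ₁ => borelA k₂ δ₂ (fun σ₂ => h σ₁ σ₂ m) τ₂) τ₁
      = symb k₁ δ₁ Q₁ R₁ m τ₁ * symb k₂ δ₂ Q₂ R₂ m τ₂
        * opA k₁ δ₁ Q₁ R₁ (swapOp (opA k₂ δ₂ Q₂ R₂) h) τ₁ τ₂ m := by
  have e2 : ∀ σ₁, ev R₂ m * borelA k₂ δ₂ (fun σ₂ => h σ₁ σ₂ m) τ₂
      = symb k₂ δ₂ Q₂ R₂ m τ₂ * swapOp (opA k₂ δ₂ Q₂ R₂) h σ₁ τ₂ m := fun σ₁ =>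
    borelA_eq_opA hk₂ hδ₂ (fun τ₂ τ₁ m => h τ₁ τ₂ m) σ₁ hP₂
  rw [mul_assoc, ← borelA_const_mul]
  simp only [e2]
  rw [borelA_const_mul, mul_left_comm, borelA_eq_opA hk₁ hδ₁ _ τ₂ hP₁]
  ring

theorem volterra₂_eq {k₁ δ₁ k₂ δ₂ : ℕ} (hk₁ : 1 ≤ k₁) (hδ₁ : 1 ≤ δ₁) (hk₂ : 1 ≤ k₂)
    (hδ₂ : 1 ≤ δ₂) {Q₁ R₁ Q₂ R₂ : ℂ[X]} {n₁ q₁ n₂ q₂ : ℕ} (hn₁ : k₁ ≤ n₁ + k₁ * q₁)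
    (hn₂ : k₂ ≤ n₂ + k₂ * q₂) (h : ℂ → ℂ → ℝ → ℂ) {τ₁ τ₂ : ℂ} {m : ℝ}
    (hP₁ : charPoly k₁ δ₁ Q₁ R₁ m τ₁ ≠ 0) (hP₂ : charPoly k₂ δ₂ Q₂ R₂ m τ₂ ≠ 0) :
    ev R₁ m * ev R₂ m
        * volterra₂ k₁ k₂ n₁ n₂ (fun σ₁ σ₂ => (σ₁ ^ k₁) ^ q₁ * ((σ₂ ^ k₂) ^ q₂ * h σ₁ σ₂ m)) τ₁ τ₂
      = symb k₁ δ₁ Q₁ R₁ m τ₁ * symb k₂ δ₂ Q₂ R₂ m τ₂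
        * (((Real.Gamma ((n₁ : ℝ) / k₁) : ℂ) * (Real.Gamma ((n₂ : ℝ) / k₂) : ℂ))⁻¹
          * opK k₁ δ₁ Q₁ R₁ n₁ q₁ (swapOp (opK k₂ δ₂ Q₂ R₂ n₂ q₂) h) τ₁ τ₂ m) := by
  have e2 : ∀ σ₁, ev R₂ m * (τ₂ ^ k₂ * volterra k₂ n₂ (fun σ₂ => (σ₂ ^ k₂) ^ q₂ * h σ₁ σ₂ m) τ₂)
      = symb k₂ δ₂ Q₂ R₂ m τ₂ * swapOp (opK k₂ δ₂ Q₂ R₂ n₂ q₂) h σ₁ τ₂ m := fun σ₁ =>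
    volterra_eq_opK hk₂ hδ₂ hn₂ (fun τ₂ τ₁ m => h τ₁ τ₂ m) σ₁ hP₂
  have e1 := volterra_eq_opK hk₁ hδ₁ hn₁ (swapOp (opK k₂ δ₂ Q₂ R₂ n₂ q₂) h) τ₂ hP₁
  have e3 : ev R₂ m * τ₂ ^ k₂ * volterra k₁ n₁ (fun σ₁ =>
      volterra k₂ n₂ (fun σ₂ => (σ₁ ^ k₁) ^ q₁ * ((σ₂ ^ k₂) ^ q₂ * h σ₁ σ₂ m)) τ₂) τ₁
      = symb k₂ δ₂ Q₂ R₂ m τ₂ * volterra k₁ n₁ (fun σ₁ => (σ₁ ^ k₁) ^ q₁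
        * swapOp (opK k₂ δ₂ Q₂ R₂ n₂ q₂) h σ₁ τ₂ m) τ₁ := by
    rw [← volterra_const_mul, ← volterra_const_mul]
    congr 1
    funext σ₁
    rw [volterra_const_mul]
    linear_combination (σ₁ ^ k₁) ^ q₁ * e2 σ₁
  rw [volterra₂, div_eq_mul_inv]
  linear_combination (ev R₁ m * τ₁ ^ k₁
      * ((Real.Gamma ((n₁ : ℝ) / k₁) : ℂ) * (Real.Gamma ((n₂ : ℝ) / k₂) : ℂ))⁻¹) * e3
    + symb k₂ δ₂ Q₂ R₂ m τ₂
      * ((Real.Gamma ((n₁ : ℝ) / k₁) : ℂ) * (Real.Gamma ((n₂ : ℝ) / k₂) : ℂ))⁻¹ * e1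

/-! ### The convolution terms through `bil` -/

/-- Lebesgue measure on `(0,1]`. -/
abbrev unitMeasure : Measure ℝ := volume.restrict (Ioc 0 1)

/-- The kernel of the convolution in the Borel plane. -/
def convKer (u : ℝ) : ℝ := 1 / ((1 - u) * u)

theorem pow_mul_convol (k : ℕ) (h : ℂ → ℂ → ℂ) {σ : ℂ} (hσ : σ ≠ 0) :
    σ ^ k * convol k h σ
      = ∫ u, (convKer u : ℂ) * h (rt k (1 - u) * σ) (rt k u * σ) ∂unitMeasure := by
  rw [convol, mul_inv_cancel_left₀ (pow_ne_zero _ hσ),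
    intervalIntegral.integral_of_le zero_le_one]
  refine integral_congr_ae (.of_forall fun u => ?_)
  simp only [convKer]
  push_cast
  ring

/-- The normalization of the Fourier convolution. -/
def fourierConst : ℂ := 1 / (Real.sqrt (2 * Real.pi) : ℂ)

theorem norm_fourierConst_le : ‖fourierConst‖ ≤ 1 := by
  rw [fourierConst, norm_div, norm_one, Complex.norm_real, Real.norm_of_nonneg (Real.sqrt_nonneg _)]
  have : 1 ≤ Real.sqrt (2 * Real.pi) := by
    rw [Real.one_le_sqrt]
    linarith [Real.pi_gt_three]
  exact div_le_one_of_le₀ this (by linarith)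

section convolution

variable {k₁ k₂ : ℕ} {b₁ b₂ c₁ c₂ : ℂ → ℝ} {C₁ C₂ : ℝ} {E : ℝ → ℝ} {N N' : ℝ}
  {f g : ℂ → ℂ → ℝ → ℂ} {σ₁ σ₂ : ℂ}

theorem bil_eq_zero_left {μ₁ μ₂ : Measure ℝ} {κ₁ κ₂ : ℝ → ℝ}
    (hg : Mem D₁ D₂ c₁ c₂ E N g) (hc₁ : c₁ 0 = 0)
    (H₁ : ConvKernel k₁ b₁ c₁ μ₁ κ₁ C₁) (H₂ : ConvKernel k₂ b₂ c₂ μ₂ κ₂ C₂)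
    (h₁ : (0 : ℂ) ∈ D₁.Ω) (h₂ : σ₂ ∈ D₂.Ω) (m : ℝ) :
    bil k₁ k₂ μ₁ μ₂ κ₁ κ₂ f g 0 σ₂ m = 0 := by
  rw [bil]
  refine integral_eq_zero_of_ae ?_
  filter_upwards [ae_prod_mem H₁ H₂] with x hx
  have e := hg.bd 0 h₁ _ (D₂.smul_mem _ (rpow_inv_mem_Icc k₂ hx.2.1) _ h₂) x.2.2
  rw [hc₁, zero_mul, zero_mul, mul_zero, norm_le_zero_iff] at e
  change g 0 (rt k₂ x.2.1 * σ₂) x.2.2 = 0 at e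
  simp only [mul_zero, e, Pi.zero_apply]

theorem bil_eq_zero_right {μ₁ μ₂ : Measure ℝ} {κ₁ κ₂ : ℝ → ℝ}
    (hg : Mem D₁ D₂ c₁ c₂ E N g) (hc₂ : c₂ 0 = 0)
    (H₁ : ConvKernel k₁ b₁ c₁ μ₁ κ₁ C₁) (H₂ : ConvKernel k₂ b₂ c₂ μ₂ κ₂ C₂)
    (h₁ : σ₁ ∈ D₁.Ω) (h₂ : (0 : ℂ) ∈ D₂.Ω) (m : ℝ) :
    bil k₁ k₂ μ₁ μ₂ κ₁ κ₂ f g σ₁ 0 m = 0 := by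
  rw [bil]
  refine integral_eq_zero_of_ae ?_
  filter_upwards [ae_prod_mem H₁ H₂] with x hx
  have e := hg.bd _ (D₁.smul_mem _ (rpow_inv_mem_Icc k₁ hx.1.1) _ h₁) 0 h₂ x.2.2
  rw [hc₂, mul_zero, zero_mul, mul_zero, norm_le_zero_iff] at e
  change g (rt k₁ x.1 * σ₁) 0 x.2.2 = 0 at e
  simp only [mul_zero, e, Pi.zero_apply]

theorem convol_convol_eq (hE0 : ∀ m, 0 ≤ E m) (hE1 : ∀ m, E m ≤ 1)
    (hEc : Continuous E) (hEi : Integrable E) (hc₁ : c₁ 0 = 0) (hc₂ : c₂ 0 = 0)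
    (H₁ : ConvKernel k₁ b₁ c₁ unitMeasure convKer C₁)
    (H₂ : ConvKernel k₂ b₂ c₂ unitMeasure convKer C₂)
    (hf : Mem D₁ D₂ b₁ b₂ E N f) (hg : Mem D₁ D₂ c₁ c₂ E N' g) (hk₁ : 1 ≤ k₁) (hk₂ : 1 ≤ k₂)
    (h₁ : σ₁ ∈ D₁.Ω) (h₂ : σ₂ ∈ D₂.Ω) (m : ℝ) :
    σ₁ ^ k₁ * σ₂ ^ k₂ * convol k₁ (fun a₁ d₁ => convol k₂ (fun a₂ d₂ =>
      fconv (fun m' => f a₁ a₂ m') (fun m' => g d₁ d₂ m') m) σ₂) σ₁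
      = fourierConst * bil k₁ k₂ unitMeasure unitMeasure convKer convKer f g σ₁ σ₂ m := by
  rcases eq_or_ne σ₁ 0 with rfl | hσ₁
  · rw [bil_eq_zero_left hg hc₁ H₁ H₂ h₁ h₂, zero_pow (by omega)]
    ring
  rcases eq_or_ne σ₂ 0 with rfl | hσ₂
  · rw [bil_eq_zero_right hg hc₂ H₁ H₂ h₁ h₂, zero_pow (by omega)]
    ring
  rw [bil_eq_iterated H₁ H₂ hE0 hE1 hEc hEi hf hg h₁ h₂, mul_right_comm, pow_mul_convol _ _ hσ₁,
    ← integral_const_mul, ← integral_mul_const]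
  refine integral_congr_ae (.of_forall fun u₁ => ?_)
  simp only
  rw [mul_assoc, mul_comm (convol _ _ _), pow_mul_convol _ _ hσ₂, mul_left_comm,
    ← integral_const_mul fourierConst]
  congr 1
  refine integral_congr_ae (.of_forall fun u₂ => ?_)
  simp only [fconv, fourierConst]
  ring

theorem convol_left_eq (hE0 : ∀ m, 0 ≤ E m) (hE1 : ∀ m, E m ≤ 1)
    (hEc : Continuous E) (hEi : Integrable E) (hc₁ : c₁ 0 = 0)
    (H₁ : ConvKernel k₁ b₁ c₁ unitMeasure convKer C₁)
    (H₂ : ConvKernel k₂ b₂ c₂ (Measure.dirac 1) (fun _ => 1) C₂) {f : ℂ → ℝ → ℂ}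
    (hf : Mem D₁ D₂ b₁ b₂ E N (fun τ₁ _ m => f τ₁ m)) (hg : Mem D₁ D₂ c₁ c₂ E N' g) (hk₁ : 1 ≤ k₁)
    (h₁ : σ₁ ∈ D₁.Ω) (h₂ : σ₂ ∈ D₂.Ω) (m : ℝ) :
    σ₁ ^ k₁ * convol k₁ (fun a₁ d₁ =>
      fconv (f a₁) (fun m' => g d₁ σ₂ m') m) σ₁
      = fourierConst * bil k₁ k₂ unitMeasure (Measure.dirac 1) convKer (fun _ => 1)
        (fun τ₁ _ m => f τ₁ m) g σ₁ σ₂ m := by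
  rcases eq_or_ne σ₁ 0 with rfl | hσ₁
  · rw [bil_eq_zero_left hg hc₁ H₁ H₂ h₁ h₂, zero_pow (by omega)]
    ring
  rw [bil_eq_iterated H₁ H₂ hE0 hE1 hEc hEi hf hg h₁ h₂, pow_mul_convol _ _ hσ₁,
    ← integral_const_mul]
  refine integral_congr_ae (.of_forall fun u₁ => ?_)
  simp only [integral_dirac, rt_one, one_mul, Complex.ofReal_one, fconv, fourierConst]
  ring

theorem convol_right_eq (hE0 : ∀ m, 0 ≤ E m) (hE1 : ∀ m, E m ≤ 1)
    (hEc : Continuous E) (hEi : Integrable E) (hc₂ : c₂ 0 = 0)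
    (H₁ : ConvKernel k₁ b₁ c₁ (Measure.dirac 1) (fun _ => 1) C₁)
    (H₂ : ConvKernel k₂ b₂ c₂ unitMeasure convKer C₂) {f : ℂ → ℝ → ℂ}
    (hf : Mem D₁ D₂ b₁ b₂ E N (fun _ τ₂ m => f τ₂ m)) (hg : Mem D₁ D₂ c₁ c₂ E N' g) (hk₂ : 1 ≤ k₂)
    (h₁ : σ₁ ∈ D₁.Ω) (h₂ : σ₂ ∈ D₂.Ω) (m : ℝ) :
    σ₂ ^ k₂ * convol k₂ (fun a₂ d₂ =>
      fconv (f a₂) (fun m' => g σ₁ d₂ m') m) σ₂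
      = fourierConst * bil k₁ k₂ (Measure.dirac 1) unitMeasure (fun _ => 1) convKer
        (fun _ τ₂ m => f τ₂ m) g σ₁ σ₂ m := by
  rcases eq_or_ne σ₂ 0 with rfl | hσ₂
  · rw [bil_eq_zero_right hg hc₂ H₁ H₂ h₁ h₂, zero_pow (by omega)]
    ring
  rw [bil_eq_iterated H₁ H₂ hE0 hE1 hEc hEi hf hg h₁ h₂, pow_mul_convol _ _ hσ₂,
    integral_dirac, ← integral_const_mul]
  simp only [rt_one, one_mul, Complex.ofReal_one]
  rw [← integral_const_mul]
  refine integral_congr_ae (.of_forall fun u₁ => ?_)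
  simp only [fconv, fourierConst]
  ring

theorem fconv_eq (hE0 : ∀ m, 0 ≤ E m) (hE1 : ∀ m, E m ≤ 1)
    (hEc : Continuous E) (hEi : Integrable E)
    (H₁ : ConvKernel k₁ b₁ c₁ (Measure.dirac 1) (fun _ => 1) C₁)
    (H₂ : ConvKernel k₂ b₂ c₂ (Measure.dirac 1) (fun _ => 1) C₂) {f : ℝ → ℂ}
    (hf : Mem D₁ D₂ b₁ b₂ E N (fun _ _ m => f m)) (hg : Mem D₁ D₂ c₁ c₂ E N' g)
    (h₁ : σ₁ ∈ D₁.Ω) (h₂ : σ₂ ∈ D₂.Ω) (m : ℝ) :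
    fconv f (fun m' => g σ₁ σ₂ m') m
      = fourierConst * bil k₁ k₂ (Measure.dirac 1) (Measure.dirac 1) (fun _ => 1) (fun _ => 1)
        (fun _ _ m => f m) g σ₁ σ₂ m := by
  rw [bil_eq_iterated H₁ H₂ hE0 hE1 hEc hEi hf hg h₁ h₂]
  simp only [integral_dirac, rt_one, one_mul, Complex.ofReal_one, fconv, fourierConst]

end convolution

/-! ### Bounds for the operators of the equation -/

theorem charPoly_ne_zero {k δ : ℕ} {Q R : ℂ[X]} {CP r : ℝ} {Ω : Set ℂ} (hCP : 0 < CP) (hr : 0 < r)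
    (hR : ∀ m, ev R m ≠ 0) (hP : CharPolyBound k δ Q R CP r Ω) {τ : ℂ} (hτ : τ ∈ Ω) (m : ℝ) :
    charPoly k δ Q R m τ ≠ 0 := by
  have h1 := hP τ hτ m
  have h2 : 0 < ‖ev R m‖ := norm_pos_iff.2 (hR m)
  rw [← norm_pos_iff]
  refine lt_of_lt_of_le ?_ h1
  positivity

/-- The lower bound for the characteristic polynomial without its factor `|R(im)|(1+|τ|^k)^θ`. -/
def lowConst (k δ : ℕ) (CP r : ℝ) : ℝ := CP * r ^ (1 / (((δ : ℝ) - 1) * k))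

theorem lowConst_pos {k δ : ℕ} {CP r : ℝ} (hCP : 0 < CP) (hr : 0 < r) : 0 < lowConst k δ CP r := by
  unfold lowConst; positivity

/-- A function assigning to each exponent `a > 0` a constant for which the conclusion of
`exists_kernel_bound` holds. -/
def KernelConst (ν : ℝ) (k : ℕ) (C : ℝ → ℝ) : Prop := ∀ a : ℝ, 0 < a → 0 < C a ∧
  ∀ (p : ℕ) (x : ℝ), 0 ≤ x →
      IntegrableOn (fun t => (1 - t) ^ (a - 1) * t ^ p / t * wt ν k (t ^ (1 / (k : ℝ)) * x))
        (Ioc 0 1) ∧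
      ∫ t in Ioc (0 : ℝ) 1, (1 - t) ^ (a - 1) * t ^ p / t * wt ν k (t ^ (1 / (k : ℝ)) * x)
        ≤ C a * (1 + x ^ k) ^ (-a) * wt ν k x

theorem exists_kernelConst {ν : ℝ} (hν : 0 < ν) {k : ℕ} (hk : 1 ≤ k) : ∃ C, KernelConst ν k C := by
  choose! C hC using fun (a : ℝ) (ha : 0 < a) => exists_kernel_bound hν hk ha
  exact ⟨C, hC⟩

section operators

variable {ν : ℝ} {k δ : ℕ} {Q R : ℂ[X]} {CP r : ℝ} {ε : ℂ} {b₂ : ℂ → ℝ} {E : ℝ → ℝ} {C : ℝ → ℝ}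

theorem linOp_opK (hν : 0 < ν) (hk : 1 ≤ k) (hCP : 0 < CP) (hr : 0 < r) (hR : ∀ m, ev R m ≠ 0)
    (hP : CharPolyBound k δ Q R CP r D₁.Ω) (hε : ε ≠ 0) (hC : KernelConst ν k C)
    (hb₂ : ∀ τ, 0 ≤ b₂ τ) (hb₂c : Continuous b₂) (hE0 : ∀ m, 0 ≤ E m) (hE1 : ∀ m, E m ≤ 1)
    {n q : ℕ} (hn : 1 ≤ n) {M : ℝ}
    (hM : ∀ x : ℝ, 0 ≤ x → (‖ε‖ * x) ^ (n + k * q - k) * (1 + x ^ k) ^ (-((n : ℝ) / k))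
      ≤ M * (1 + (‖ε‖ * x) ^ k) ^ (((δ : ℝ) - 1) - 1 / (k : ℝ))) :
    LinOp D₁ D₂ (Wt ν k ε) b₂ E E (C ((n : ℝ) / k) * (M / lowConst k δ CP r))
      (opK k δ Q R n q) := by
  have hk0 : (0 : ℝ) < k := by exact_mod_cast hk
  have hn0 : (0 : ℝ) < n := by exact_mod_cast hn
  have ha : 0 < (n : ℝ) / k := by positivity
  have hl := lowConst_pos (k := k) (δ := δ) hCP hr
  have hM0 : 0 ≤ M := by
    have := hM 0 le_rfl
    rw [mul_zero, zero_pow (show k ≠ 0 by omega)] at this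
    simp only [add_zero, Real.one_rpow, mul_one] at this
    exact le_trans (by positivity) this
  have hne : ∀ τ ∈ D₁.Ω, ∀ m, charPoly k δ Q R m τ ≠ 0 := fun τ hτ m =>
    charPoly_ne_zero hCP hr hR hP hτ m
  have hRc := continuous_ev R
  have hQc := continuous_ev Q
  refine linOp_volT hν hk ha (hC _ ha).1 (hC _ ha).2 q ?_ ?_ (by positivity) ?_ hb₂ hb₂c hE0 hE1
  · refine ContinuousOn.div (by fun_prop) ?_ fun p hp => hne _ hp.1 _
    unfold charPoly
    fun_prop
  · intro m
    refine DifferentiableOn.div (by fun_prop) ?_ fun τ hτ => hne _ (D₁.sub hτ) _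
    unfold charPoly
    fun_prop
  · intro τ hτ m
    have h1 := hP τ hτ m
    have h2 : 0 < ‖ev R m‖ := norm_pos_iff.2 (hR m)
    have h3 : 0 < ‖charPoly k δ Q R m τ‖ := norm_pos_iff.2 (hne τ hτ m)
    have h4 := hM ‖τ / ε‖ (norm_nonneg _)
    have h5 : ‖ε‖ * ‖τ / ε‖ = ‖τ‖ := by
      rw [← norm_mul, mul_div_cancel₀ _ hε]
    rw [h5] at h4
    rw [norm_div, norm_mul, norm_pow, div_mul_eq_mul_div, div_le_div_iff₀ h3 hl]
    change lowConst k δ CP r * _ * _ ≤ _ at h1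
    calc ‖ev R m‖ * ‖τ‖ ^ (n + k * q - k) * (1 + ‖τ / ε‖ ^ k) ^ (-((n : ℝ) / k))
          * lowConst k δ CP r
        = (‖ev R m‖ * lowConst k δ CP r)
          * (‖τ‖ ^ (n + k * q - k) * (1 + ‖τ / ε‖ ^ k) ^ (-((n : ℝ) / k))) := by ring
      _ ≤ (‖ev R m‖ * lowConst k δ CP r)
          * (M * (1 + ‖τ‖ ^ k) ^ (((δ : ℝ) - 1) - 1 / (k : ℝ))) := by gcongr
      _ = M * (lowConst k δ CP r * ‖ev R m‖
          * (1 + ‖τ‖ ^ k) ^ (((δ : ℝ) - 1) - 1 / (k : ℝ))) := by ring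
      _ ≤ _ := by gcongr

theorem pow_mul_rpow_neg_le (hk : 1 ≤ k) (n : ℕ) {x : ℝ} (hx : 0 ≤ x) :
    x ^ n * (1 + x ^ k) ^ (-((n : ℝ) / k)) ≤ 1 := by
  have hk0 : (0 : ℝ) < k := by exact_mod_cast hk
  rw [Real.rpow_neg (by positivity), ← div_eq_mul_inv, div_le_one (by positivity)]
  calc x ^ n = (x ^ k) ^ ((n : ℝ) / k) := by
        rw [← Real.rpow_natCast x k, ← Real.rpow_mul hx, mul_div_cancel₀ _ hk0.ne',
          Real.rpow_natCast]
    _ ≤ _ := Real.rpow_le_rpow (by positivity) (by linarith) (by positivity)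

/-- The Volterra operator with `s^q` in its kernel, `q ≥ 1`, is of size `|ε|^n`: the growth of
order `q - 1` in `τ^k` is absorbed by the characteristic polynomial. -/
theorem linOp_opK_of_pos (hν : 0 < ν) (hk : 1 ≤ k) (hCP : 0 < CP) (hr : 0 < r)
    (hR : ∀ m, ev R m ≠ 0)
    (hP : CharPolyBound k δ Q R CP r D₁.Ω) (hε : ε ≠ 0) (hC : KernelConst ν k C)
    (hb₂ : ∀ τ, 0 ≤ b₂ τ) (hb₂c : Continuous b₂) (hE0 : ∀ m, 0 ≤ E m) (hE1 : ∀ m, E m ≤ 1)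
    {n q : ℕ} (hn : 1 ≤ n) (hq : 1 ≤ q) (hqδ : (q : ℝ) + 1 / k ≤ δ) :
    LinOp D₁ D₂ (Wt ν k ε) b₂ E E (C ((n : ℝ) / k) * (‖ε‖ ^ n / lowConst k δ CP r))
      (opK k δ Q R n q) := by
  refine linOp_opK hν hk hCP hr hR hP hε hC hb₂ hb₂c hE0 hE1 hn fun x hx => ?_
  obtain ⟨j, rfl⟩ : ∃ j, q = j + 1 := ⟨q - 1, by omega⟩
  have e : n + k * (j + 1) - k = n + k * j := by rw [mul_add, mul_one]; omega
  push_cast at hqδ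
  have h1 : (‖ε‖ * x) ^ (k * j) ≤ (1 + (‖ε‖ * x) ^ k) ^ (((δ : ℝ) - 1) - 1 / (k : ℝ)) := by
    have hy : 0 ≤ (‖ε‖ * x) ^ k := by positivity
    calc (‖ε‖ * x) ^ (k * j) = ((‖ε‖ * x) ^ k) ^ j := pow_mul _ _ _
      _ ≤ (1 + (‖ε‖ * x) ^ k) ^ j := by gcongr; linarith
      _ = (1 + (‖ε‖ * x) ^ k) ^ (j : ℝ) := (Real.rpow_natCast _ _).symm
      _ ≤ _ := Real.rpow_le_rpow_of_exponent_le (by linarith) (by linarith)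
  have h2 := pow_mul_rpow_neg_le hk n hx
  have h3 : 0 ≤ x ^ n * (1 + x ^ k) ^ (-((n : ℝ) / k)) := by positivity
  rw [e, pow_add]
  calc (‖ε‖ * x) ^ n * (‖ε‖ * x) ^ (k * j) * (1 + x ^ k) ^ (-((n : ℝ) / k))
      = ‖ε‖ ^ n * (‖ε‖ * x) ^ (k * j) * (x ^ n * (1 + x ^ k) ^ (-((n : ℝ) / k))) := by
        rw [mul_pow _ _ n]; ring
    _ ≤ ‖ε‖ ^ n * (‖ε‖ * x) ^ (k * j) * 1 := by gcongr
    _ ≤ _ := by rw [mul_one]; gcongr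

/-- The Volterra operator of the convolution terms compensates a factor `ε^{-1}`. -/
theorem linOp_opK_succ (hν : 0 < ν) (hk : 1 ≤ k) (hCP : 0 < CP) (hr : 0 < r)
    (hR : ∀ m, ev R m ≠ 0)
    (hP : CharPolyBound k δ Q R CP r D₁.Ω) (hε : ε ≠ 0) (hC : KernelConst ν k C)
    (hb₂ : ∀ τ, 0 ≤ b₂ τ) (hb₂c : Continuous b₂) (hE0 : ∀ m, 0 ≤ E m) (hE1 : ∀ m, E m ≤ 1)
    (hδ : (1 : ℝ) + 1 / k ≤ δ) :
    LinOp D₁ D₂ (Wt ν k ε) b₂ E E (C (((k + 1 : ℕ) : ℝ) / k) * (‖ε‖ / lowConst k δ CP r))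
      (opK k δ Q R (k + 1) 0) := by
  refine linOp_opK hν hk hCP hr hR hP hε hC hb₂ hb₂c hE0 hE1 (by omega) fun x hx => ?_
  have hk0 : (0 : ℝ) < k := by exact_mod_cast hk
  have e : k + 1 + k * 0 - k = 1 := by omega
  have h1 : (1 : ℝ) ≤ (1 + (‖ε‖ * x) ^ k) ^ (((δ : ℝ) - 1) - 1 / (k : ℝ)) :=
    Real.one_le_rpow (by have : 0 ≤ (‖ε‖ * x) ^ k := by positivity
                         linarith) (by linarith)
  have hX : 0 ≤ x ^ k := by positivity
  have h2 : x * (1 + x ^ k) ^ (-(((k + 1 : ℕ) : ℝ) / k)) ≤ 1 := by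
    refine le_trans ?_ (pow_mul_rpow_neg_le hk 1 hx)
    rw [pow_one]
    gcongr
    · linarith
    · omega
  rw [e, pow_one]
  calc ‖ε‖ * x * (1 + x ^ k) ^ (-(((k + 1 : ℕ) : ℝ) / k))
      = ‖ε‖ * (x * (1 + x ^ k) ^ (-(((k + 1 : ℕ) : ℝ) / k))) := by ring
    _ ≤ ‖ε‖ * 1 := by gcongr
    _ ≤ _ := by gcongr

/-- The coefficient of `|ε|` in the bound of `opA`. -/
def constA (k δ : ℕ) (CP r : ℝ) (C : ℝ → ℝ) : ℝ :=
  ∑ p ∈ Finset.Icc 1 (δ - 1),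
    ‖(irregCoeff k δ p : ℂ) * (k : ℂ) ^ p / (Real.Gamma ((δ - p : ℕ) : ℝ) : ℂ)‖
      * (C (((k * (δ - p) : ℕ) : ℝ) / k) / lowConst k δ CP r)

theorem constA_nonneg (hk : 1 ≤ k) (hCP : 0 < CP) (hr : 0 < r) (hC : KernelConst ν k C) :
    0 ≤ constA k δ CP r C := by
  have hk0 : (0 : ℝ) < k := by exact_mod_cast hk
  refine Finset.sum_nonneg fun p hp => mul_nonneg (norm_nonneg _) (div_nonneg ?_
    (lowConst_pos hCP hr).le)
  have hp' := Finset.mem_Icc.1 hp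
  have : 1 ≤ k * (δ - p) := Nat.one_le_iff_ne_zero.2 (Nat.mul_ne_zero (by omega) (by omega))
  have : (0 : ℝ) < ((k * (δ - p) : ℕ) : ℝ) := by exact_mod_cast this
  exact (hC _ (by positivity)).1.le

theorem LinOp.const_mul {E E' : ℝ → ℝ} {b₁ : ℂ → ℝ} {K : ℝ}
    {A : (ℂ → ℂ → ℝ → ℂ) → ℂ → ℂ → ℝ → ℂ} (hb₁ : ∀ τ, 0 ≤ b₁ τ) (hb₂ : ∀ τ, 0 ≤ b₂ τ)
    (hA : LinOp D₁ D₂ b₁ b₂ E E' K A) (c : ℂ) :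
    LinOp D₁ D₂ b₁ b₂ E E' (‖c‖ * K) (fun h τ₁ τ₂ m => c * A h τ₁ τ₂ m) :=
  (LinOp.mulm hb₁ hb₂ (ρ := fun _ => c) continuous_const (norm_nonneg c) fun _ => le_rfl).comp hA

theorem linOp_opA (hν : 0 < ν) (hk : 1 ≤ k) (hCP : 0 < CP) (hr : 0 < r) (hR : ∀ m, ev R m ≠ 0)
    (hP : CharPolyBound k δ Q R CP r D₁.Ω) (hε : ε ≠ 0) (hε1 : ‖ε‖ ≤ 1) (hC : KernelConst ν k C)
    (hb₂ : ∀ τ, 0 ≤ b₂ τ) (hb₂c : Continuous b₂) (hE0 : ∀ m, 0 ≤ E m) (hE1 : ∀ m, E m ≤ 1) :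
    LinOp D₁ D₂ (Wt ν k ε) b₂ E E (constA k δ CP r C * ‖ε‖) (opA k δ Q R) := by
  have hk0 : (0 : ℝ) < k := by exact_mod_cast hk
  have hk1 : (1 : ℝ) ≤ k := by exact_mod_cast hk
  rw [constA, Finset.sum_mul]
  refine LinOp.sum _ fun p hp => ?_
  have hp' := Finset.mem_Icc.1 hp
  have hn : 1 ≤ k * (δ - p) := Nat.one_le_iff_ne_zero.2 (Nat.mul_ne_zero (by omega) (by omega))
  have hn' : (0 : ℝ) < ((k * (δ - p) : ℕ) : ℝ) := by exact_mod_cast hn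
  have hqδ : (p : ℝ) + 1 / k ≤ δ := by
    have h1 : p + 1 ≤ δ := by omega
    have h2 : (p : ℝ) + 1 ≤ δ := by exact_mod_cast h1
    have h3 : 1 / (k : ℝ) ≤ 1 := by rw [div_le_one hk0]; exact hk1
    linarith
  have h1 := linOp_opK_of_pos (Q := Q) (D₂ := D₂) hν hk hCP hr hR hP hε hC hb₂ hb₂c hE0 hE1 hn
    hp'.1 hqδ
  refine (h1.const_mul Wt_nonneg hb₂ _).mono Wt_nonneg hb₂ hE0 ?_
  rw [mul_assoc]
  have hC0 := (hC (((k * (δ - p) : ℕ) : ℝ) / k) (by positivity)).1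
  have hl := lowConst_pos (k := k) (δ := δ) hCP hr
  have h4 : ‖ε‖ ^ (k * (δ - p)) ≤ ‖ε‖ := pow_le_of_le_one (norm_nonneg _) hε1 (by omega)
  rw [← mul_div_assoc, div_mul_eq_mul_div]
  gcongr

end operators

/-! ### Small quadratic perturbations -/

section quadratic

variable {b₁ b₂ : ℂ → ℝ} {E : ℝ → ℝ} {ϖ KL KB : ℝ}
  {L : (ℂ → ℂ → ℝ → ℂ) → ℂ → ℂ → ℝ → ℂ}
  {B : (ℂ → ℂ → ℝ → ℂ) → (ℂ → ℂ → ℝ → ℂ) → ℂ → ℂ → ℝ → ℂ} {c : ℂ → ℂ → ℝ → ℂ}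

theorem mem_quadratic (hb₁ : ∀ τ, 0 ≤ b₁ τ) (hb₂ : ∀ τ, 0 ≤ b₂ τ) (hE0 : ∀ m, 0 ≤ E m)
    (hL : LinOp D₁ D₂ b₁ b₂ E E KL L)
    (hB : ∀ {f N}, Mem D₁ D₂ b₁ b₂ E N f → LinOp D₁ D₂ b₁ b₂ E E (KB * N) (B f))
    (hc : Mem D₁ D₂ b₁ b₂ E (ϖ / 4) c) (hKL : KL ≤ 1 / 4) (hKB : KB * ϖ ≤ 1 / 8)
    {h : ℂ → ℂ → ℝ → ℂ} (hh : Mem D₁ D₂ b₁ b₂ E ϖ h) :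
    Mem D₁ D₂ b₁ b₂ E ϖ (L h + B h h + c) := by
  refine (((hL.mem hh).add ((hB hh).mem hh)).add hc).mono hb₁ hb₂ hE0 ?_
  nlinarith [hh.nonneg]

theorem contraction_quadratic (hb₁ : ∀ τ, 0 ≤ b₁ τ) (hb₂ : ∀ τ, 0 ≤ b₂ τ) (hE0 : ∀ m, 0 ≤ E m)
    (hL : LinOp D₁ D₂ b₁ b₂ E E KL L)
    (hB : ∀ {f N}, Mem D₁ D₂ b₁ b₂ E N f → LinOp D₁ D₂ b₁ b₂ E E (KB * N) (B f))
    (hB' : ∀ {g N}, Mem D₁ D₂ b₁ b₂ E N g → LinOp D₁ D₂ b₁ b₂ E E (KB * N) (fun f => B f g))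
    (hc : Mem D₁ D₂ b₁ b₂ E (ϖ / 4) c) (hKL : KL ≤ 1 / 4) (hKB : KB * ϖ ≤ 1 / 8)
    {h h' : ℂ → ℂ → ℝ → ℂ} {N : ℝ} (hh : Mem D₁ D₂ b₁ b₂ E ϖ h) (hh' : Mem D₁ D₂ b₁ b₂ E ϖ h')
    (hd : Mem D₁ D₂ b₁ b₂ E N (h - h')) :
    Mem D₁ D₂ b₁ b₂ E (N / 2) (L h + B h h + c - (L h' + B h' h' + c)) := by
  have e := (((hL.mem hd).add ((hB hh).mem hd)).add ((hB' hh').mem hd)).mono (N' := N / 2)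
    hb₁ hb₂ hE0 (by nlinarith [hd.nonneg])
  refine ⟨(mem_quadratic hb₁ hb₂ hE0 hL hB hc hKL hKB hh).toReg.sub
    (mem_quadratic hb₁ hb₂ hE0 hL hB hc hKL hKB hh').toReg, e.nonneg, fun τ₁ h₁ τ₂ h₂ m => ?_⟩
  refine le_of_eq_of_le (congrArg _ ?_) (e.bd τ₁ h₁ τ₂ h₂ m)
  simp only [Pi.add_apply, Pi.sub_apply, hL.sub hh hh' _ h₁ _ h₂, (hB hh).sub hh hh' _ h₁ _ h₂,
    (hB' hh').sub hh hh' _ h₁ _ h₂]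
  ring

end quadratic

/-! ### The fixed point map -/

/-- The numerical constants of the estimates, which depend only on the parameters of the problem,
and the properties of the parameters that the estimates use. -/
structure Bounds (S : Params) (e₀ μ ν₁ ν₂ CP r₁ r₂ : ℝ) where
  k₁_pos : 1 ≤ S.k₁
  k₂_pos : 1 ≤ S.k₂
  ν₁_pos : 0 < ν₁
  ν₂_pos : 0 < ν₂
  CP_pos : 0 < CP
  r₁_pos : 0 < r₁
  r₂_pos : 0 < r₂
  RD₁_ne : ∀ m, ev S.RD₁ m ≠ 0
  RD₂_ne : ∀ m, ev S.RD₂ m ≠ 0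
  le_δ₁ : (1 : ℝ) + 1 / S.k₁ ≤ S.δ S.D₁
  le_δ₂ : (1 : ℝ) + 1 / S.k₂ ≤ S.δ' S.D₂
  /-- A common bound for the degrees of `P₁(·,ε)`, `P₂(·,ε)` and `R₀`. -/
  N : ℕ
  N_lt : (N : ℝ) + 1 < μ
  /-- The constants of the Volterra operators in the first variable. -/
  C₁ : ℝ → ℝ
  /-- The constants of the Volterra operators in the second variable. -/
  C₂ : ℝ → ℝ
  kernel₁ : KernelConst ν₁ S.k₁ C₁
  kernel₂ : KernelConst ν₂ S.k₂ C₂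
  /-- The constant of the convolution in the first variable. -/
  c₁ : ℝ
  /-- The constant of the convolution in the second variable. -/
  c₂ : ℝ
  /-- The constant of the convolution in the Fourier variable. -/
  c₃ : ℝ
  conv₁ : ∀ ε, ConvKernel S.k₁ (Wt ν₁ S.k₁ ε) (Wt ν₁ S.k₁ ε) unitMeasure convKer c₁
  conv₂ : ∀ ε, ConvKernel S.k₂ (Wt ν₂ S.k₂ ε) (Wt ν₂ S.k₂ ε) unitMeasure convKer c₂
  c₃_nonneg : 0 ≤ c₃
  conv₃ : ∀ β : ℝ, 0 ≤ β → ∀ m : ℝ,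
    ∫ x : ℝ, Ew β (μ - N) (m - x) * Ew β (μ - N) x ≤ c₃ * Ew β (μ - N) m
  /-- The constant of the lower bound for `R_{D₁} R_{D₂}` on the imaginary axis. -/
  Cρ : ℝ
  Cρ_pos : 0 < Cρ
  le_RD : ∀ m, (1 + |m|) ^ N ≤ Cρ * ‖ev S.RD₁ m * ev S.RD₂ m‖
  /-- A common bound for the growth of `P₁(·,ε)`, `P₂(·,ε)` and `R₀` on the imaginary axis. -/
  M : ℝ
  M_pos : 0 < M
  P₁_le : ∀ ε ∈ Metric.closedBall (0 : ℂ) e₀, ∀ m, ‖ev (S.P₁ ε) m‖ ≤ M * (1 + |m|) ^ N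
  P₂_le : ∀ ε ∈ Metric.closedBall (0 : ℂ) e₀, ∀ m, ‖ev (S.P₂ ε) m‖ ≤ M * (1 + |m|) ^ N
  R₀_le : ∀ m, ‖ev S.R₀ m‖ ≤ M * (1 + |m|) ^ N
  /-- Bounds for the quotients of `R_{l₁,l₂}` by `R_{D₁} R_{D₂}`. -/
  CR : ℕ → ℕ → ℝ
  CR_nonneg : ∀ l₁ l₂, 0 ≤ CR l₁ l₂
  R_le : ∀ l₁ ∈ Finset.Icc 1 (S.D₁ - 1), ∀ l₂ ∈ Finset.Icc 1 (S.D₂ - 1), ∀ m,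
    ‖ev (S.R l₁ l₂) m‖ ≤ CR l₁ l₂ * ‖ev S.RD₁ m * ev S.RD₂ m‖
  one_le_dk₁ : ∀ l ∈ Finset.Icc 1 (S.D₁ - 1), 1 ≤ dk S.k₁ (S.δ l) (S.d l)
  one_le_dk₂ : ∀ l ∈ Finset.Icc 1 (S.D₂ - 1), 1 ≤ dk S.k₂ (S.δ' l) (S.d' l)
  one_le_δ₁ : ∀ l ∈ Finset.Icc 1 (S.D₁ - 1), 1 ≤ S.δ l
  one_le_δ₂ : ∀ l ∈ Finset.Icc 1 (S.D₂ - 1), 1 ≤ S.δ' l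
  δ_le₁ : ∀ l ∈ Finset.Icc 1 (S.D₁ - 1), (S.δ l : ℝ) + 1 / S.k₁ ≤ S.δ S.D₁
  δ_le₂ : ∀ l ∈ Finset.Icc 1 (S.D₂ - 1), (S.δ' l : ℝ) + 1 / S.k₂ ≤ S.δ' S.D₂
  one_le_exp : ∀ l₁ ∈ Finset.Icc 1 (S.D₁ - 1), ∀ l₂ ∈ Finset.Icc 1 (S.D₂ - 1),
    (1 : ℤ) ≤ ((S.Δ l₁ l₂ : ℤ) - S.d l₁ - S.d' l₂ + S.δ l₁ + S.δ' l₂ - 2)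
      + dk S.k₁ (S.δ l₁) (S.d l₁) + dk S.k₂ (S.δ' l₂) (S.d' l₂)

/-- The conditions on the domains, on `β` and on `ε` under which the estimates hold. -/
structure Admissible (S : Params) (e₀ CP r₁ r₂ : ℝ) (D₁ D₂ : Dom) (β : ℝ) (ε : ℂ) : Prop where
  β_nonneg : 0 ≤ β
  ne_zero : ε ≠ 0
  norm_le_one : ‖ε‖ ≤ 1
  mem_ball : ε ∈ Metric.closedBall (0 : ℂ) e₀
  bound₁ : CharPolyBound S.k₁ (S.δ S.D₁) S.Q₁ S.RD₁ CP r₁ D₁.Ω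
  bound₂ : CharPolyBound S.k₂ (S.δ' S.D₂) S.Q₂ S.RD₂ CP r₂ D₂.Ω

namespace Params

variable (S : Params)

/-- The product of the symbols of the two variables. -/
def symbols (m : ℝ) (τ₁ τ₂ : ℂ) : ℂ :=
  symb S.k₁ (S.δ S.D₁) S.Q₁ S.RD₁ m τ₁ * symb S.k₂ (S.δ' S.D₂) S.Q₂ S.RD₂ m τ₂

/-- Normalized Volterra operators in both variables. -/
def opKK (n₁ q₁ n₂ q₂ : ℕ) (h : ℂ → ℂ → ℝ → ℂ) : ℂ → ℂ → ℝ → ℂ :=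
  opK S.k₁ (S.δ S.D₁) S.Q₁ S.RD₁ n₁ q₁ (swapOp (opK S.k₂ (S.δ' S.D₂) S.Q₂ S.RD₂ n₂ q₂) h)

/-- The operator `ε⁻² 𝒱` of the equation, divided by the symbols. -/
def opV (ε : ℂ) (h : ℂ → ℂ → ℝ → ℂ) : ℂ → ℂ → ℝ → ℂ := fun τ₁ τ₂ m =>
  (ev S.RD₁ m * ev S.RD₂ m)⁻¹ *
    ((ε ^ (-2 : ℤ) * ((Real.Gamma (((S.k₁ + 1 : ℕ) : ℝ) / S.k₁) : ℂ)
        * (Real.Gamma (((S.k₂ + 1 : ℕ) : ℝ) / S.k₂) : ℂ))⁻¹)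
      * S.opKK (S.k₁ + 1) 0 (S.k₂ + 1) 0 h τ₁ τ₂ m)

/-- The coefficient of the term of index `(l₁,l₂)`, without its power of `ε`. -/
def lowerCoeff (l₁ l₂ : ℕ) : ℂ :=
  (S.k₁ : ℂ) ^ S.δ l₁ * (S.k₂ : ℂ) ^ S.δ' l₂
    * ((Real.Gamma ((dk S.k₁ (S.δ l₁) (S.d l₁) : ℝ) / S.k₁) : ℂ)
        * (Real.Gamma ((dk S.k₂ (S.δ' l₂) (S.d' l₂) : ℝ) / S.k₂) : ℂ))⁻¹

/-- The term of index `(l₁,l₂)` of the equation, divided by the symbols. -/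
def opR (ε : ℂ) (l₁ l₂ : ℕ) (h : ℂ → ℂ → ℝ → ℂ) : ℂ → ℂ → ℝ → ℂ := fun τ₁ τ₂ m =>
  (ev (S.R l₁ l₂) m * (ev S.RD₁ m * ev S.RD₂ m)⁻¹) *
    ((ε ^ ((S.Δ l₁ l₂ : ℤ) - S.d l₁ - S.d' l₂ + S.δ l₁ + S.δ' l₂ - 2) * S.lowerCoeff l₁ l₂)
      * S.opKK (dk S.k₁ (S.δ l₁) (S.d l₁)) (S.δ l₁) (dk S.k₂ (S.δ' l₂) (S.d' l₂)) (S.δ' l₂)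
          h τ₁ τ₂ m)

/-- Convolution of `f` with `p(im) h`, with the normalization of the Fourier convolution. -/
def opConv (μ₁ μ₂ : Measure ℝ) (κ₁ κ₂ : ℝ → ℝ) (p : ℂ[X]) (f h : ℂ → ℂ → ℝ → ℂ) :
    ℂ → ℂ → ℝ → ℂ := fun τ₁ τ₂ m =>
  fourierConst * bil S.k₁ S.k₂ μ₁ μ₂ κ₁ κ₂ f (fun τ₁ τ₂ m => ev p m * h τ₁ τ₂ m) τ₁ τ₂ m

/-- The linear part of the fixed point map, without the terms in `φ, φ¹, φ², C₀₀`. -/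
def linPart (ε : ℂ) (ω : ℂ → ℂ → ℝ → ℂ) : ℂ → ℂ → ℝ → ℂ :=
  swapOp (opA S.k₂ (S.δ' S.D₂) S.Q₂ S.RD₂) ω + opA S.k₁ (S.δ S.D₁) S.Q₁ S.RD₁ ω
    + (fun τ₁ τ₂ m => (-1) * opA S.k₁ (S.δ S.D₁) S.Q₁ S.RD₁
        (swapOp (opA S.k₂ (S.δ' S.D₂) S.Q₂ S.RD₂) ω) τ₁ τ₂ m)
    + ∑ l₁ ∈ Finset.Icc 1 (S.D₁ - 1), ∑ l₂ ∈ Finset.Icc 1 (S.D₂ - 1), S.opR ε l₁ l₂ ω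

/-- The terms of the fixed point map in `φ, φ¹, φ², C₀₀`. -/
def dataPart (ε : ℂ) (φ : ℂ → ℂ → ℝ → ℂ) (φ₁ φ₂ : ℂ → ℝ → ℂ) (C₀₀ : ℝ → ℂ)
    (ω : ℂ → ℂ → ℝ → ℂ) : ℂ → ℂ → ℝ → ℂ :=
  S.opV ε (S.opConv unitMeasure unitMeasure convKer convKer S.R₀ φ ω)
    + S.opV ε (S.opConv unitMeasure (Measure.dirac 1) convKer (fun _ => 1) S.R₀
        (fun τ₁ _ m => φ₁ τ₁ m) ω)
    + S.opV ε (S.opConv (Measure.dirac 1) unitMeasure (fun _ => 1) convKer S.R₀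
        (fun _ τ₂ m => φ₂ τ₂ m) ω)
    + S.opV ε (S.opConv (Measure.dirac 1) (Measure.dirac 1) (fun _ => 1) (fun _ => 1) S.R₀
        (fun _ _ m => C₀₀ m) ω)

/-- The quadratic term of the equation, divided by the symbols and polarized. -/
def quadPart (ε : ℂ) (f g : ℂ → ℂ → ℝ → ℂ) : ℂ → ℂ → ℝ → ℂ :=
  S.opV ε (S.opConv unitMeasure unitMeasure convKer convKer (S.P₂ ε)
    (fun τ₁ τ₂ m => ev (S.P₁ ε) m * f τ₁ τ₂ m) g)

end Params

section estimates

variable {S : Params} {e₀ μ ν₁ ν₂ CP r₁ r₂ β : ℝ} {ε : ℂ}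

namespace Bounds

variable (B : Bounds S e₀ μ ν₁ ν₂ CP r₁ r₂)

/-- A bound for the norm of `opV`, uniform in `ε`. -/
def kV : ℝ :=
  B.Cρ * (‖((Real.Gamma (((S.k₁ + 1 : ℕ) : ℝ) / S.k₁) : ℂ)
        * (Real.Gamma (((S.k₂ + 1 : ℕ) : ℝ) / S.k₂) : ℂ))⁻¹‖
    * (B.C₁ (((S.k₁ + 1 : ℕ) : ℝ) / S.k₁) / lowConst S.k₁ (S.δ S.D₁) CP r₁
      * (B.C₂ (((S.k₂ + 1 : ℕ) : ℝ) / S.k₂) / lowConst S.k₂ (S.δ' S.D₂) CP r₂)))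

/-- The coefficient of `|ε|` in the bound of `opR`. -/
def kR (l₁ l₂ : ℕ) : ℝ :=
  B.CR l₁ l₂ * (‖S.lowerCoeff l₁ l₂‖
    * (B.C₁ ((dk S.k₁ (S.δ l₁) (S.d l₁) : ℝ) / S.k₁) / lowConst S.k₁ (S.δ S.D₁) CP r₁
      * (B.C₂ ((dk S.k₂ (S.δ' l₂) (S.d' l₂) : ℝ) / S.k₂) / lowConst S.k₂ (S.δ' S.D₂) CP r₂)))

/-- The coefficient of `|ε|` in the bound of `linPart`. -/
def kL : ℝ :=
  constA S.k₂ (S.δ' S.D₂) CP r₂ B.C₂ + constA S.k₁ (S.δ S.D₁) CP r₁ B.C₁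
    + constA S.k₁ (S.δ S.D₁) CP r₁ B.C₁ * constA S.k₂ (S.δ' S.D₂) CP r₂ B.C₂
    + ∑ l₁ ∈ Finset.Icc 1 (S.D₁ - 1), ∑ l₂ ∈ Finset.Icc 1 (S.D₂ - 1), B.kR l₁ l₂

theorem Ew_mono (m : ℝ) : Ew β μ m ≤ Ew β (μ - B.N) m :=
    Ew_anti β (by linarith [B.N.cast_nonneg (α := ℝ)]) m

theorem pow_mul_Ew (m : ℝ) : (1 + |m|) ^ B.N * Ew β μ m = Ew β (μ - B.N) m := by
  have : 0 < 1 + |m| := by positivity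
  rw [Ew, Ew, ← mul_assoc, ← Real.rpow_natCast, ← Real.rpow_add this]
  congr 2
  ring

theorem low₁_pos (B : Bounds S e₀ μ ν₁ ν₂ CP r₁ r₂) :
    0 < lowConst S.k₁ (S.δ S.D₁) CP r₁ := lowConst_pos B.CP_pos B.r₁_pos

theorem low₂_pos (B : Bounds S e₀ μ ν₁ ν₂ CP r₁ r₂) :
    0 < lowConst S.k₂ (S.δ' S.D₂) CP r₂ := lowConst_pos B.CP_pos B.r₂_pos

theorem C₁_pos {n : ℕ} (hn : 1 ≤ n) : 0 < B.C₁ ((n : ℝ) / S.k₁) := by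
  have h1 : (0 : ℝ) < S.k₁ := by exact_mod_cast B.k₁_pos
  have h2 : (0 : ℝ) < n := by exact_mod_cast hn
  exact (B.kernel₁ _ (by positivity)).1

theorem C₂_pos {n : ℕ} (hn : 1 ≤ n) : 0 < B.C₂ ((n : ℝ) / S.k₂) := by
  have h1 : (0 : ℝ) < S.k₂ := by exact_mod_cast B.k₂_pos
  have h2 : (0 : ℝ) < n := by exact_mod_cast hn
  exact (B.kernel₂ _ (by positivity)).1

theorem kV_nonneg : 0 ≤ B.kV := by
  have h1 := B.C₁_pos (n := S.k₁ + 1) (by omega)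
  have h2 := B.C₂_pos (n := S.k₂ + 1) (by omega)
  have h3 := B.low₁_pos
  have h4 := B.low₂_pos
  have h5 := B.Cρ_pos
  unfold kV
  positivity

theorem kR_nonneg {l₁ l₂ : ℕ} (hl₁ : l₁ ∈ Finset.Icc 1 (S.D₁ - 1))
    (hl₂ : l₂ ∈ Finset.Icc 1 (S.D₂ - 1)) : 0 ≤ B.kR l₁ l₂ := by
  have h1 := B.C₁_pos (B.one_le_dk₁ _ hl₁)
  have h2 := B.C₂_pos (B.one_le_dk₂ _ hl₂)
  have h3 := B.low₁_pos
  have h4 := B.low₂_pos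
  have h5 := B.CR_nonneg l₁ l₂
  unfold kR
  positivity

theorem kL_nonneg : 0 ≤ B.kL := by
  have h1 := constA_nonneg (δ := S.δ S.D₁) B.k₁_pos B.CP_pos B.r₁_pos B.kernel₁
  have h2 := constA_nonneg (δ := S.δ' S.D₂) B.k₂_pos B.CP_pos B.r₂_pos B.kernel₂
  have h3 : 0 ≤ ∑ l₁ ∈ Finset.Icc 1 (S.D₁ - 1), ∑ l₂ ∈ Finset.Icc 1 (S.D₂ - 1), B.kR l₁ l₂ :=
    Finset.sum_nonneg fun l₁ h₁ => Finset.sum_nonneg fun l₂ h₂ => B.kR_nonneg h₁ h₂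
  unfold kL
  positivity

theorem linOp_evMul {p : ℂ[X]} (hp : ∀ m, ‖ev p m‖ ≤ B.M * (1 + |m|) ^ B.N) :
    LinOp D₁ D₂ (Wt ν₁ S.k₁ ε) (Wt ν₂ S.k₂ ε) (Ew β μ) (Ew β (μ - B.N)) B.M
      (fun h τ₁ τ₂ m => ev p m * h τ₁ τ₂ m) := by
  refine LinOp.mulm Wt_nonneg Wt_nonneg (continuous_ev p) B.M_pos.le fun m => ?_
  rw [← B.pow_mul_Ew, ← mul_assoc]
  exact mul_le_mul_of_nonneg_right (hp m) (Ew_nonneg _ _ _)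

theorem one_lt_sub : 1 < μ - B.N := by linarith [B.N_lt]

theorem μ_nonneg (B : Bounds S e₀ μ ν₁ ν₂ CP r₁ r₂) :
    0 ≤ μ := by linarith [B.N_lt, B.N.cast_nonneg (α := ℝ)]

/-- The gain of one factor `|ε|` in each variable compensates `ε⁻²`, and the division by
`R_{D₁} R_{D₂}` recovers the `N` powers of `1 + |m|` lost by the polynomial factors. -/
theorem linOp_opV (P : Admissible S e₀ CP r₁ r₂ D₁ D₂ β ε)
    : LinOp D₁ D₂ (Wt ν₁ S.k₁ ε) (Wt ν₂ S.k₂ ε) (Ew β (μ - B.N)) (Ew β μ) B.kV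
    (S.opV ε) := by
  have hE0 := fun m => Ew_nonneg β (μ - B.N) m
  have hE1 := fun m => Ew_le_one P.β_nonneg (zero_le_one.trans B.one_lt_sub.le) m
  have h1 := linOp_opK_succ (D₁ := D₁) (D₂ := D₂) (Q := S.Q₁) B.ν₁_pos B.k₁_pos B.CP_pos B.r₁_pos
    B.RD₁_ne P.bound₁ P.ne_zero B.kernel₁ (b₂ := Wt ν₂ S.k₂ ε) Wt_nonneg (continuous_Wt _ _ _)
    hE0 hE1 B.le_δ₁
  have h2 := linOp_opK_succ (D₁ := D₂) (D₂ := D₁) (Q := S.Q₂) B.ν₂_pos B.k₂_pos B.CP_pos B.r₂_pos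
    B.RD₂_ne P.bound₂ P.ne_zero B.kernel₂ (b₂ := Wt ν₁ S.k₁ ε) Wt_nonneg (continuous_Wt _ _ _)
    hE0 hE1 B.le_δ₂
  have h3 := (h1.comp h2.swap).const_mul Wt_nonneg Wt_nonneg
    (ε ^ (-2 : ℤ) * ((Real.Gamma (((S.k₁ + 1 : ℕ) : ℝ) / S.k₁) : ℂ)
        * (Real.Gamma (((S.k₂ + 1 : ℕ) : ℝ) / S.k₂) : ℂ))⁻¹)
  have h4 : LinOp D₁ D₂ (Wt ν₁ S.k₁ ε) (Wt ν₂ S.k₂ ε) (Ew β (μ - B.N)) (Ew β μ) B.Cρ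
      (fun h τ₁ τ₂ m => (ev S.RD₁ m * ev S.RD₂ m)⁻¹ * h τ₁ τ₂ m) := by
    have hne : ∀ m, ev S.RD₁ m * ev S.RD₂ m ≠ 0 := fun m => mul_ne_zero (B.RD₁_ne m) (B.RD₂_ne m)
    refine LinOp.mulm Wt_nonneg Wt_nonneg
      (((continuous_ev _).mul (continuous_ev _)).inv₀ hne) B.Cρ_pos.le fun m => ?_
    rw [← B.pow_mul_Ew, ← mul_assoc, norm_inv]
    refine mul_le_mul_of_nonneg_right ?_ (Ew_nonneg _ _ _)
    rw [inv_mul_le_iff₀ (norm_pos_iff.2 (hne m)), mul_comm]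
    exact B.le_RD m
  refine (h4.comp h3).mono Wt_nonneg Wt_nonneg (Ew_nonneg _ _) (le_of_eq ?_)
  have hε : ‖ε‖ ≠ 0 := norm_ne_zero_iff.2 P.ne_zero
  rw [kV, norm_mul, norm_zpow]
  simp only [zpow_neg, zpow_ofNat]
  field_simp

theorem linOp_opR (P : Admissible S e₀ CP r₁ r₂ D₁ D₂ β ε)
    {l₁ l₂ : ℕ} (hl₁ : l₁ ∈ Finset.Icc 1 (S.D₁ - 1))
    (hl₂ : l₂ ∈ Finset.Icc 1 (S.D₂ - 1)) :
    LinOp D₁ D₂ (Wt ν₁ S.k₁ ε) (Wt ν₂ S.k₂ ε) (Ew β μ) (Ew β μ) (B.kR l₁ l₂ * ‖ε‖)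
      (S.opR ε l₁ l₂) := by
  have hE0 := fun m => Ew_nonneg β μ m
  have hE1 := fun m => Ew_le_one P.β_nonneg B.μ_nonneg m
  have h1 := linOp_opK_of_pos (D₁ := D₁) (D₂ := D₂) (Q := S.Q₁) B.ν₁_pos B.k₁_pos B.CP_pos B.r₁_pos
    B.RD₁_ne P.bound₁ P.ne_zero B.kernel₁ (b₂ := Wt ν₂ S.k₂ ε) Wt_nonneg (continuous_Wt _ _ _)
    hE0 hE1 (B.one_le_dk₁ _ hl₁) (B.one_le_δ₁ _ hl₁) (B.δ_le₁ _ hl₁)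
  have h2 := linOp_opK_of_pos (D₁ := D₂) (D₂ := D₁) (Q := S.Q₂) B.ν₂_pos B.k₂_pos B.CP_pos B.r₂_pos
    B.RD₂_ne P.bound₂ P.ne_zero B.kernel₂ (b₂ := Wt ν₁ S.k₁ ε) Wt_nonneg (continuous_Wt _ _ _)
    hE0 hE1 (B.one_le_dk₂ _ hl₂) (B.one_le_δ₂ _ hl₂) (B.δ_le₂ _ hl₂)
  have h3 := (h1.comp h2.swap).const_mul Wt_nonneg Wt_nonneg
    (ε ^ ((S.Δ l₁ l₂ : ℤ) - S.d l₁ - S.d' l₂ + S.δ l₁ + S.δ' l₂ - 2) * S.lowerCoeff l₁ l₂)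
  have h4 : LinOp D₁ D₂ (Wt ν₁ S.k₁ ε) (Wt ν₂ S.k₂ ε) (Ew β μ) (Ew β μ) (B.CR l₁ l₂)
      (fun h τ₁ τ₂ m => (ev (S.R l₁ l₂) m * (ev S.RD₁ m * ev S.RD₂ m)⁻¹) * h τ₁ τ₂ m) := by
    have hne : ∀ m, ev S.RD₁ m * ev S.RD₂ m ≠ 0 := fun m => mul_ne_zero (B.RD₁_ne m) (B.RD₂_ne m)
    refine LinOp.mulm Wt_nonneg Wt_nonneg ((continuous_ev _).mul
      (((continuous_ev _).mul (continuous_ev _)).inv₀ hne)) (B.CR_nonneg _ _) fun m => ?_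
    refine mul_le_mul_of_nonneg_right ?_ (Ew_nonneg _ _ _)
    rw [norm_mul, norm_inv, ← div_eq_mul_inv, div_le_iff₀ (norm_pos_iff.2 (hne m))]
    exact B.R_le _ hl₁ _ hl₂ m
  refine (h4.comp h3).mono Wt_nonneg Wt_nonneg (Ew_nonneg _ _) ?_
  have hε : 0 < ‖ε‖ := norm_pos_iff.2 P.ne_zero
  -- the gains of the two Volterra operators outweigh the negative power of `ε`
  have key : ‖ε‖ ^ ((S.Δ l₁ l₂ : ℤ) - S.d l₁ - S.d' l₂ + S.δ l₁ + S.δ' l₂ - 2)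
      * (‖ε‖ ^ dk S.k₁ (S.δ l₁) (S.d l₁) * ‖ε‖ ^ dk S.k₂ (S.δ' l₂) (S.d' l₂)) ≤ ‖ε‖ := by
    rw [← zpow_natCast, ← zpow_natCast, ← zpow_add₀ hε.ne', ← zpow_add₀ hε.ne', ← add_assoc]
    calc _ ≤ ‖ε‖ ^ (1 : ℤ) := zpow_le_zpow_right_of_le_one₀ hε P.norm_le_one
            (B.one_le_exp _ hl₁ _ hl₂)
      _ = _ := zpow_one _
  rw [norm_mul, norm_zpow]
  have c1 := B.C₁_pos (B.one_le_dk₁ _ hl₁)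
  have c2 := B.C₂_pos (B.one_le_dk₂ _ hl₂)
  have c3 := B.low₁_pos
  have c4 := B.low₂_pos
  have c5 := B.CR_nonneg l₁ l₂
  refine le_trans (le_of_eq ?_) (mul_le_mul_of_nonneg_left key (B.kR_nonneg hl₁ hl₂))
  rw [kR]
  ring

theorem linOp_linPart (P : Admissible S e₀ CP r₁ r₂ D₁ D₂ β ε) :
    LinOp D₁ D₂ (Wt ν₁ S.k₁ ε) (Wt ν₂ S.k₂ ε) (Ew β μ) (Ew β μ) (B.kL * ‖ε‖) (S.linPart ε) := by
  have hE0 := fun m => Ew_nonneg β μ m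
  have hE1 := fun m => Ew_le_one P.β_nonneg B.μ_nonneg m
  have h1 := linOp_opA (D₁ := D₁) (D₂ := D₂) (Q := S.Q₁) B.ν₁_pos B.k₁_pos B.CP_pos B.r₁_pos
    B.RD₁_ne P.bound₁ P.ne_zero P.norm_le_one B.kernel₁ (b₂ := Wt ν₂ S.k₂ ε) Wt_nonneg
    (continuous_Wt _ _ _) hE0 hE1
  have h2 := (linOp_opA (D₁ := D₂) (D₂ := D₁) (Q := S.Q₂) B.ν₂_pos B.k₂_pos B.CP_pos B.r₂_pos
    B.RD₂_ne P.bound₂ P.ne_zero P.norm_le_one B.kernel₂ (b₂ := Wt ν₁ S.k₁ ε) Wt_nonneg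
    (continuous_Wt _ _ _) hE0 hE1).swap
  have h3 := (h1.comp h2).const_mul Wt_nonneg Wt_nonneg (-1)
  have h4 := LinOp.sum (Finset.Icc 1 (S.D₁ - 1)) fun l₁ hl₁ =>
    LinOp.sum (Finset.Icc 1 (S.D₂ - 1)) fun l₂ hl₂ => B.linOp_opR P hl₁ hl₂
  refine (((h2.add h1).add h3).add h4).mono Wt_nonneg Wt_nonneg (Ew_nonneg _ _) ?_
  have c1 := constA_nonneg (δ := S.δ S.D₁) B.k₁_pos B.CP_pos B.r₁_pos B.kernel₁
  have c2 := constA_nonneg (δ := S.δ' S.D₂) B.k₂_pos B.CP_pos B.r₂_pos B.kernel₂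
  have hε : ‖ε‖ * ‖ε‖ ≤ ‖ε‖ := mul_le_of_le_one_left (norm_nonneg _) P.norm_le_one
  rw [kL, norm_neg, norm_one, one_mul]
  simp only [add_mul, Finset.sum_mul]
  refine add_le_add (add_le_add le_rfl ?_) le_rfl
  calc _ = constA S.k₁ (S.δ S.D₁) CP r₁ B.C₁ * constA S.k₂ (S.δ' S.D₂) CP r₂ B.C₂
        * (‖ε‖ * ‖ε‖) := by ring
    _ ≤ _ := by gcongr

theorem linOp_opConv (P : Admissible S e₀ CP r₁ r₂ D₁ D₂ β ε)
    {b₁ b₂ : ℂ → ℝ} {μ₁ μ₂ : Measure ℝ} [SFinite μ₁] [SFinite μ₂] {κ₁ κ₂ : ℝ → ℝ}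
    {C C' N : ℝ} {f : ℂ → ℂ → ℝ → ℂ}
    (H₁ : ConvKernel S.k₁ b₁ (Wt ν₁ S.k₁ ε) μ₁ κ₁ C) (H₂ : ConvKernel S.k₂ b₂ (Wt ν₂ S.k₂ ε) μ₂ κ₂ C')
    (hb₁ : ∀ τ, 0 ≤ b₁ τ) (hb₂ : ∀ τ, 0 ≤ b₂ τ)
    {p : ℂ[X]} (hp : ∀ m, ‖ev p m‖ ≤ B.M * (1 + |m|) ^ B.N)
    (hf : Mem D₁ D₂ b₁ b₂ (Ew β (μ - B.N)) N f) :
    LinOp D₁ D₂ (Wt ν₁ S.k₁ ε) (Wt ν₂ S.k₂ ε) (Ew β μ) (Ew β μ)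
      (B.kV * (C * C' * B.c₃ * B.M) * N) (fun h => S.opV ε (S.opConv μ₁ μ₂ κ₁ κ₂ p f h)) := by
  have h1 := linOp_bil_right H₁ H₂ hb₁ hb₂ Wt_nonneg Wt_nonneg (Ew_nonneg β (μ - B.N))
    (Ew_le_one P.β_nonneg (zero_le_one.trans B.one_lt_sub.le)) (continuous_Ew _ _)
    (integrable_Ew P.β_nonneg B.one_lt_sub) B.c₃_nonneg (B.conv₃ β P.β_nonneg) hf
  refine ((B.linOp_opV P).comp ((h1.comp (B.linOp_evMul hp)).const_mul Wt_nonneg Wt_nonneg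
    fourierConst)).mono Wt_nonneg Wt_nonneg (Ew_nonneg _ _) ?_
  have h2 := B.kV_nonneg
  have h3 := H₁.const_nonneg
  have h4 := H₂.const_nonneg
  have h5 := B.c₃_nonneg
  have h6 := B.M_pos
  have h7 := hf.nonneg
  calc _ ≤ B.kV * (1 * (C * C' * B.c₃ * N * B.M)) := by
        gcongr
        exact norm_fourierConst_le
    _ = _ := by ring

/-- A bound for the norm of `dataPart`, for data of norms at most `ζ₁, ζ₁₁, ζ₁₂, ζ₁₀`. -/
def kD (ζ₁ ζ₁₁ ζ₁₂ ζ₁₀ : ℝ) : ℝ :=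
  B.kV * (B.c₁ * B.c₂ * B.c₃ * B.M) * ζ₁ + B.kV * (B.c₁ * 1 * B.c₃ * B.M) * ζ₁₁
    + B.kV * (1 * B.c₂ * B.c₃ * B.M) * ζ₁₂ + B.kV * (1 * 1 * B.c₃ * B.M) * ζ₁₀

/-- A bound for the norm of the bilinear map `quadPart`. -/
def kQ : ℝ := B.kV * (B.c₁ * B.c₂ * B.c₃ * B.M) * B.M

theorem kQ_nonneg : 0 ≤ B.kQ := by
  have h2 := B.kV_nonneg
  have h3 := (B.conv₁ 0).const_nonneg
  have h4 := (B.conv₂ 0).const_nonneg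
  have h5 := B.c₃_nonneg
  have h6 := B.M_pos
  unfold kQ
  positivity

theorem linOp_dataPart (P : Admissible S e₀ CP r₁ r₂ D₁ D₂ β ε)
    {φ : ℂ → ℂ → ℝ → ℂ} {φ₁ φ₂ : ℂ → ℝ → ℂ} {C₀₀ : ℝ → ℂ} {ζ₁ ζ₁₁ ζ₁₂ ζ₁₀ : ℝ}
    (hφ : Mem D₁ D₂ (Wt ν₁ S.k₁ ε) (Wt ν₂ S.k₂ ε) (Ew β (μ - B.N)) ζ₁ φ)
    (hφ₁ : Mem D₁ D₂ (Wt ν₁ S.k₁ ε) (fun _ => 1) (Ew β (μ - B.N)) ζ₁₁ (fun τ₁ _ m => φ₁ τ₁ m))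
    (hφ₂ : Mem D₁ D₂ (fun _ => 1) (Wt ν₂ S.k₂ ε) (Ew β (μ - B.N)) ζ₁₂ (fun _ τ₂ m => φ₂ τ₂ m))
    (hC : Mem D₁ D₂ (fun _ => 1) (fun _ => 1) (Ew β (μ - B.N)) ζ₁₀ (fun _ _ m => C₀₀ m)) :
    LinOp D₁ D₂ (Wt ν₁ S.k₁ ε) (Wt ν₂ S.k₂ ε) (Ew β μ) (Ew β μ) (B.kD ζ₁ ζ₁₁ ζ₁₂ ζ₁₀)
      (S.dataPart ε φ φ₁ φ₂ C₀₀) := by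
  have d₁ := convKernel_dirac S.k₁ (continuous_Wt ν₁ S.k₁ ε)
  have d₂ := convKernel_dirac S.k₂ (continuous_Wt ν₂ S.k₂ ε)
  have h1 : ∀ _ : ℂ, (0 : ℝ) ≤ 1 := fun _ => zero_le_one
  exact (((B.linOp_opConv P (B.conv₁ ε) (B.conv₂ ε) Wt_nonneg Wt_nonneg B.R₀_le hφ).add
    (B.linOp_opConv P (B.conv₁ ε) d₂ Wt_nonneg h1 B.R₀_le hφ₁)).add
    (B.linOp_opConv P d₁ (B.conv₂ ε) h1 Wt_nonneg B.R₀_le hφ₂)).add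
    (B.linOp_opConv P d₁ d₂ h1 h1 B.R₀_le hC)

theorem linOp_quadPart_right (P : Admissible S e₀ CP r₁ r₂ D₁ D₂ β ε) {f : ℂ → ℂ → ℝ → ℂ} {N : ℝ}
    (hf : Mem D₁ D₂ (Wt ν₁ S.k₁ ε) (Wt ν₂ S.k₂ ε) (Ew β μ) N f) :
    LinOp D₁ D₂ (Wt ν₁ S.k₁ ε) (Wt ν₂ S.k₂ ε) (Ew β μ) (Ew β μ) (B.kQ * N)
      (S.quadPart ε f) := by
  rw [kQ, mul_assoc]
  exact B.linOp_opConv P (B.conv₁ ε) (B.conv₂ ε) Wt_nonneg Wt_nonneg (B.P₂_le ε P.mem_ball)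
    ((B.linOp_evMul (B.P₁_le ε P.mem_ball)).mem hf)

theorem linOp_quadPart_left (P : Admissible S e₀ CP r₁ r₂ D₁ D₂ β ε) {g : ℂ → ℂ → ℝ → ℂ} {N : ℝ}
    (hg : Mem D₁ D₂ (Wt ν₁ S.k₁ ε) (Wt ν₂ S.k₂ ε) (Ew β μ) N g) :
    LinOp D₁ D₂ (Wt ν₁ S.k₁ ε) (Wt ν₂ S.k₂ ε) (Ew β μ) (Ew β μ) (B.kQ * N)
      (fun f => S.quadPart ε f g) := by
  have h1 := linOp_bil_left (B.conv₁ ε) (B.conv₂ ε) Wt_nonneg Wt_nonneg (Ew_nonneg β (μ - B.N))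
    (Ew_le_one P.β_nonneg (zero_le_one.trans B.one_lt_sub.le)) (continuous_Ew _ _)
    (integrable_Ew P.β_nonneg B.one_lt_sub) B.c₃_nonneg (B.conv₃ β P.β_nonneg)
    ((B.linOp_evMul (B.P₂_le ε P.mem_ball)).mem hg)
  refine ((B.linOp_opV P).comp ((h1.comp (B.linOp_evMul (B.P₁_le ε P.mem_ball))).const_mul
    Wt_nonneg Wt_nonneg fourierConst)).mono Wt_nonneg Wt_nonneg (Ew_nonneg _ _) ?_
  have h2 := B.kV_nonneg
  have h3 := (B.conv₁ ε).const_nonneg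
  have h4 := (B.conv₂ ε).const_nonneg
  have h5 := B.c₃_nonneg
  have h6 := B.M_pos
  have h7 := hg.nonneg
  calc _ ≤ B.kV * (1 * (B.c₁ * B.c₂ * B.c₃ * (B.M * N) * B.M)) := by
        gcongr
        exact norm_fourierConst_le
    _ = _ := by rw [kQ]; ring

end Bounds

end estimates

/-! ### Equivalence of the equation with the fixed point problem -/

theorem volterra₂_const_mul (k₁ k₂ n₁ n₂ : ℕ) (c : ℂ) (g : ℂ → ℂ → ℂ) (τ₁ τ₂ : ℂ) :
    volterra₂ k₁ k₂ n₁ n₂ (fun σ₁ σ₂ => c * g σ₁ σ₂) τ₁ τ₂ = c * volterra₂ k₁ k₂ n₁ n₂ g τ₁ τ₂ := by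
  simp only [volterra₂, volterra_const_mul]
  ring

section equation

variable {S : Params} {e₀ μ ν₁ ν₂ CP r₁ r₂ β : ℝ} {ε : ℂ} {τ₁ τ₂ : ℂ}

namespace Bounds

theorem one_le_δD₁ (B : Bounds S e₀ μ ν₁ ν₂ CP r₁ r₂) : 1 ≤ S.δ S.D₁ := by
  have h1 := B.le_δ₁
  have h2 : (0 : ℝ) ≤ 1 / S.k₁ := by positivity
  have : (1 : ℝ) ≤ S.δ S.D₁ := by linarith
  exact_mod_cast this

theorem one_le_δD₂ (B : Bounds S e₀ μ ν₁ ν₂ CP r₁ r₂) : 1 ≤ S.δ' S.D₂ := by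
  have h1 := B.le_δ₂
  have h2 : (0 : ℝ) ≤ 1 / S.k₂ := by positivity
  have : (1 : ℝ) ≤ S.δ' S.D₂ := by linarith
  exact_mod_cast this

theorem charPoly₁_ne (B : Bounds S e₀ μ ν₁ ν₂ CP r₁ r₂) (P : Admissible S e₀ CP r₁ r₂ D₁ D₂ β ε)
    (h₁ : τ₁ ∈ D₁.Ω) (m : ℝ) : charPoly S.k₁ (S.δ S.D₁) S.Q₁ S.RD₁ m τ₁ ≠ 0 :=
  charPoly_ne_zero B.CP_pos B.r₁_pos B.RD₁_ne P.bound₁ h₁ m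

theorem charPoly₂_ne (B : Bounds S e₀ μ ν₁ ν₂ CP r₁ r₂) (P : Admissible S e₀ CP r₁ r₂ D₁ D₂ β ε)
    (h₂ : τ₂ ∈ D₂.Ω) (m : ℝ) : charPoly S.k₂ (S.δ' S.D₂) S.Q₂ S.RD₂ m τ₂ ≠ 0 :=
  charPoly_ne_zero B.CP_pos B.r₂_pos B.RD₂_ne P.bound₂ h₂ m

theorem opV_eq (B : Bounds S e₀ μ ν₁ ν₂ CP r₁ r₂) (P : Admissible S e₀ CP r₁ r₂ D₁ D₂ β ε)
    (h₁ : τ₁ ∈ D₁.Ω) (h₂ : τ₂ ∈ D₂.Ω) (m : ℝ) {g : ℂ → ℂ → ℂ} {h : ℂ → ℂ → ℝ → ℂ}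
    (hg : ∀ σ₁ ∈ D₁.Ω, ∀ σ₂ ∈ D₂.Ω, g σ₁ σ₂ = h σ₁ σ₂ m) :
    ε ^ (-2 : ℤ) * volterra₂ S.k₁ S.k₂ (S.k₁ + 1) (S.k₂ + 1) g τ₁ τ₂
      = S.symbols m τ₁ τ₂ * S.opV ε h τ₁ τ₂ m := by
  have e := volterra₂_eq B.k₁_pos B.one_le_δD₁ B.k₂_pos B.one_le_δD₂ (n₁ := S.k₁ + 1) (q₁ := 0)
    (n₂ := S.k₂ + 1) (q₂ := 0) (by omega) (by omega) h (B.charPoly₁_ne P h₁ m)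
    (B.charPoly₂_ne P h₂ m)
  simp only [pow_zero, one_mul] at e
  have hne : ev S.RD₁ m * ev S.RD₂ m ≠ 0 := mul_ne_zero (B.RD₁_ne m) (B.RD₂_ne m)
  rw [volterra₂_congr h₁ h₂ hg, ← inv_mul_cancel_left₀ hne (volterra₂ _ _ _ _ _ _ _), e,
    Params.opV, Params.symbols, Params.opKK]
  ring

theorem opR_eq (B : Bounds S e₀ μ ν₁ ν₂ CP r₁ r₂) (P : Admissible S e₀ CP r₁ r₂ D₁ D₂ β ε)
    (h₁ : τ₁ ∈ D₁.Ω) (h₂ : τ₂ ∈ D₂.Ω) (m : ℝ) {l₁ l₂ : ℕ} (hl₁ : l₁ ∈ Finset.Icc 1 (S.D₁ - 1))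
    (hl₂ : l₂ ∈ Finset.Icc 1 (S.D₂ - 1)) (h : ℂ → ℂ → ℝ → ℂ) :
    ev (S.R l₁ l₂) m
          * ε ^ ((S.Δ l₁ l₂ : ℤ) - S.d l₁ - S.d' l₂ + S.δ l₁ + S.δ' l₂ - 2)
          * volterra₂ S.k₁ S.k₂ (dk S.k₁ (S.δ l₁) (S.d l₁)) (dk S.k₂ (S.δ' l₂) (S.d' l₂))
              (fun σ₁ σ₂ => (S.k₁ : ℂ) ^ S.δ l₁ * (S.k₂ : ℂ) ^ S.δ' l₂
                * (σ₁ ^ S.k₁) ^ S.δ l₁ * (σ₂ ^ S.k₂) ^ S.δ' l₂ * h σ₁ σ₂ m) τ₁ τ₂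
      = S.symbols m τ₁ τ₂ * S.opR ε l₁ l₂ h τ₁ τ₂ m := by
  have hk : ∀ {k n q : ℕ}, 1 ≤ q → k ≤ n + k * q := fun {k n q} hq =>
    (Nat.le_mul_of_pos_right k hq).trans (Nat.le_add_left _ _)
  have e := volterra₂_eq B.k₁_pos B.one_le_δD₁ B.k₂_pos B.one_le_δD₂
    (n₁ := dk S.k₁ (S.δ l₁) (S.d l₁)) (n₂ := dk S.k₂ (S.δ' l₂) (S.d' l₂))
    (hk (B.one_le_δ₁ _ hl₁)) (hk (B.one_le_δ₂ _ hl₂)) h (B.charPoly₁_ne P h₁ m)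
    (B.charPoly₂_ne P h₂ m)
  have hne : ev S.RD₁ m * ev S.RD₂ m ≠ 0 := mul_ne_zero (B.RD₁_ne m) (B.RD₂_ne m)
  rw [show (fun σ₁ σ₂ : ℂ => (S.k₁ : ℂ) ^ S.δ l₁ * (S.k₂ : ℂ) ^ S.δ' l₂
      * (σ₁ ^ S.k₁) ^ S.δ l₁ * (σ₂ ^ S.k₂) ^ S.δ' l₂ * h σ₁ σ₂ m)
      = fun σ₁ σ₂ => ((S.k₁ : ℂ) ^ S.δ l₁ * (S.k₂ : ℂ) ^ S.δ' l₂)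
        * ((σ₁ ^ S.k₁) ^ S.δ l₁ * ((σ₂ ^ S.k₂) ^ S.δ' l₂ * h σ₁ σ₂ m)) by
    funext σ₁ σ₂; ring, volterra₂_const_mul,
    ← inv_mul_cancel_left₀ hne (volterra₂ _ _ _ _ _ _ _), e,
    Params.opR, Params.symbols, Params.opKK, Params.lowerCoeff]
  ring

/-- Term by term, the right hand side of the equation is the product of the symbols with the fixed
point map. -/
theorem borelEq_iff (B : Bounds S e₀ μ ν₁ ν₂ CP r₁ r₂) (P : Admissible S e₀ CP r₁ r₂ D₁ D₂ β ε)
    {φ ψ ω : ℂ → ℂ → ℝ → ℂ} {φ₁ φ₂ : ℂ → ℝ → ℂ} {C₀₀ : ℝ → ℂ} {ζ₁ ζ₁₁ ζ₁₂ ζ₁₀ N : ℝ}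
    (hφ : Mem D₁ D₂ (Wt ν₁ S.k₁ ε) (Wt ν₂ S.k₂ ε) (Ew β (μ - B.N)) ζ₁ φ)
    (hφ₁ : Mem D₁ D₂ (Wt ν₁ S.k₁ ε) (fun _ => 1) (Ew β (μ - B.N)) ζ₁₁ (fun τ₁ _ m => φ₁ τ₁ m))
    (hφ₂ : Mem D₁ D₂ (fun _ => 1) (Wt ν₂ S.k₂ ε) (Ew β (μ - B.N)) ζ₁₂ (fun _ τ₂ m => φ₂ τ₂ m))
    (hC : Mem D₁ D₂ (fun _ => 1) (fun _ => 1) (Ew β (μ - B.N)) ζ₁₀ (fun _ _ m => C₀₀ m))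
    (hω : Mem D₁ D₂ (Wt ν₁ S.k₁ ε) (Wt ν₂ S.k₂ ε) (Ew β μ) N ω)
    (h₁ : τ₁ ∈ D₁.Ω) (h₂ : τ₂ ∈ D₂.Ω) (m : ℝ) :
    BorelEq S ε φ φ₁ φ₂ C₀₀ ψ ω τ₁ τ₂ m ↔
      S.symbols m τ₁ τ₂ * ω τ₁ τ₂ m = S.symbols m τ₁ τ₂
        * ((S.linPart ε ω + S.dataPart ε φ φ₁ φ₂ C₀₀ ω) + S.quadPart ε ω ω + S.opV ε ψ) τ₁ τ₂ m := by
  have hE0 := Ew_nonneg β (μ - B.N)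
  have hE1 := Ew_le_one P.β_nonneg (zero_le_one.trans B.one_lt_sub.le)
  have hEc := continuous_Ew β (μ - B.N)
  have hEi := integrable_Ew P.β_nonneg B.one_lt_sub
  have z₁ := Wt_zero ν₁ S.k₁ ε
  have z₂ := Wt_zero ν₂ S.k₂ ε
  have d₁ := convKernel_dirac S.k₁ (continuous_Wt ν₁ S.k₁ ε)
  have d₂ := convKernel_dirac S.k₂ (continuous_Wt ν₂ S.k₂ ε)
  have g0 := (B.linOp_evMul B.R₀_le).mem hω
  have g1 := (B.linOp_evMul (B.P₁_le ε P.mem_ball)).mem hω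
  have g2 := (B.linOp_evMul (B.P₂_le ε P.mem_ball)).mem hω
  have tA₂ := borelA_eq_opA B.k₂_pos B.one_le_δD₂ (fun τ₂ τ₁ m => ω τ₁ τ₂ m) τ₁
    (B.charPoly₂_ne P h₂ m)
  have tA₁ := borelA_eq_opA B.k₁_pos B.one_le_δD₁ ω τ₂ (B.charPoly₁_ne P h₁ m)
  have tA₁₂ := borelA_borelA_eq B.k₁_pos B.one_le_δD₁ B.k₂_pos B.one_le_δD₂ ω
    (B.charPoly₁_ne P h₁ m) (B.charPoly₂_ne P h₂ m)
  have tR := Finset.sum_congr rfl fun l₁ hl₁ => Finset.sum_congr rfl fun l₂ hl₂ =>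
    B.opR_eq P h₁ h₂ m (l₁ := l₁) (l₂ := l₂) hl₁ hl₂ ω
  have tQ := B.opV_eq P h₁ h₂ m (h := S.opConv unitMeasure unitMeasure convKer convKer (S.P₂ ε)
    (fun τ₁ τ₂ m => ev (S.P₁ ε) m * ω τ₁ τ₂ m) ω) fun σ₁ k₁ σ₂ k₂ =>
    convol_convol_eq hE0 hE1 hEc hEi z₁ z₂ (B.conv₁ ε) (B.conv₂ ε) g1 g2 B.k₁_pos B.k₂_pos k₁ k₂ m
  have tφ := B.opV_eq P h₁ h₂ m (h := S.opConv unitMeasure unitMeasure convKer convKer S.R₀ φ ω)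
    fun σ₁ k₁ σ₂ k₂ => convol_convol_eq hE0 hE1 hEc hEi z₁ z₂ (B.conv₁ ε) (B.conv₂ ε) hφ g0
      B.k₁_pos B.k₂_pos k₁ k₂ m
  have tφ₁ := B.opV_eq P h₁ h₂ m (h := S.opConv unitMeasure (Measure.dirac 1) convKer (fun _ => 1)
    S.R₀ (fun τ₁ _ m => φ₁ τ₁ m) ω)
    fun σ₁ k₁ σ₂ k₂ => convol_left_eq hE0 hE1 hEc hEi z₁ (B.conv₁ ε) d₂ hφ₁ g0 B.k₁_pos k₁ k₂ m
  have tφ₂ := B.opV_eq P h₁ h₂ m (h := S.opConv (Measure.dirac 1) unitMeasure (fun _ => 1) convKer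
    S.R₀ (fun _ τ₂ m => φ₂ τ₂ m) ω)
    fun σ₁ k₁ σ₂ k₂ => convol_right_eq hE0 hE1 hEc hEi z₂ d₁ (B.conv₂ ε) hφ₂ g0 B.k₂_pos k₁ k₂ m
  have tC := B.opV_eq P h₁ h₂ m (h := S.opConv (Measure.dirac 1) (Measure.dirac 1) (fun _ => 1)
    (fun _ => 1) S.R₀ (fun _ _ m => C₀₀ m) ω)
    fun σ₁ k₁ σ₂ k₂ => fconv_eq hE0 hE1 hEc hEi d₁ d₂ hC g0 k₁ k₂ m
  have tψ := B.opV_eq P h₁ h₂ m (h := ψ) fun σ₁ _ σ₂ _ => rfl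
  rw [BorelEq, tR, tQ, tφ, tφ₁, tφ₂, tC, tψ, tA₁₂]
  rw [mul_assoc (symb S.k₁ _ _ _ _ _) (ev S.RD₂ m), tA₂,
    mul_assoc (symb S.k₂ _ _ _ _ _) (ev S.RD₁ m), tA₁]
  simp only [← Finset.mul_sum]
  rw [← Params.symbols]
  refine Eq.congr_right ?_
  simp only [Params.linPart, Params.dataPart, Params.quadPart, Pi.add_apply, Finset.sum_apply,
    Params.symbols, swapOp]
  ring

/-- On functions vanishing for `τ₁ = 0` and for `τ₂ = 0` the symbols can be cancelled. -/
theorem symbols_mul_left_cancel (B : Bounds S e₀ μ ν₁ ν₂ CP r₁ r₂)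
    (P : Admissible S e₀ CP r₁ r₂ D₁ D₂ β ε) {f g : ℂ → ℂ → ℝ → ℂ} {N N' : ℝ}
    (hf : Mem D₁ D₂ (Wt ν₁ S.k₁ ε) (Wt ν₂ S.k₂ ε) (Ew β μ) N f)
    (hg : Mem D₁ D₂ (Wt ν₁ S.k₁ ε) (Wt ν₂ S.k₂ ε) (Ew β μ) N' g)
    (h₁ : τ₁ ∈ D₁.Ω) (h₂ : τ₂ ∈ D₂.Ω) (m : ℝ)
    (h : S.symbols m τ₁ τ₂ * f τ₁ τ₂ m = S.symbols m τ₁ τ₂ * g τ₁ τ₂ m) :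
    f τ₁ τ₂ m = g τ₁ τ₂ m := by
  by_cases hτ : τ₁ ≠ 0 ∧ τ₂ ≠ 0
  · refine mul_left_cancel₀ ?_ h
    rw [Params.symbols, symb_eq _ B.one_le_δD₁, symb_eq _ B.one_le_δD₂]
    exact mul_ne_zero (mul_ne_zero (pow_ne_zero _ hτ.1) (B.charPoly₁_ne P h₁ m))
      (mul_ne_zero (pow_ne_zero _ hτ.2) (B.charPoly₂_ne P h₂ m))
  · have hW : Wt ν₁ S.k₁ ε τ₁ * Wt ν₂ S.k₂ ε τ₂ = 0 := by
      by_cases h0 : τ₁ = 0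
      · rw [h0, Wt_zero, zero_mul]
      · rw [show τ₂ = 0 by tauto, Wt_zero, mul_zero]
    have e1 := hf.bd _ h₁ _ h₂ m
    have e2 := hg.bd _ h₁ _ h₂ m
    rw [hW, zero_mul, mul_zero, norm_le_zero_iff] at e1 e2
    rw [e1, e2]

/-- Existence and uniqueness in the ball of radius `ϖ`, for data which are small with respect to
the constants of the problem. -/
theorem exists_unique_solution (B : Bounds S e₀ μ ν₁ ν₂ CP r₁ r₂)
    (P : Admissible S e₀ CP r₁ r₂ D₁ D₂ β ε)
    {φ ψ : ℂ → ℂ → ℝ → ℂ} {φ₁ φ₂ : ℂ → ℝ → ℂ} {C₀₀ : ℝ → ℂ} {ζ₁ ζ₂ ζ₁₁ ζ₁₂ ζ₁₀ ϖ : ℝ}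
    (hφ : Mem D₁ D₂ (Wt ν₁ S.k₁ ε) (Wt ν₂ S.k₂ ε) (Ew β (μ - B.N)) ζ₁ φ)
    (hψ : Mem D₁ D₂ (Wt ν₁ S.k₁ ε) (Wt ν₂ S.k₂ ε) (Ew β (μ - B.N)) ζ₂ ψ)
    (hφ₁ : Mem D₁ D₂ (Wt ν₁ S.k₁ ε) (fun _ => 1) (Ew β (μ - B.N)) ζ₁₁ (fun τ₁ _ m => φ₁ τ₁ m))
    (hφ₂ : Mem D₁ D₂ (fun _ => 1) (Wt ν₂ S.k₂ ε) (Ew β (μ - B.N)) ζ₁₂ (fun _ τ₂ m => φ₂ τ₂ m))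
    (hC : Mem D₁ D₂ (fun _ => 1) (fun _ => 1) (Ew β (μ - B.N)) ζ₁₀ (fun _ _ m => C₀₀ m))
    (hL : B.kL * ‖ε‖ ≤ 1 / 8) (hD : B.kD ζ₁ ζ₁₁ ζ₁₂ ζ₁₀ ≤ 1 / 8) (hϖ : 0 ≤ ϖ)
    (hQ : B.kQ * ϖ ≤ 1 / 8) (hV : B.kV * ζ₂ ≤ ϖ / 4) :
    ∃ ω, (Mem D₁ D₂ (Wt ν₁ S.k₁ ε) (Wt ν₂ S.k₂ ε) (Ew β μ) ϖ ω ∧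
        ∀ τ₁ ∈ D₁.Ω, ∀ τ₂ ∈ D₂.Ω, ∀ m, BorelEq S ε φ φ₁ φ₂ C₀₀ ψ ω τ₁ τ₂ m) ∧
      ∀ ω', Mem D₁ D₂ (Wt ν₁ S.k₁ ε) (Wt ν₂ S.k₂ ε) (Ew β μ) ϖ ω' →
        (∀ τ₁ ∈ D₁.Ω, ∀ τ₂ ∈ D₂.Ω, ∀ m, BorelEq S ε φ φ₁ φ₂ C₀₀ ψ ω' τ₁ τ₂ m) →
        ∀ τ₁ ∈ D₁.Ω, ∀ τ₂ ∈ D₂.Ω, ∀ m, ω' τ₁ τ₂ m = ω τ₁ τ₂ m := by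
  have hE0 := Ew_nonneg β μ
  have hL' := (B.linOp_linPart P).add (B.linOp_dataPart P hφ hφ₁ hφ₂ hC)
  have hc := ((B.linOp_opV P).mem hψ).mono Wt_nonneg Wt_nonneg hE0 hV
  have hK : B.kL * ‖ε‖ + B.kD ζ₁ ζ₁₁ ζ₁₂ ζ₁₀ ≤ 1 / 4 := by linarith
  have hmem := fun {h} hh => mem_quadratic (h := h) Wt_nonneg Wt_nonneg hE0 hL'
    (B.linOp_quadPart_right P) hc hK hQ hh
  have hcon := fun {h h' N} => contraction_quadratic (h := h) (h' := h') (N := N) Wt_nonneg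
    Wt_nonneg hE0 hL' (B.linOp_quadPart_right P) (B.linOp_quadPart_left P) hc hK hQ
  obtain ⟨ω, hω, hfix⟩ := exists_fixedPoint (continuous_Wt _ _ _) (continuous_Wt _ _ _) Wt_nonneg
    Wt_nonneg hE0 (Ew_le_one P.β_nonneg B.μ_nonneg) hϖ hmem hcon
  refine ⟨ω, ⟨hω, fun τ₁ h₁ τ₂ h₂ m => ?_⟩, fun ω' hω' heq' => ?_⟩
  · rw [B.borelEq_iff P hφ hφ₁ hφ₂ hC hω h₁ h₂ m]
    exact congrArg _ (hfix τ₁ h₁ τ₂ h₂ m)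
  · refine fixedPoint_unique hcon hω hω' hfix fun τ₁ h₁ τ₂ h₂ m => ?_
    exact B.symbols_mul_left_cancel P hω' (hmem hω') h₁ h₂ m
      ((B.borelEq_iff P hφ hφ₁ hφ₂ hC hω' h₁ h₂ m).1 (heq' τ₁ h₁ τ₂ h₂ m))

end Bounds

end equation

/-! ### Existence of the constants -/

theorem ev_mul (p q : ℂ[X]) (m : ℝ) : ev (p * q) m = ev p m * ev q m := by simp [ev]

theorem exists_uniform_norm_ev_le {P : ℂ → ℂ[X]} {e₀ : ℝ} {N : ℕ}
    (hP : ∀ i, AnalyticOnNhd ℂ (fun ε => (P ε).coeff i) (Metric.closedBall 0 e₀))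
    (hN : ∀ ε ∈ Metric.closedBall (0 : ℂ) e₀, (P ε).natDegree ≤ N) :
    ∃ M : ℝ, 0 < M ∧ ∀ ε ∈ Metric.closedBall (0 : ℂ) e₀, ∀ m, ‖ev (P ε) m‖ ≤ M * (1 + |m|) ^ N := by
  choose B hB using fun i => (isCompact_closedBall (0 : ℂ) e₀).exists_bound_of_continuousOn
    (hP i).continuousOn
  set A := 1 + ∑ i ∈ Finset.range (N + 1), |B i| with hA
  have hA0 : 0 < A := by
    have : 0 ≤ ∑ i ∈ Finset.range (N + 1), |B i| := Finset.sum_nonneg fun _ _ => abs_nonneg _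
    positivity
  refine ⟨(N + 1) * A, by positivity, fun ε hε m => norm_ev_le (hN ε hε) (fun i => ?_) m⟩
  by_cases hi : i < N + 1
  · have h1 := Finset.single_le_sum (f := fun i => |B i|) (fun _ _ => abs_nonneg _)
      (Finset.mem_range.2 hi)
    have h2 := (hB i ε hε).trans (le_abs_self _)
    linarith
  · rw [Polynomial.coeff_eq_zero_of_natDegree_lt (by have := hN ε hε; omega), norm_zero]
    exact hA0.le

/-- The degrees of `P₁(·,ε)`, `P₂(·,ε)` and `R₀` have a common bound which satisfies the
assumptions made on each of them. -/
theorem Params.Standing.exists_degree {S : Params} {e₀ μ : ℝ} (hS : S.Standing e₀ μ) (he₀ : 0 < e₀) :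
    ∃ N : ℕ, (N : ℝ) + 1 < μ ∧ N ≤ (S.RD₁ * S.RD₂).natDegree ∧ S.R₀.natDegree ≤ N ∧
      ∀ ε ∈ Metric.closedBall (0 : ℂ) e₀, (S.P₁ ε).natDegree ≤ N ∧ (S.P₂ ε).natDegree ≤ N := by
  set g : ℂ → ℕ := fun ε => max (max (S.P₁ ε).natDegree (S.P₂ ε).natDegree) S.R₀.natDegree with hg
  set T := g '' Metric.closedBall (0 : ℂ) e₀ with hT
  have h0 : (0 : ℂ) ∈ Metric.closedBall (0 : ℂ) e₀ := Metric.mem_closedBall_self he₀.le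
  have hbd : BddAbove T := by
    refine ⟨(S.RD₁ * S.RD₂).natDegree, ?_⟩
    rintro _ ⟨ε, hε, rfl⟩
    exact max_le (max_le (hS.deg_P₁ ε hε) (hS.deg_P₂ ε hε)) hS.deg_R₀
  obtain ⟨ε', hε', he⟩ : sSup T ∈ T := Nat.sSup_mem ⟨g 0, 0, h0, rfl⟩ hbd
  have hle : ∀ ε ∈ Metric.closedBall (0 : ℂ) e₀, g ε ≤ sSup T := fun ε hε =>
    le_csSup hbd ⟨ε, hε, rfl⟩
  refine ⟨sSup T, ?_, ?_, (le_max_right _ _).trans (hle 0 h0), fun ε hε =>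
    ⟨((le_max_left _ _).trans (le_max_left _ _)).trans (hle ε hε),
      ((le_max_right _ _).trans (le_max_left _ _)).trans (hle ε hε)⟩⟩
  · rw [← he]
    obtain h | h | h : g ε' = (S.P₁ ε').natDegree ∨ g ε' = (S.P₂ ε').natDegree ∨
        g ε' = S.R₀.natDegree := by simp only [hg]; omega
    · rw [h]; exact hS.lt_μ_P₁ ε' hε'
    · rw [h]; exact hS.lt_μ_P₂ ε' hε'
    · rw [h]; exact hS.lt_μ_R₀
  · rw [← he]
    exact max_le (max_le (hS.deg_P₁ ε' hε') (hS.deg_P₂ ε' hε')) hS.deg_R₀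

theorem one_le_of_lt_succ {D : ℕ} {δ : ℕ → ℕ} (h1 : δ 1 = 1)
    (hlt : ∀ l ∈ Finset.Icc 1 (D - 1), δ l < δ (l + 1)) :
    ∀ l ∈ Finset.Icc 1 (D - 1), 1 ≤ δ l := by
  intro l hl
  obtain ⟨h, h'⟩ := Finset.mem_Icc.1 hl
  induction l, h using Nat.le_induction with
  | base => exact h1.ge
  | succ n hn ih =>
    have h2 : n ∈ Finset.Icc 1 (D - 1) := Finset.mem_Icc.2 ⟨hn, by omega⟩
    have := ih h2 (by omega)
    have := hlt n h2
    omega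

theorem dk_add {k δl dl : ℕ} (h1 : 1 ≤ δl) (hd : (δl - 1) * (k + 1) < dl) :
    1 ≤ dk k δl dl ∧ dk k δl dl + δl * (k + 1) = dl + k + 1 := by
  obtain ⟨j, rfl⟩ : ∃ j, δl = j + 1 := ⟨δl - 1, by omega⟩
  rw [Nat.add_sub_cancel] at hd
  rw [dk, add_mul, one_mul]
  omega

theorem mul_add_two_le {k a b : ℕ} (hk : 1 ≤ k) (h : (a : ℝ) + 2 / k ≤ b) : k * a + 2 ≤ k * b := by
  have hk0 : (0 : ℝ) < k := by exact_mod_cast hk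
  have h1 := mul_le_mul_of_nonneg_left h hk0.le
  rw [mul_add, mul_div_cancel₀ _ hk0.ne'] at h1
  exact_mod_cast h1

theorem add_one_div_le {k a b : ℕ} (h : (a : ℝ) + 2 / k ≤ b) : (a : ℝ) + 1 / k ≤ b := by
  have : 1 / (k : ℝ) ≤ 2 / k := by gcongr; norm_num
  linarith

theorem nonempty_bounds {S : Params} {e₀ μ ν₁ ν₂ CP r₁ r₂ : ℝ}
    (he₀ : 0 < e₀) (hν₁ : 0 < ν₁) (hν₂ : 0 < ν₂) (hCP : 0 < CP) (hr₁ : 0 < r₁) (hr₂ : 0 < r₂)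
    (hS : S.Standing e₀ μ)
    (hδ : ∀ l₁ ∈ Finset.Icc 1 (S.D₁ - 1), (S.δ l₁ : ℝ) + 2 / S.k₁ ≤ S.δ S.D₁)
    (hδ' : ∀ l₂ ∈ Finset.Icc 1 (S.D₂ - 1), (S.δ' l₂ : ℝ) + 2 / S.k₂ ≤ S.δ' S.D₂)
    (hΔ : ∀ l₁ ∈ Finset.Icc 1 (S.D₁ - 1), ∀ l₂ ∈ Finset.Icc 1 (S.D₂ - 1),
      (0 : ℤ) ≤ S.Δ l₁ l₂ + S.k₁ * (1 - S.δ S.D₁) + S.k₂ * (1 - S.δ' S.D₂) + 2) :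
    Nonempty (Bounds S e₀ μ ν₁ ν₂ CP r₁ r₂) := by
  obtain ⟨N, hNμ, hN, hR₀, hP⟩ := hS.exists_degree he₀
  obtain ⟨C₁, hC₁⟩ := exists_kernelConst hν₁ hS.k₁_pos
  obtain ⟨C₂, hC₂⟩ := exists_kernelConst hν₂ hS.k₂_pos
  obtain ⟨c₁, hc₁, hc₁'⟩ := exists_conv_bound hν₁ hS.k₁_pos
  obtain ⟨c₂, hc₂, hc₂'⟩ := exists_conv_bound hν₂ hS.k₂_pos
  obtain ⟨c₃, hc₃, hc₃'⟩ := exists_Ew_conv (s := μ - N) (by linarith)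
  obtain ⟨Cρ, hCρ, hCρ'⟩ := exists_le_norm_ev hS.RD_ne
  obtain ⟨M₁, hM₁, hM₁'⟩ := exists_uniform_norm_ev_le hS.analytic_P₁ fun ε hε => (hP ε hε).1
  obtain ⟨M₂, hM₂, hM₂'⟩ := exists_uniform_norm_ev_le hS.analytic_P₂ fun ε hε => (hP ε hε).2
  obtain ⟨M₀, hM₀, hM₀'⟩ := exists_norm_ev_le S.R₀
  choose CR hCR hCR' using fun l₁ l₂ => exists_norm_ev_le (S.R l₁ l₂)
  have h1 : ∀ m : ℝ, 1 ≤ 1 + |m| := fun m => by linarith [abs_nonneg m]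
  have hδ1 := one_le_of_lt_succ hS.δ_one hS.δ_lt
  have hδ2 := one_le_of_lt_succ hS.δ'_one hS.δ'_lt
  have hD₁ : 1 ∈ Finset.Icc 1 (S.D₁ - 1) := Finset.mem_Icc.2 ⟨le_rfl, by have := hS.two_le_D₁; omega⟩
  have hD₂ : 1 ∈ Finset.Icc 1 (S.D₂ - 1) := Finset.mem_Icc.2 ⟨le_rfl, by have := hS.two_le_D₂; omega⟩
  refine ⟨{
    k₁_pos := hS.k₁_pos
    k₂_pos := hS.k₂_pos
    ν₁_pos := hν₁
    ν₂_pos := hν₂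
    CP_pos := hCP
    r₁_pos := hr₁
    r₂_pos := hr₂
    RD₁_ne := fun m h => hS.RD_ne m (by rw [ev_mul, h, zero_mul])
    RD₂_ne := fun m h => hS.RD_ne m (by rw [ev_mul, h, mul_zero])
    le_δ₁ := by simpa [hS.δ_one] using add_one_div_le (hδ 1 hD₁)
    le_δ₂ := by simpa [hS.δ'_one] using add_one_div_le (hδ' 1 hD₂)
    N := N
    N_lt := hNμ
    C₁ := C₁
    C₂ := C₂
    kernel₁ := hC₁
    kernel₂ := hC₂
    c₁ := c₁
    c₂ := c₂
    c₃ := c₃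
    conv₁ := fun ε => convKernel_Wt hν₁ hS.k₁_pos ε hc₁ hc₁'
    conv₂ := fun ε => convKernel_Wt hν₂ hS.k₂_pos ε hc₂ hc₂'
    c₃_nonneg := hc₃.le
    conv₃ := hc₃'
    Cρ := Cρ
    Cρ_pos := hCρ
    le_RD := fun m => by
      rw [← ev_mul]
      exact (pow_le_pow_right₀ (h1 m) hN).trans (hCρ' m)
    M := M₁ + M₂ + M₀
    M_pos := by positivity
    P₁_le := fun ε hε m => (hM₁' ε hε m).trans (by gcongr; linarith)
    P₂_le := fun ε hε m => (hM₂' ε hε m).trans (by gcongr; linarith)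
    R₀_le := fun m => (hM₀' m).trans (by
      gcongr
      · linarith
      · exact h1 m)
    CR := fun l₁ l₂ => CR l₁ l₂ * Cρ
    CR_nonneg := fun l₁ l₂ => (mul_pos (hCR l₁ l₂) hCρ).le
    R_le := fun l₁ hl₁ l₂ hl₂ m => by
      rw [← ev_mul, mul_assoc]
      refine (hCR' l₁ l₂ m).trans (mul_le_mul_of_nonneg_left ?_ (hCR l₁ l₂).le)
      exact (pow_le_pow_right₀ (h1 m) (hS.deg_R _ hl₁ _ hl₂)).trans (hCρ' m)
    one_le_dk₁ := fun l hl => (dk_add (hδ1 l hl) (hS.lt_d l hl)).1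
    one_le_dk₂ := fun l hl => (dk_add (hδ2 l hl) (hS.lt_d' l hl)).1
    one_le_δ₁ := hδ1
    one_le_δ₂ := hδ2
    δ_le₁ := fun l hl => add_one_div_le (hδ l hl)
    δ_le₂ := fun l hl => add_one_div_le (hδ' l hl)
    one_le_exp := fun l₁ hl₁ l₂ hl₂ => by
      have e1 := (dk_add (hδ1 l₁ hl₁) (hS.lt_d l₁ hl₁)).2
      have e2 := (dk_add (hδ2 l₂ hl₂) (hS.lt_d' l₂ hl₂)).2
      have e3 := mul_add_two_le hS.k₁_pos (hδ l₁ hl₁)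
      have e4 := mul_add_two_le hS.k₂_pos (hδ' l₂ hl₂)
      have e5 := hΔ l₁ hl₁ l₂ hl₂
      zify at e1 e2 e3 e4
      linarith }⟩

theorem mul_div_add_one_le {a t : ℝ} (ha : 0 ≤ a) (ht : 0 ≤ t) : a * (t / (a + 1)) ≤ t := by
  rw [mul_div_assoc', div_le_iff₀ (by linarith)]
  nlinarith

end BorelPlane

end

open BorelPlane

theorem proposition11
    (S : Params) (e₀ μ ν₁ ν₂ CP r₁ r₂ dQ₁ dQ₂ η₁ η₂ : ℝ)
    (he₀ : 0 < e₀) (hν₁ : 0 < ν₁) (hν₂ : 0 < ν₂) (hCP : 0 < CP)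
    (hr₁ : 0 < r₁) (hr₂ : 0 < r₂) (hη₁ : 0 < η₁) (hη₂ : 0 < η₂)
    (hS : S.Standing e₀ μ)
    (hQ₁ : ∀ m : ℝ, ev S.Q₁ m / ev S.RD₁ m ∈ truncSector r₁ dQ₁ η₁)
    (hQ₂ : ∀ m : ℝ, ev S.Q₂ m / ev S.RD₂ m ∈ truncSector r₂ dQ₂ η₂)
    (hδ : ∀ l₁ ∈ Finset.Icc 1 (S.D₁ - 1), (S.δ l₁ : ℝ) + 2 / S.k₁ ≤ S.δ S.D₁)
    (hδ' : ∀ l₂ ∈ Finset.Icc 1 (S.D₂ - 1), (S.δ' l₂ : ℝ) + 2 / S.k₂ ≤ S.δ' S.D₂)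
    (hΔ : ∀ l₁ ∈ Finset.Icc 1 (S.D₁ - 1), ∀ l₂ ∈ Finset.Icc 1 (S.D₂ - 1),
      (0 : ℤ) ≤ S.Δ l₁ l₂ + S.k₁ * (1 - S.δ S.D₁) + S.k₂ * (1 - S.δ' S.D₂) + 2) :
    ∃ e : ℝ, 0 < e ∧ e ≤ e₀ ∧ ∀ ε₀ : ℝ, 0 < ε₀ → ε₀ ≤ e →
    ∃ ϖ ζ₁ ζ₂ ζ₁₁ ζ₁₂ ζ₁₀ : ℝ,
      0 < ϖ ∧ 0 < ζ₁ ∧ 0 < ζ₂ ∧ 0 < ζ₁₁ ∧ 0 < ζ₁₂ ∧ 0 < ζ₁₀ ∧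
    ∀ (β ρ d₁ θ₁ d₂ θ₂ : ℝ), 0 < β → 0 < ρ → 0 < θ₁ → 0 < θ₂ →
      CharPolyBound S.k₁ (S.δ S.D₁) S.Q₁ S.RD₁ CP r₁ (closedDom ρ d₁ θ₁) →
      CharPolyBound S.k₂ (S.δ' S.D₂) S.Q₂ S.RD₂ CP r₂ (closedDom ρ d₂ θ₂) →
    ∀ (C F : ℕ → ℕ → ℝ → ℂ → ℂ) (K₀ T₀ : ℝ), 0 < K₀ → 0 < T₀ →
      (∀ n₁ n₂, ∀ ε ∈ Metric.ball (0 : ℂ) ε₀,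
        MemE β μ (fun m => C n₁ n₂ m ε) ∧
        normE β μ (fun m => C n₁ n₂ m ε) ≤ ENNReal.ofReal (K₀ * (1 / T₀) ^ (n₁ + n₂))) →
      (∀ n₁ n₂, 1 ≤ n₁ → 1 ≤ n₂ → ∀ ε ∈ Metric.ball (0 : ℂ) ε₀,
        MemE β μ (fun m => F n₁ n₂ m ε) ∧
        normE β μ (fun m => F n₁ n₂ m ε) ≤ ENNReal.ofReal (K₀ * (1 / T₀) ^ (n₁ + n₂))) →
      (∀ ε ∈ Metric.ball (0 : ℂ) ε₀, ε ≠ 0 →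
        normF (closedDom ρ d₁ θ₁) (closedDom ρ d₂ θ₂) ν₁ ν₂ β μ S.k₁ S.k₂ ε
          (fun τ₁ τ₂ m => borel₂ S.k₁ S.k₂ (fun n₁ n₂ => C n₁ n₂ m ε) τ₁ τ₂)
            ≤ ENNReal.ofReal ζ₁ ∧
        normF (closedDom ρ d₁ θ₁) (closedDom ρ d₂ θ₂) ν₁ ν₂ β μ S.k₁ S.k₂ ε
          (fun τ₁ τ₂ m => borel₂ S.k₁ S.k₂ (fun n₁ n₂ => F n₁ n₂ m ε) τ₁ τ₂)
            ≤ ENNReal.ofReal ζ₂ ∧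
        normF₁ (closedDom ρ d₁ θ₁) ν₁ β μ S.k₁ ε
          (fun τ₁ m => borel₁ S.k₁ (fun n => C n 0 m ε) τ₁) ≤ ENNReal.ofReal ζ₁₁ ∧
        normF₁ (closedDom ρ d₂ θ₂) ν₂ β μ S.k₂ ε
          (fun τ₂ m => borel₁ S.k₂ (fun n => C 0 n m ε) τ₂) ≤ ENNReal.ofReal ζ₁₂ ∧
        normE β μ (fun m => C 0 0 m ε) ≤ ENNReal.ofReal ζ₁₀) →
      ∀ ε ∈ Metric.ball (0 : ℂ) ε₀, ε ≠ 0 →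
        ∃ ω : ℂ → ℂ → ℝ → ℂ,
          IsSolutionInBall S ν₁ ν₂ β μ ρ d₁ θ₁ d₂ θ₂ ϖ C F ε ω ∧
          ∀ ω' : ℂ → ℂ → ℝ → ℂ,
            IsSolutionInBall S ν₁ ν₂ β μ ρ d₁ θ₁ d₂ θ₂ ϖ C F ε ω' →
            ∀ τ₁ ∈ closedDom ρ d₁ θ₁, ∀ τ₂ ∈ closedDom ρ d₂ θ₂, ∀ m : ℝ,
              ω' τ₁ τ₂ m = ω τ₁ τ₂ m := by
  obtain ⟨B⟩ := nonempty_bounds he₀ hν₁ hν₂ hCP hr₁ hr₂ hS hδ hδ' hΔ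
  have hkL := B.kL_nonneg
  have hkV := B.kV_nonneg
  have hkQ := B.kQ_nonneg
  have hc₁ := (B.conv₁ 0).const_nonneg
  have hc₂ := (B.conv₂ 0).const_nonneg
  have hc₃ := B.c₃_nonneg
  have hM := B.M_pos
  have a₁ : 0 ≤ B.kV * (B.c₁ * B.c₂ * B.c₃ * B.M) := by positivity
  have a₁₁ : 0 ≤ B.kV * (B.c₁ * 1 * B.c₃ * B.M) := by positivity
  have a₁₂ : 0 ≤ B.kV * (1 * B.c₂ * B.c₃ * B.M) := by positivity
  have a₁₀ : 0 ≤ B.kV * (1 * 1 * B.c₃ * B.M) := by positivity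
  refine ⟨min (min e₀ 1) ((1 / 8) / (B.kL + 1)), by positivity,
    (min_le_left _ _).trans (min_le_left _ _), fun ε₀ hε₀ hε₀e => ?_⟩
  obtain ⟨hε₀', he3⟩ := le_min_iff.1 hε₀e
  obtain ⟨he1, he2⟩ := le_min_iff.1 hε₀'
  -- The constants do not depend on `ε₀`: each term of the fixed point map gets a fixed share of
  -- the contraction rate.
  set ϖ : ℝ := (1 / 8) / (B.kQ + 1) with hϖdef
  have hϖ : 0 < ϖ := by positivity
  set ζ₁ : ℝ := (1 / 32) / (B.kV * (B.c₁ * B.c₂ * B.c₃ * B.M) + 1) with hζ₁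
  set ζ₂ : ℝ := (ϖ / 4) / (B.kV + 1) with hζ₂
  set ζ₁₁ : ℝ := (1 / 32) / (B.kV * (B.c₁ * 1 * B.c₃ * B.M) + 1) with hζ₁₁
  set ζ₁₂ : ℝ := (1 / 32) / (B.kV * (1 * B.c₂ * B.c₃ * B.M) + 1) with hζ₁₂
  set ζ₁₀ : ℝ := (1 / 32) / (B.kV * (1 * 1 * B.c₃ * B.M) + 1) with hζ₁₀
  have p₁ : 0 < ζ₁ := by positivity
  have p₂ : 0 < ζ₂ := by positivity
  have p₁₁ : 0 < ζ₁₁ := by positivity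
  have p₁₂ : 0 < ζ₁₂ := by positivity
  have p₁₀ : 0 < ζ₁₀ := by positivity
  refine ⟨ϖ, ζ₁, ζ₂, ζ₁₁, ζ₁₂, ζ₁₀, hϖ, p₁, p₂, p₁₁, p₁₂, p₁₀, ?_⟩
  intro β ρ d₁ θ₁ d₂ θ₂ hβ hρ _ _ hP₁ hP₂ C F K₀ T₀ hK₀ hT₀ hC hF hdata ε hε hε0
  obtain ⟨nφ, nψ, nφ₁, nφ₂, nC⟩ := hdata ε hε hε0
  have hεn : ‖ε‖ < ε₀ := by simpa using hε
  have P : Admissible S e₀ CP r₁ r₂ (sectorDom ρ d₁ θ₁ hρ) (sectorDom ρ d₂ θ₂ hρ) β ε :=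
    ⟨hβ.le, hε0, by linarith, by simpa using (hεn.le.trans he1), hP₁, hP₂⟩
  have hT : 0 ≤ 1 / T₀ := by positivity
  have hEw := Ew_le_one hβ.le B.μ_nonneg
  have bC : ∀ n₁ n₂ m, ‖C n₁ n₂ m ε‖ ≤ K₀ * (1 / T₀) ^ (n₁ + n₂) := fun n₁ n₂ m =>
    ((normE_le_iff (by positivity) _).1 (hC n₁ n₂ ε hε).2 m).trans
      (mul_le_of_le_one_right (by positivity) (hEw m))
  have bF : ∀ n₁ n₂, 1 ≤ n₁ → 1 ≤ n₂ → ∀ m, ‖F n₁ n₂ m ε‖ ≤ K₀ * (1 / T₀) ^ (n₁ + n₂) :=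
    fun n₁ n₂ h₁ h₂ m =>
    ((normE_le_iff (by positivity) _).1 (hF n₁ n₂ h₁ h₂ ε hε).2 m).trans
      (mul_le_of_le_one_right (by positivity) (hEw m))
  have one_nonneg : ∀ _ : ℂ, (0 : ℝ) ≤ 1 := fun _ => zero_le_one
  have hφ := Mem.mono_weight Wt_nonneg Wt_nonneg (B.Ew_mono (β := β))
    (⟨reg_borel₂ hS.k₁_pos hS.k₂_pos hK₀.le hT (fun n₁ n₂ _ _ => (hC n₁ n₂ ε hε).1.1)
      (fun n₁ n₂ _ _ m => bC n₁ n₂ m), p₁.le, (normF_le_iff p₁.le _).1 nφ⟩ :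
      Mem (sectorDom ρ d₁ θ₁ hρ) (sectorDom ρ d₂ θ₂ hρ) (Wt ν₁ S.k₁ ε) (Wt ν₂ S.k₂ ε) (Ew β μ) ζ₁ _)
  have hψ := Mem.mono_weight Wt_nonneg Wt_nonneg (B.Ew_mono (β := β))
    (⟨reg_borel₂ hS.k₁_pos hS.k₂_pos hK₀.le hT (fun n₁ n₂ h₁ h₂ => (hF n₁ n₂ h₁ h₂ ε hε).1.1)
      bF, p₂.le, (normF_le_iff p₂.le _).1 nψ⟩ :
      Mem (sectorDom ρ d₁ θ₁ hρ) (sectorDom ρ d₂ θ₂ hρ) (Wt ν₁ S.k₁ ε) (Wt ν₂ S.k₂ ε) (Ew β μ) ζ₂ _)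
  have hφ₁ := Mem.mono_weight Wt_nonneg one_nonneg (B.Ew_mono (β := β))
    (⟨reg_borel₁ hS.k₁_pos hK₀.le hT (fun n => (hC n 0 ε hε).1.1)
      (fun n m => bC n 0 m), p₁₁.le, fun τ₁ h₁ τ₂ _ m => by
        rw [mul_one]; exact (normF₁_le_iff p₁₁.le _).1 nφ₁ τ₁ h₁ m⟩ :
      Mem (sectorDom ρ d₁ θ₁ hρ) (sectorDom ρ d₂ θ₂ hρ) (Wt ν₁ S.k₁ ε) (fun _ => 1) (Ew β μ) ζ₁₁
        (fun τ₁ _ m => borel₁ S.k₁ (fun n => C n 0 m ε) τ₁))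
  have hφ₂ := Mem.mono_weight one_nonneg Wt_nonneg (B.Ew_mono (β := β))
    (⟨(reg_borel₁ hS.k₂_pos hK₀.le hT (fun n => (hC 0 n ε hε).1.1)
      (fun n m => by simpa using bC 0 n m)).swap, p₁₂.le, fun τ₁ _ τ₂ h₂ m => by
        rw [one_mul]; exact (normF₁_le_iff p₁₂.le _).1 nφ₂ τ₂ h₂ m⟩ :
      Mem (sectorDom ρ d₁ θ₁ hρ) (sectorDom ρ d₂ θ₂ hρ) (fun _ => 1) (Wt ν₂ S.k₂ ε) (Ew β μ) ζ₁₂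
        (fun _ τ₂ m => borel₁ S.k₂ (fun n => C 0 n m ε) τ₂))
  have hC₀ := Mem.mono_weight one_nonneg one_nonneg (B.Ew_mono (β := β))
    (⟨Reg.of_continuous (hC 0 0 ε hε).1.1, p₁₀.le, fun τ₁ _ τ₂ _ m => by
        rw [one_mul, one_mul]; exact (normE_le_iff p₁₀.le _).1 nC m⟩ :
      Mem (sectorDom ρ d₁ θ₁ hρ) (sectorDom ρ d₂ θ₂ hρ) (fun _ => 1) (fun _ => 1) (Ew β μ) ζ₁₀
        (fun _ _ m => C 0 0 m ε))
  have hL : B.kL * ‖ε‖ ≤ 1 / 8 :=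
    (mul_le_mul_of_nonneg_left (hεn.le.trans he3) hkL).trans
      (mul_div_add_one_le hkL (by norm_num))
  have hD : B.kD ζ₁ ζ₁₁ ζ₁₂ ζ₁₀ ≤ 1 / 8 := by
    have t₁ := mul_div_add_one_le (t := 1 / 32) a₁ (by norm_num)
    have t₁₁ := mul_div_add_one_le (t := 1 / 32) a₁₁ (by norm_num)
    have t₁₂ := mul_div_add_one_le (t := 1 / 32) a₁₂ (by norm_num)
    have t₁₀ := mul_div_add_one_le (t := 1 / 32) a₁₀ (by norm_num)
    exact (add_le_add (add_le_add (add_le_add t₁ t₁₁) t₁₂) t₁₀).trans (by norm_num)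
  obtain ⟨ω, ⟨hω, heq⟩, huniq⟩ := B.exists_unique_solution P hφ hψ hφ₁ hφ₂ hC₀ hL hD hϖ.le
    (mul_div_add_one_le hkQ (by norm_num)) (mul_div_add_one_le hkV (by positivity))
  have hω' := (mem_iff_memF hρ hρ hϖ.le).1 hω
  exact ⟨ω, ⟨hω'.1, hω'.2, heq⟩, fun ω' h' =>
    huniq ω' ((mem_iff_memF hρ hρ hϖ.le).2 ⟨h'.mem, h'.norm_le⟩) h'.eqn⟩
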